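/- **Proposition (Type IIb/III singularity of a Ricci-like flow on contact Calabi–Yau manifolds).** *Conventions.* For a $G_2$-structure $\varphi$ on a 7-manifold $M$, with metric $g$ and volume form $\mathrm{vol}$ determined by $(X\lrcorner\varphi)\wedge(Y\lrcorner\varphi)\wedge\varphi=6\,g(X,Y)\,\mathrm{vol}$, let $\psi=*\varphi$, let the torsion $T$ be the 2-tensor with $\nabla_m\varphi_{ijk}=T_m{}^p\psi_{pijk}$, and put $(\mathsf VT)_k=T^{ij}\varphi_{ijk}$, $(\operatorname{Div}T)_i=\nabla^jT_{ji}$ and $(A\diamond\varphi)_{ijk}=A_i{}^p\varphi_{pjk}+A_j{}^p\varphi_{ipk}+A_k{}^p\varphi_{ijp}$. Consider the flow $$\frac{\partial\varphi}{\partial t}=\Big(-\mathrm{Ric}-\tfrac23\big(T\circ(\mathsf VT\lrcorner\varphi)\big)_{\rm sym}+(\operatorname{tr}T)\,T_{\rm sym}\Big)\diamond\varphi+\Big(\operatorname{Div}T+\tfrac13(\operatorname{tr}T)\mathsf VT-\tfrac13T^t(\mathsf VT)\Big)\lrcorner\psi .\qquad(*)$$ Let $\Lambda(t)=\sup_{x\in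 M}\Lambda(x,t)$, where $\Lambda(x,t)=\big(|\mathrm{Rm}|^2+|\nabla T|^2+|T|^4\big)^{1/2}$. A solution of $(*)$ on $[0,\infty)$ is said to have a *Type IIb* infinite-time singularity if $\sup_{t\in[0,\infty)}t\Lambda(t)=\infty$, and a *Type III* infinite-time singularity if $\sup_{t\in[0,\infty)}t\Lambda(t)<\infty$. A *contact Calabi–Yau* 7-manifold $(M,g_0,\eta_0,\Upsilon_0)$ is a Sasakian 7-manifold with metric $g_0$, contact form $\eta_0$ and transverse Kähler form $\omega_0=d\eta_0$, so that $g_0=\eta_0^2+g_{\mathcal D_0}$ with $\mathcal D_0=\ker\eta_0$, together with a nowhere vanishing closed transverse $(3,0)$-form $\Upsilon_0$ such that $\Upsilon_0\wedge\overline{\Upsilon_0}=-\tfrac{4i}{3}\,\omega_0^3$. *Statement.* Let $(M,g_0,\eta_0,\Upsilon_0)$ be a compact contact Calabi–Yau 7-manifold without boundary and let $a>0$. Put $$f_t=a\Big(1+\tfrac{25a^2}{2}t\Big)^{-3/10},\qquad h_t=\Big(1+\tfrac{25a^2}{2}t\Big)^{1/10},\qquad \varphi_t=f_th_t^2\,\eta_0\wedge\omega_0+h_t^3\,\mathrm{Re}\,\Upsilon_0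 .$$ Then $(\varphi_t)$ is a smooth family of $G_2$-structures which solves $(*)$ for $t\in\big(-\tfrac{2}{25a^2},\infty\big)$, with $\varphi_0=a\,\eta_0\wedge\omega_0+\mathrm{Re}\,\Upsilon_0$. If the transverse metric $g_{\mathcal D_0}$ is not flat (that is, if the curvature of its transverse Levi-Civita connection is not identically zero), then this solution has a Type IIb infinite-time singularity. If $g_{\mathcal D_0}$ is flat, then it has a Type III infinite-time singularity. -/

import Mathlib

open scoped Manifold ContDiff ENNReal

noncomputable section

namespace G2Flow

/-! ### Exterior algebra -/

section Wedge

variable {V : Type*} [AddCommGroup V] [Module ℝ V] [TopologicalSpace V]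
variable {K : Type*} [CommRing K] [Algebra ℝ K] [TopologicalSpace K] [IsTopologicalRing K]

/-- The wedge product of alternating forms as an algebraic alternating form, with the
normalization given by the sum over shuffles. -/
def wedgeAlg {k l : ℕ} (α : V [⋀^Fin k]→L[ℝ] K) (β : V [⋀^Fin l]→L[ℝ] K) :
    V [⋀^Fin (k + l)]→ₗ[ℝ] K :=
  ((LinearMap.mul' ℝ K).compAlternatingMap
    (α.toAlternatingMap.domCoprod β.toAlternatingMap)).domDomCongr finSumFinEquiv

theorem continuous_wedgeAlg {k l : ℕ} (α : V [⋀^Fin k]→L[ℝ] K) (β : V [⋀^Fin l]→L[ℝ] K) :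
    Continuous (fun v => wedgeAlg α β v) := by
  simp only [wedgeAlg, AlternatingMap.domDomCongr_apply, LinearMap.compAlternatingMap_apply,
    AlternatingMap.domCoprod_apply, sum_apply, map_sum]
  refine continuous_finsetSum _ fun σ _ => ?_
  induction σ using Quotient.inductionOn' with
  | _ σ =>
    change Continuous fun v : Fin (k + l) → V => LinearMap.mul' ℝ K
      (((Equiv.Perm.sign σ) • (MultilinearMap.domCoprod α.toAlternatingMap.toMultilinearMap
        β.toAlternatingMap.toMultilinearMap).domDomCongr σ) (v ∘ finSumFinEquiv))
    have h : Continuous fun v : Fin (k + l) → V =>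
        α (fun i => v (finSumFinEquiv (σ (Sum.inl i))))
          * β (fun j => v (finSumFinEquiv (σ (Sum.inr j)))) :=
      (α.cont.comp (continuous_pi fun i => continuous_apply _)).mul
        (β.cont.comp (continuous_pi fun i => continuous_apply _))
    rcases Int.units_eq_one_or (Equiv.Perm.sign σ) with hs | hs
    · rw [hs, one_smul]
      exact h
    · rw [hs, Units.neg_smul, one_smul]
      refine Continuous.congr h.neg fun v => ?_
      rw [neg_apply, map_neg]
      rfl

/-- The wedge product of alternating forms. -/
def wedge {k l : ℕ} (α : V [⋀^Fin k]→L[ℝ] K) (β : V [⋀^Fin l]→L[ℝ] K) :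
    V [⋀^Fin (k + l)]→L[ℝ] K :=
  { wedgeAlg α β with cont := continuous_wedgeAlg α β }

end Wedge

/-! ### Tensor calculus in coordinates on `ℝ⁷`

A covariant `k`-tensor is represented by its values on `k` vectors. A tensor field on an open
subset of `ℝ⁷` is a function of the base point. -/

/-- The model space `ℝ⁷`. -/
abbrev E7 : Type := EuclideanSpace ℝ (Fin 7)

/-- Covariant 2-tensors. -/
abbrev Tensor2 : Type := E7 → E7 → ℝ

/-- Alternating `k`-forms on `ℝ⁷`. -/
abbrev Alt (k : ℕ) : Type := E7 [⋀^Fin k]→L[ℝ] ℝ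

/-- The coordinate basis. -/
abbrev e (i : Fin 7) : E7 := EuclideanSpace.single i 1

/-- The inverse matrix `g^{ij}` of a metric. -/
def invGram (g : Tensor2) : Matrix (Fin 7) (Fin 7) ℝ :=
  (Matrix.of fun i j => g (e i) (e j))⁻¹

/-- The vector `g^{ij} α_i e_j` dual to a covector `α`. -/
def sharp (g : Tensor2) (α : E7 → ℝ) : E7 :=
  ∑ i, ∑ j, (invGram g i j * α (e i)) • e j

/-- The metric trace `g^{ij} b_{ij}`. -/
def trace (g b : Tensor2) : ℝ := ∑ i, ∑ j, invGram g i j * b (e i) (e j)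

/-- The squared norm `g^{i₁j₁} ⋯ g^{iₖjₖ} A_{i₁…iₖ} A_{j₁…jₖ}` of a covariant `k`-tensor. -/
def normSq (g : Tensor2) {k : ℕ} (A : (Fin k → E7) → ℝ) : ℝ :=
  ∑ i : Fin k → Fin 7, ∑ j : Fin k → Fin 7,
    (∏ a, invGram g (i a) (j a)) * A (fun a => e (i a)) * A (fun a => e (j a))

/-- The Christoffel symbols `Γ(X, Y)` of the Levi-Civita connection,
`Γ^k_{ij} = ½ g^{kl} (∂_i g_{jl} + ∂_j g_{il} - ∂_l g_{ij})`. -/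
def christoffel (g : E7 → Tensor2) (y X Y : E7) : E7 :=
  sharp (g y) fun Z => (1 / 2) * (fderiv ℝ (fun z => g z Y Z) y X
    + fderiv ℝ (fun z => g z X Z) y Y - fderiv ℝ (fun z => g z X Y) y Z)

/-- The Levi-Civita covariant derivative `∇_X Y` of vector fields. -/
def leviCivita (g : E7 → Tensor2) (X Y : E7 → E7) (y : E7) : E7 :=
  fderiv ℝ Y y (X y) + christoffel g y (X y) (Y y)

/-- The Levi-Civita covariant derivative `(∇_X A)(v)` of a covariant `k`-tensor field. -/
def nabla (g : E7 → Tensor2) {k : ℕ} (A : E7 → (Fin k → E7) → ℝ) (y X : E7)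
    (v : Fin k → E7) : ℝ :=
  fderiv ℝ (fun z => A z v) y X
    - ∑ i, A y (Function.update v i (christoffel g y X (v i)))

/-- The curvature `R(X, Y)Z = D_X D_Y Z - D_Y D_X Z - D_{[X, Y]} Z` of a connection `D`. It is
evaluated on the constant extensions of `X`, `Y`, `Z`, for which `[X, Y] = 0`. -/
def curvature (D : (E7 → E7) → (E7 → E7) → E7 → E7) (y X Y Z : E7) : E7 :=
  D (fun _ => X) (D (fun _ => Y) fun _ => Z) y - D (fun _ => Y) (D (fun _ => X) fun _ => Z) y

/-- The Riemann curvature tensor `Rm(X, Y, Z, W) = g(R(X, Y)Z, W)`. -/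
def riemann (g : E7 → Tensor2) (y : E7) (v : Fin 4 → E7) : ℝ :=
  g y (curvature (leviCivita g) y (v 0) (v 1) (v 2)) (v 3)

/-- The Ricci tensor `Ric(Y, Z) = tr (X ↦ R(X, Y)Z)`. -/
def ricci (g : E7 → Tensor2) (y : E7) : Tensor2 := fun Y Z =>
  ∑ i, curvature (leviCivita g) y (e i) Y Z i

/-- The symmetric part of a 2-tensor. -/
def symPart (A : Tensor2) : Tensor2 := fun X Y => (A X Y + A Y X) / 2

/-- The composition `(A ∘ B)_{ij} = g^{pq} A_{ip} B_{qj}`. -/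
def comp2 (g A B : Tensor2) : Tensor2 := fun X Y => trace g fun P Q => A X P * B Q Y

/-- `(A ⋄ γ)_{i₁…iₖ} = A_{i₁}^p γ_{p i₂…iₖ} + ⋯ + A_{iₖ}^p γ_{i₁…iₖ₋₁ p}`. -/
def diamond (g A : Tensor2) {k : ℕ} (γ : (Fin k → E7) → ℝ) (v : Fin k → E7) : ℝ :=
  ∑ i, γ (Function.update v i (sharp g (A (v i))))

/-! ### `G₂`-structures at a point -/

/-- `g` is the metric and `vol` the volume form determined by the 3-form `φ`: `g` is positive
definite, `vol` is a volume form of `g`, that is, `vol(v₁, …, v₇)² = det g(vᵢ, vⱼ)`, and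
`(X ⌟ φ) ∧ (Y ⌟ φ) ∧ φ = 6 g(X, Y) vol`. -/
structure IsMetricOf (φ : Alt 3) (g : LinearMap.BilinForm ℝ E7) (vol : Alt 7) : Prop where
  symm : ∀ X Y, g X Y = g Y X
  pos : ∀ X, X ≠ 0 → 0 < g X X
  vol_sq : ∀ v : Fin 7 → E7, vol v ^ 2 = (Matrix.of fun i j => g (v i) (v j)).det
  formula : ∀ X Y : E7,
    (wedge (wedge (φ.curryLeft X) (φ.curryLeft Y)) φ : Alt 7) = (6 * g X Y) • vol

/-- `φ` is a `G₂`-structure, that is, a nondegenerate 3-form: it determines a metric and a volume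
form. -/
def IsG2Structure (φ : Alt 3) : Prop := ∃ g vol, IsMetricOf φ g vol

/-- The metric and the volume form determined by a `G₂`-structure (they are unique). -/
def metricPair (φ : Alt 3) : LinearMap.BilinForm ℝ E7 × Alt 7 :=
  Classical.epsilon fun p : LinearMap.BilinForm ℝ E7 × Alt 7 => IsMetricOf φ p.1 p.2

/-- The metric `g_φ`. -/
def metric (φ : Alt 3) : Tensor2 := fun X Y => (metricPair φ).1 X Y

/-- The volume form `vol_φ`. -/
def volForm (φ : Alt 3) : Alt 7 := (metricPair φ).2

/-- The dual 4-form `ψ = *φ`, in components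
`ψ_{j₁…j₄} = (1/3!) φ^{i₁i₂i₃} vol_{i₁i₂i₃j₁…j₄}`. -/
def psi (φ : Alt 3) (v : Fin 4 → E7) : ℝ :=
  (1 / 6) * ∑ i : Fin 3 → Fin 7, ∑ j : Fin 3 → Fin 7,
    (∏ a, invGram (metric φ) (i a) (j a)) * φ (fun a => e (i a))
      * volForm φ (Fin.append (fun a => e (j a)) v)

/-! ### Torsion and the flow in coordinates

Here `φ : E7 → Alt 3` is the coordinate expression of a field of `G₂`-structures. -/

/-- The field of metrics determined by `φ`. -/
def metricField (φ : E7 → Alt 3) : E7 → Tensor2 := fun y => metric (φ y)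

/-- `T` is the torsion of `φ` at `y`: `∇_m φ_{ijk} = T_m^p ψ_{pijk}`. -/
def IsTorsionAt (φ : E7 → Alt 3) (y : E7) (T : LinearMap.BilinForm ℝ E7) : Prop :=
  ∀ (X : E7) (v : Fin 3 → E7),
    nabla (metricField φ) (fun z w => φ z w) y X v
      = psi (φ y) (Fin.cons (sharp (metric (φ y)) fun P => T X P) v)

/-- The torsion tensor `T` (it exists and is unique for a smooth field of `G₂`-structures). -/
def torsion (φ : E7 → Alt 3) (y : E7) : Tensor2 := fun X Y =>
  (Classical.epsilon fun T : LinearMap.BilinForm ℝ E7 => IsTorsionAt φ y T) X Y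

/-- The covariant derivative of the torsion, `(∇T)_{mij} = ∇_m T_{ij}`. -/
def nablaTorsion (φ : E7 → Alt 3) (y : E7) (v : Fin 3 → E7) : ℝ :=
  nabla (metricField φ) (fun z (w : Fin 2 → E7) => torsion φ z (w 0) (w 1)) y (v 0) ![v 1, v 2]

/-- The divergence of the torsion, `(Div T)_i = ∇^j T_{ji}`. -/
def divTorsion (φ : E7 → Alt 3) (y Z : E7) : ℝ :=
  trace (metric (φ y)) fun P Q => nablaTorsion φ y ![P, Q, Z]

/-- The 7-dimensional part of the torsion, `(VT)_k = T^{ij} φ_{ijk}`, as a covector. -/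
def vecTorsion (φ : E7 → Alt 3) (y Z : E7) : ℝ :=
  trace (metric (φ y)) fun P P' => trace (metric (φ y)) fun Q Q' =>
    torsion φ y P Q * φ y ![P', Q', Z]

/-- The 7-dimensional part of the torsion as a vector. -/
def vecTorsionSharp (φ : E7 → Alt 3) (y : E7) : E7 :=
  sharp (metric (φ y)) (vecTorsion φ y)

/-- The symmetric 2-tensor `-Ric - ⅔ (T ∘ (VT ⌟ φ))_sym + (tr T) T_sym`. -/
def flowSym (φ : E7 → Alt 3) (y : E7) : Tensor2 := fun X Y =>
  - ricci (metricField φ) y X Y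
    - (2 / 3) * symPart (comp2 (metric (φ y)) (torsion φ y)
        fun P Q => φ y ![vecTorsionSharp φ y, P, Q]) X Y
    + trace (metric (φ y)) (torsion φ y) * symPart (torsion φ y) X Y

/-- The covector `Div T + ⅓ (tr T) VT - ⅓ Tᵗ(VT)`, where `(Tᵗ V)_i = T_{ji} V^j`. -/
def flowVec (φ : E7 → Alt 3) (y : E7) : E7 → ℝ := fun Z =>
  divTorsion φ y Z + (1 / 3) * trace (metric (φ y)) (torsion φ y) * vecTorsion φ y Z
    - (1 / 3) * torsion φ y (vecTorsionSharp φ y) Z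

/-- The velocity `(-Ric - ⅔ (T ∘ (VT ⌟ φ))_sym + (tr T) T_sym) ⋄ φ
+ (Div T + ⅓ (tr T) VT - ⅓ Tᵗ(VT)) ⌟ ψ` of the flow. -/
def flowVelocity (φ : E7 → Alt 3) (y : E7) (v : Fin 3 → E7) : ℝ :=
  diamond (metric (φ y)) (flowSym φ y) (fun w => φ y w) v
    + psi (φ y) (Fin.cons (sharp (metric (φ y)) (flowVec φ y)) v)

/-- `Λ = (|Rm|² + |∇T|² + |T|⁴)^{1/2}`. -/
def lambdaAt (φ : E7 → Alt 3) (y : E7) : ℝ :=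
  Real.sqrt (normSq (metric (φ y)) (riemann (metricField φ) y)
    + normSq (metric (φ y)) (nablaTorsion φ y)
    + normSq (metric (φ y)) (fun v : Fin 2 → E7 => torsion φ y (v 0) (v 1)) ^ 2)

/-! ### Differential forms on a 7-manifold

Differential operators at `x` are computed in the preferred chart at `x`, in which the tangent
space at `x` is identified with `ℝ⁷` by the identity. -/

section Manifold

variable {M : Type*} [TopologicalSpace M] [ChartedSpace E7 M]

variable (M) in
/-- Fields of alternating `k`-forms on `M` with values in `K`. -/
abbrev Form (k : ℕ) (K : Type*) [NormedAddCommGroup K] [NormedSpace ℝ K] : Type _ :=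
  ∀ x : M, TangentSpace (𝓡 7) x [⋀^Fin k]→L[ℝ] K

/-- The image of `x` in the preferred chart at `x`. -/
def base (x : M) : E7 := extChartAt (𝓡 7) x x

/-- The point of `M` with coordinates `y` in the preferred chart at `x`. -/
def pt (x : M) (y : E7) : M := (extChartAt (𝓡 7) x).symm y

/-- The derivative at `y` of the inverse of the preferred chart at `x`. -/
def frame (x : M) (y : E7) : E7 →L[ℝ] TangentSpace (𝓡 7) (pt x y) :=
  mfderiv (𝓡 7) (𝓡 7) (extChartAt (𝓡 7) x).symm y

/-- The inverse of `frame x y`. -/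
def coframe (x : M) (y : E7) : TangentSpace (𝓡 7) (pt x y) →L[ℝ] E7 :=
  (frame x y).inverse

section Form

variable {k : ℕ} {K : Type*} [NormedAddCommGroup K] [NormedSpace ℝ K]

/-- The coordinate expression of a form in the preferred chart at `x`, that is, its pullback by
the inverse of the chart. -/
def Form.inChart (A : Form M k K) (x : M) (y : E7) : E7 [⋀^Fin k]→L[ℝ] K :=
  (A (pt x y)).compContinuousLinearMap (frame x y)

/-- A form is smooth if its coordinate expressions are. -/
def Form.IsSmooth (A : Form M k K) : Prop :=
  ∀ x : M, ContDiffOn ℝ ∞ (Form.inChart A x) (extChartAt (𝓡 7) x).target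

/-- The exterior derivative of a form on `M`. -/
def Form.d (A : Form M k K) : Form M (k + 1) K := fun x =>
  (extDeriv (Form.inChart A x) (base x) : E7 [⋀^Fin (k + 1)]→L[ℝ] K)

end Form

/-- The coordinate expression of a metric. -/
def metricInChart (g : ∀ x : M, TangentSpace (𝓡 7) x →L[ℝ] TangentSpace (𝓡 7) x →L[ℝ] ℝ)
    (x : M) (y : E7) : Tensor2 := fun X Y => g (pt x y) (frame x y X) (frame x y Y)

/-- The coordinate expression of a vector field. -/
def fieldInChart (ξ : ∀ x : M, TangentSpace (𝓡 7) x) (x : M) (y : E7) : E7 :=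
  coframe x y (ξ (pt x y))

/-- The coordinate expression of a field of endomorphisms of the tangent spaces. -/
def endoInChart (Φ : ∀ x : M, TangentSpace (𝓡 7) x →L[ℝ] TangentSpace (𝓡 7) x)
    (x : M) (y : E7) : E7 →L[ℝ] E7 :=
  (coframe x y).comp ((Φ (pt x y)).comp (frame x y))

/-- The Nijenhuis tensor
`[Φ, Φ](X, Y) = Φ²[X, Y] + [ΦX, ΦY] - Φ[ΦX, Y] - Φ[X, ΦY]` of a field of endomorphisms, evaluated
on the constant extensions of `X` and `Y`, for which `[X, Y] = 0`. -/
def nijenhuis (Φ : E7 → E7 →L[ℝ] E7) (y X Y : E7) : E7 :=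
  VectorField.lieBracket ℝ (fun z => Φ z X) (fun z => Φ z Y) y
    - Φ y (VectorField.lieBracket ℝ (fun z => Φ z X) (fun _ => Y) y)
    - Φ y (VectorField.lieBracket ℝ (fun _ => X) (fun z => Φ z Y) y)

/-! ### The flow on a 7-manifold -/

/-- `φ` is, for times in `I`, a smooth family of `G₂`-structures on `M` which solves
`∂φ/∂t = (-Ric - ⅔ (T ∘ (VT ⌟ φ))_sym + (tr T) T_sym) ⋄ φ
+ (Div T + ⅓ (tr T) VT - ⅓ Tᵗ(VT)) ⌟ ψ`. -/
structure IsRicciLikeFlow (φ : ℝ → Form M 3 ℝ) (I : Set ℝ) : Prop where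
  smooth : ∀ x : M, ContDiffOn ℝ ∞ (fun p : ℝ × E7 => Form.inChart (φ p.1) x p.2)
    (I ×ˢ (extChartAt (𝓡 7) x).target)
  isG2Structure : ∀ t ∈ I, ∀ x : M, IsG2Structure (Form.inChart (φ t) x (base x))
  equation : ∀ t ∈ I, ∀ (x : M) (v : Fin 3 → E7),
    HasDerivWithinAt (fun s => Form.inChart (φ s) x (base x) v)
      (flowVelocity (Form.inChart (φ t) x) (base x) v) I t

/-- `Λ(t) = sup_M Λ(x, t)`, as an extended nonnegative real number. -/
def supLambda (φ : Form M 3 ℝ) : ℝ≥0∞ :=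
  ⨆ x : M, ENNReal.ofReal (lambdaAt (Form.inChart φ x) (base x))

/-- A solution on `[0, ∞)` has a Type IIb infinite-time singularity: `sup t Λ(t) = ∞`. -/
def HasTypeIIbSingularity (φ : ℝ → Form M 3 ℝ) : Prop :=
  IsRicciLikeFlow φ (Set.Ici 0) ∧ (⨆ t ∈ Set.Ici (0 : ℝ), ENNReal.ofReal t * supLambda (φ t)) = ⊤

/-- A solution on `[0, ∞)` has a Type III infinite-time singularity: `sup t Λ(t) < ∞`. -/
def HasTypeIIISingularity (φ : ℝ → Form M 3 ℝ) : Prop :=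
  IsRicciLikeFlow φ (Set.Ici 0) ∧ (⨆ t ∈ Set.Ici (0 : ℝ), ENNReal.ofReal t * supLambda (φ t)) < ⊤

/-! ### Contact Calabi-Yau manifolds -/

variable [IsManifold (𝓡 7) ∞ M]

variable (M) in
/-- A contact Calabi-Yau structure on a 7-manifold: a Sasakian structure `(g, η, ξ, Φ)`, with
`ω = dη` the transverse Kähler form of `g`, and a nowhere vanishing closed transverse
`(3,0)`-form `Υ` with `Υ ∧ Ῡ = -(4i/3) ω³`. The Reeb field `ξ` and the endomorphism `Φ` are
determined by `g` and `η`. Exterior derivatives carry no factor `½`. -/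
structure ContactCalabiYau where
  /-- the Sasakian metric -/
  g : Bundle.ContMDiffRiemannianMetric (𝓡 7) ∞ E7 (fun x : M => TangentSpace (𝓡 7) x)
  /-- the contact form -/
  η : Form M 1 ℝ
  /-- the Reeb vector field -/
  ξ : ∀ x : M, TangentSpace (𝓡 7) x
  /-- the endomorphism restricting to the transverse complex structure on `ker η` -/
  Φ : ∀ x : M, TangentSpace (𝓡 7) x →L[ℝ] TangentSpace (𝓡 7) x
  /-- the transverse holomorphic volume form -/
  Υ : Form M 3 ℂ
  smooth_η : Form.IsSmooth η
  smooth_ξ : ∀ x : M, ContDiffOn ℝ ∞ (fieldInChart ξ x) (extChartAt (𝓡 7) x).target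
  smooth_Φ : ∀ x : M, ContDiffOn ℝ ∞ (endoInChart Φ x) (extChartAt (𝓡 7) x).target
  smooth_Υ : Form.IsSmooth Υ
  η_ξ : ∀ x, η x ![ξ x] = 1
  Φ_sq : ∀ x X, Φ x (Φ x X) = -X + η x ![X] • ξ x
  g_Φ : ∀ x X Y, g.inner x (Φ x X) (Φ x Y) = g.inner x X Y - η x ![X] * η x ![Y]
  /-- contact metric condition `ω = g(Φ ·, ·)` -/
  dη_eq : ∀ x X Y, Form.d η x ![X, Y] = g.inner x (Φ x X) Y
  /-- normality `[Φ, Φ] + dη ⊗ ξ = 0` -/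
  normal : ∀ (x : M) (X Y : E7), nijenhuis (endoInChart Φ x) (base x) X Y
    + Form.inChart (Form.d η) x (base x) ![X, Y] • fieldInChart ξ x (base x) = 0
  /-- `Υ` is transverse -/
  Υ_ξ : ∀ x X Y, Υ x ![ξ x, X, Y] = 0
  /-- `Υ` has type `(3,0)` -/
  Υ_type : ∀ x X Y Z, Υ x ![Φ x X, Y, Z] = Complex.I * Υ x ![X, Y, Z]
  Υ_ne : ∀ x, Υ x ≠ 0
  Υ_closed : ∀ x, Form.d Υ x = 0
  Υ_wedge : ∀ x (v : Fin 6 → TangentSpace (𝓡 7) x),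
    wedge (Υ x) ((Complex.conjCLE : ℂ →L[ℝ] ℂ).compContinuousAlternatingMap (Υ x)) v
      = -(4 * Complex.I / 3) * (wedge (wedge (Form.d η x) (Form.d η x)) (Form.d η x) v : ℝ)

namespace ContactCalabiYau

variable (S : ContactCalabiYau M)

/-- The form `A η ∧ ω + B Re Υ`. -/
def ansatz (A B : ℝ) : Form M 3 ℝ := fun x =>
  A • (wedge (S.η x) (Form.d S.η x) : TangentSpace (𝓡 7) x [⋀^Fin 3]→L[ℝ] ℝ)
    + B • Complex.reCLM.compContinuousAlternatingMap (S.Υ x)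

/-- The `G₂`-structure `φ₀ = a η ∧ ω + Re Υ`. -/
def initialForm (a : ℝ) : Form M 3 ℝ := S.ansatz a 1

/-- `f_t = a (1 + (25a²/2) t)^{-3/10}`. -/
def fFun (a t : ℝ) : ℝ := a * (1 + 25 * a ^ 2 / 2 * t) ^ (-(3 / 10) : ℝ)

/-- `h_t = (1 + (25a²/2) t)^{1/10}`. -/
def hFun (a t : ℝ) : ℝ := (1 + 25 * a ^ 2 / 2 * t) ^ (1 / 10 : ℝ)

/-- The family `φ_t = f_t h_t² η ∧ ω + h_t³ Re Υ`. -/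
def flowSolution (a t : ℝ) : Form M 3 ℝ :=
  S.ansatz (fFun a t * hFun a t ^ 2) (hFun a t ^ 3)

/-- The coordinate expression of the projection `Z ↦ Z - η(Z) ξ` onto `𝒟 = ker η`. -/
def proj (x : M) (y Z : E7) : E7 :=
  Z - Form.inChart S.η x y ![Z] • fieldInChart S.ξ x y

/-- The transverse Levi-Civita connection of `g_𝒟` on `𝒟`, in coordinates. For a section `Z` of
`𝒟` it is `D_X Z = (∇_X Z)^𝒟` for `X` in `𝒟` and `D_ξ Z = [ξ, Z]^𝒟`; vector fields `Z` are
first projected to `𝒟`. -/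
def transverseConnection (x : M) (X Z : E7 → E7) (y : E7) : E7 :=
  S.proj x y
    (leviCivita (metricInChart S.g.inner x) (fun z => S.proj x z (X z))
        (fun z => S.proj x z (Z z)) y
      + Form.inChart S.η x y ![X y] •
        VectorField.lieBracket ℝ (fieldInChart S.ξ x) (fun z => S.proj x z (Z z)) y)

/-- The transverse metric `g_𝒟` is flat: the curvature of its transverse Levi-Civita connection
vanishes. -/
def IsTransverselyFlat : Prop :=
  ∀ (x : M) (X Y Z : E7), curvature (S.transverseConnection x) (base x) X Y Z = 0

end ContactCalabiYau

end Manifold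

end G2Flow

end

/-! One connection reduces the whole computation to algebra. In a chart, let ∇ be the metric
connection of g₀ with torsion ω ⊗ ξ, whose Christoffel symbols `LocalCCY.G` come from a Koszul
formula. The Sasakian conditions make η, ξ, Φ and ω parallel (`fderiv_η`, `fderiv_ξ`, `fderiv_Φ`,
`fderiv_om_eq`), and closedness together with the normalization of Υ makes Υ parallel (`fderiv_Υ`).
Hence the curvature R of ∇ vanishes whenever ξ is inserted, has zero complex trace on ker η, and is
transversely Ricci-flat (`ricci_R`). It is also the curvature of the transverse Levi-Civita
connection (`curvature_transverse`).

Fix f and h, and put k = f / h². The form f h² η ∧ ω + h³ Re Υ is the standard 3-form in a rescaled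
unitary frame, so its metric is f² η² + h² g_𝒟. The Levi-Civita connection of that metric is ∇ + C,
where C is a constant-coefficient expression in the parallel tensors η, ξ, Φ, ω (`christoffel_eq`).
So T, ∇T and the part of Rm beyond R are algebraic: in the frame their components are powers of k
times fixed numbers, and the identities among integers are settled by decision. The outcome is that
T is diagonal with eigenvalue -3k/2 on ξ and k/2 on 𝒟, that VT = 0 and Div T = 0, and that Ric = -k
T (`torsion_eq`, `vecTorsion_eq`, `divTorsion_eq`, `ricci_eq`). The velocity of the flow is
therefore (5/2) k T ⋄ φ = (5/4) k² (3 h³ Re Υ - f h² η ∧ ω), by `flowVelocity_eq`. The flow becomes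
the pair of equations (f h²)' = -(5/4) k² f h² and (h³)' = (15/4) k² h³, which the given f and h
satisfy because k² = a² / (1 + 25a²t/2).

For the singularity type, the two parts of Rm scale differently (`riem_frameT`): the transverse
curvature as h⁻², the algebraic part as k², and ∇T and |T|² also as k². If R = 0, then Λ is a
constant times k² and tΛ stays bounded. If some component of R is nonzero at a point, then tΛ is at
least a positive multiple of t h⁻² minus a constant, and t h⁻² is unbounded since h² grows only as
the power 1/5 of 1 + 25a²t/2.

Two further ingredients are needed. The metric and torsion of φ are defined by choice, so they are
identified through uniqueness (`IsMetricOf.unique`, `IsG2Frame.psi_nondegenerate`). And conditions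
imposed at each point in that point's own chart are carried over a whole chart by naturality of the
exterior derivative and of the Nijenhuis tensor. -/

namespace G2Flow

open Equiv Finset

/-! ### Wedge products as sums against the Levi-Civita symbol. -/

section WedgeExpansion

variable {V : Type*} [AddCommGroup V] [Module ℝ V] [TopologicalSpace V]
variable {K : Type*} [CommRing K] [Algebra ℝ K] [TopologicalSpace K] [IsTopologicalRing K]

/-- The wedge product as an antisymmetrized product. -/
theorem factorial_smul_wedge {k l : ℕ} (α : V [⋀^Fin k]→L[ℝ] K) (β : V [⋀^Fin l]→L[ℝ] K)
    (v : Fin (k + l) → V) :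
    (k.factorial * l.factorial) • wedge α β v = ∑ σ : Perm (Fin (k + l)),
      ((Perm.sign σ : ℤ) : K) * (α (fun i => v (σ (Fin.castAdd l i)))
        * β (fun j => v (σ (Fin.natAdd k j)))) := by
  have h := MultilinearMap.domCoprod_alternization_eq α.toAlternatingMap β.toAlternatingMap
  have h2 := congrArg (fun F => LinearMap.mul' ℝ K (F (fun s => v (finSumFinEquiv s)))) h
  simp only [Fintype.card_fin, AlternatingMap.smul_apply, map_nsmul] at h2
  change _ = (k.factorial * l.factorial) • wedge α β v at h2
  rw [← h2, MultilinearMap.alternatization_apply, map_sum]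
  refine Fintype.sum_equiv finSumFinEquiv.permCongr _ _ fun σ => ?_
  rw [Perm.sign_permCongr]
  have h3 : ∀ (z : ℤˣ) (w : TensorProduct ℝ K K), LinearMap.mul' ℝ K (z • w)
      = ((z : ℤ) : K) * LinearMap.mul' ℝ K w := by
    intro z w
    rcases Int.units_eq_one_or z with hz | hz <;> simp [hz]
  rw [h3]
  simp [MultilinearMap.domCoprod_apply, MultilinearMap.domDomCongr_apply, Equiv.permCongr_apply]

/-- The Levi-Civita symbol. -/
def eps {n : ℕ} (i : Fin n → Fin n) : ℤ :=
  ∏ b, ∏ a ∈ Finset.Iio b, (if i a < i b then 1 else if i b < i a then -1 else 0)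

theorem eps_perm {n : ℕ} (σ : Perm (Fin n)) : eps σ = Perm.sign σ := by
  rw [Equiv.Perm.sign_eq_prod_prod_Iio, eps]
  push_cast
  refine Finset.prod_congr rfl fun b _ => Finset.prod_congr rfl fun a ha => ?_
  have hab : a ≠ b := (Finset.mem_Iio.mp ha).ne
  have := σ.injective.ne hab
  split_ifs with h1 h2
  · rfl
  · rfl
  · exact absurd (le_antisymm (not_lt.mp h2) (not_lt.mp h1)) this

theorem eps_eq_zero {n : ℕ} {i : Fin n → Fin n} (hi : ¬ Function.Injective i) : eps i = 0 := by
  simp only [Function.Injective, not_forall] at hi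
  obtain ⟨a, b, hab, hne⟩ := hi
  wlog hlt : a < b generalizing a b
  · exact this b a hab.symm (Ne.symm hne) (lt_of_le_of_ne (not_lt.mp hlt) (Ne.symm hne))
  refine Finset.prod_eq_zero (Finset.mem_univ b) (Finset.prod_eq_zero (Finset.mem_Iio.mpr hlt) ?_)
  simp [hab]

/-- The symbol vanishes on index tuples that are not injective, so they can be added freely. A sum
over all tuples, unlike one over permutations, splits into nested sums that can be collapsed one
index at a time. -/
theorem sum_perm_eq_sum_eps {R : Type*} [CommRing R] {n : ℕ} (F : (Fin n → Fin n) → R) :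
    ∑ σ : Perm (Fin n), ((Perm.sign σ : ℤ) : R) * F σ = ∑ i, ((eps i : ℤ) : R) * F i := by
  classical
  rw [← Finset.sum_filter_add_sum_filter_not univ (fun i : Fin n → Fin n => Function.Bijective i)]
  rw [Finset.sum_eq_zero (s := univ.filter fun i : Fin n → Fin n => ¬ Function.Bijective i), add_zero]
  · refine Finset.sum_bij (fun σ _ => σ) (fun σ _ => Finset.mem_filter.mpr ⟨Finset.mem_univ _, σ.bijective⟩)
      (fun σ _ τ _ h => DFunLike.coe_injective h)
      (fun i hi => ⟨Equiv.ofBijective i (Finset.mem_filter.mp hi).2, Finset.mem_univ _, rfl⟩) fun σ _ => ?_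
    rw [eps_perm]
  · intro i hi
    rw [Finset.mem_filter] at hi
    rw [eps_eq_zero (fun h => hi.2 (Finite.injective_iff_bijective.mp h))]
    simp

/-- Expanding the inner wedge adds a sum over permutations τ of the first k + l slots. Extended by
the identity, τ keeps its sign and is absorbed into the outer permutation, so each τ contributes the
same amount; the resulting factor (k + l)! cancels. -/
theorem factorial_smul_wedge_wedge {k l m : ℕ} (α : V [⋀^Fin k]→L[ℝ] K) (β : V [⋀^Fin l]→L[ℝ] K)
    (γ : V [⋀^Fin m]→L[ℝ] K) (v : Fin (k + l + m) → V) :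
    (k.factorial * l.factorial * m.factorial) • wedge (wedge α β) γ v
      = ∑ i : Fin (k + l + m) → Fin (k + l + m), ((eps i : ℤ) : K) *
        (α (fun a => v (i (Fin.castAdd m (Fin.castAdd l a))))
          * β (fun a => v (i (Fin.castAdd m (Fin.natAdd k a))))
          * γ (fun a => v (i (Fin.natAdd (k + l) a)))) := by
  rw [← sum_perm_eq_sum_eps (F := fun i => α (fun a => v (i (Fin.castAdd m (Fin.castAdd l a))))
    * β (fun a => v (i (Fin.castAdd m (Fin.natAdd k a)))) * γ (fun a => v (i (Fin.natAdd (k + l) a))))]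
  have hne : (((k + l).factorial : ℕ) : ℝ) ≠ 0 := Nat.cast_ne_zero.mpr (Nat.factorial_ne_zero _)
  have hinj : ∀ x y : K, (k + l).factorial • x = (k + l).factorial • y → x = y := by
    intro x y h
    rw [← Nat.cast_smul_eq_nsmul ℝ, ← Nat.cast_smul_eq_nsmul ℝ] at h
    exact (IsUnit.mk0 _ hne).smul_left_cancel.mp h
  apply hinj
  have h1 := factorial_smul_wedge (wedge α β) γ v
  have h2 : (k + l).factorial • (k.factorial * l.factorial * m.factorial) • wedge (wedge α β) γ v
      = (k.factorial * l.factorial) • (((k + l).factorial * m.factorial) • wedge (wedge α β) γ v) := by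
    simp only [smul_smul]
    congr 1
    ring
  rw [h2, h1, Finset.smul_sum]
  obtain ⟨E, hE⟩ : ∃ E : Perm (Fin (k + l)) → Perm (Fin (k + l + m)), ∀ τ,
      Perm.sign (E τ) = Perm.sign τ ∧ (∀ a, E τ (Fin.castAdd m a) = Fin.castAdd m (τ a)) ∧
      ∀ b, E τ (Fin.natAdd (k + l) b) = Fin.natAdd (k + l) b :=
    ⟨fun τ => finSumFinEquiv.permCongr (Perm.sumCongr τ 1), fun τ =>
      ⟨by rw [Perm.sign_permCongr, Perm.sign_sumCongr]; simp, fun a => by simp [Equiv.permCongr_apply],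
        fun b => by simp [Equiv.permCongr_apply]⟩⟩
  let F : Perm (Fin (k + l + m)) → K := fun σ => ((Perm.sign σ : ℤ) : K)
        * (α (fun a => v (σ (Fin.castAdd m (Fin.castAdd l a))))
          * β (fun a => v (σ (Fin.castAdd m (Fin.natAdd k a))))
          * γ (fun a => v (σ (Fin.natAdd (k + l) a))))
  have h3 : ∀ σ : Perm (Fin (k + l + m)), (k.factorial * l.factorial) • (((Perm.sign σ : ℤ) : K)
      * (wedge α β (fun i => v (σ (Fin.castAdd m i))) * γ (fun j => v (σ (Fin.natAdd (k + l) j)))))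
      = ∑ τ : Perm (Fin (k + l)), F (σ * E τ) := by
    intro σ
    rw [← mul_smul_comm, ← smul_mul_assoc, factorial_smul_wedge, Finset.sum_mul, Finset.mul_sum]
    refine Finset.sum_congr rfl fun τ _ => ?_
    simp only [F, Perm.sign_mul, (hE τ).1, Perm.mul_apply, (hE τ).2.1, (hE τ).2.2]
    push_cast
    ring
  rw [Finset.sum_congr rfl fun σ _ => h3 σ, Finset.sum_comm]
  -- Right multiplication by `E τ` permutes the outer permutations.
  have h4 : ∀ τ : Perm (Fin (k + l)), ∑ σ : Perm (Fin (k + l + m)), F (σ * E τ) = ∑ σ, F σ :=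
    fun τ => Fintype.sum_equiv (Equiv.mulRight (E τ)) _ _ fun σ => rfl
  rw [Finset.sum_congr rfl fun τ _ => h4 τ, Finset.sum_const, Finset.card_univ, Fintype.card_perm,
    Fintype.card_fin]

end WedgeExpansion
end G2Flow

namespace G2Flow

/-! ### The standard `SU(3)`-structure on `ℝ⁷` in components -/

section Components

/-- Components of the 1-form `e⁰`. -/
def etaC (i : Fin 7) : ℤ := if i = 0 then 1 else 0

/-- Real parts of the complex coordinates `z₀, z₁, z₂`. -/
def reC (a : Fin 3) (i : Fin 7) : ℤ := if (i : ℕ) = 2 * a + 1 then 1 else 0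

/-- Imaginary parts of the complex coordinates. -/
def imC (a : Fin 3) (i : Fin 7) : ℤ := if (i : ℕ) = 2 * a + 2 then 1 else 0

/-- Components of the transverse Kähler form. -/
def omC (i j : Fin 7) : ℤ := ∑ a : Fin 3, (reC a i * imC a j - imC a i * reC a j)

/-- Third index of the Fano line through `i` and `j`. -/
def thirdC (i j : Fin 7) : Fin 7 :=
  -- A table packed in base 8, with the entry for (i, j) as digit number 7i + j. Diagonal entries
  -- are immaterial, since the sign vanishes there.
  Fin.ofNat 7 (455042959849095068250124771214840267487312 / 8 ^ (7 * (i : ℕ) + j) % 8)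

/-- Sign of the cross product of two basis vectors. -/
def crossSign (i j : Fin 7) : ℤ :=
  -- A table packed in base 4; the digits 0, 1, 2 stand for the signs -1, 0, 1.
  ((91657742794849960181159757961 / 4 ^ (7 * (i : ℕ) + j) % 4 : ℕ) : ℤ) - 1

/-- Components of the standard 3-form
`e⁰ ∧ (e¹² + e³⁴ + e⁵⁶) + Re ((e¹ + √-1 e²) ∧ (e³ + √-1 e⁴) ∧ (e⁵ + √-1 e⁶))`. -/
def phiC (i j k : Fin 7) : ℤ := if thirdC i j = k then crossSign i j else 0

/-- Components of the 4-form dual to the standard 3-form. -/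
def psiC (p q r s : Fin 7) : ℤ :=
  -- The contraction identity ψ_{pqrs} = φ_{pqk} φ_{rsk} - δ_{pr} δ_{qs} + δ_{ps} δ_{qr}.
  (if thirdC p q = thirdC r s then crossSign p q * crossSign r s else 0)
    - (if p = r ∧ q = s then 1 else 0) + (if p = s ∧ q = r then 1 else 0)

/-- Antisymmetrized product of the real parts of complex numbers. -/
def reDet (x y : Fin 3 → Fin 3 → ℤ) : ℤ :=
  ∑ σ : Equiv.Perm (Fin 3), (Equiv.Perm.sign σ : ℤ) *
    (x (σ 0) 0 * x (σ 1) 1 * x (σ 2) 2 - x (σ 0) 0 * y (σ 1) 1 * y (σ 2) 2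
      - y (σ 0) 0 * x (σ 1) 1 * y (σ 2) 2 - y (σ 0) 0 * y (σ 1) 1 * x (σ 2) 2)

/-- Components of the difference between the Levi-Civita and the transverse connection. -/
def gammaC (i j p : Fin 7) : ℤ := - omC i j * etaC p + etaC i * omC j p + etaC j * omC i p

/-- Eigenvalues of the torsion. -/
def torC (i : Fin 7) : ℤ := 1 - 4 * etaC i

/-- Components of the curvature of the model with flat transverse metric. -/
def rmC (a b c d : Fin 7) : ℤ :=
  ∑ p, (gammaC b c p * gammaC a p d - gammaC a c p * gammaC b p d) + 2 * omC a b * gammaC 0 c d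

/-- Signature of a pair. -/
def sgnC {n : ℕ} (i j : Fin n) : ℤ := if i < j then 1 else if j < i then -1 else 0

/-- The Levi-Civita symbol on seven indices. -/
def eps7 (p q r s a b c : Fin 7) : ℤ :=
  (sgnC p q * sgnC p r * sgnC p s * sgnC q r * sgnC q s * sgnC r s) *
   (sgnC p a * sgnC q a * sgnC r a * sgnC s a) *
   (sgnC p b * sgnC q b * sgnC r b * sgnC s b * sgnC a b) *
   (sgnC p c * sgnC q c * sgnC r c * sgnC s c * sgnC a c * sgnC b c)

/-- This ties the packed tables to the 3-form they encode, η ∧ ω + Re (dz₀ ∧ dz₁ ∧ dz₂). -/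
theorem phiC_eq : ∀ i j k : Fin 7,
    phiC i j k = etaC i * omC j k - etaC j * omC i k + etaC k * omC i j
      + reDet (fun a b => reC a (![i, j, k] b)) (fun a b => imC a (![i, j, k] b)) := by
  decide +kernel

/-- The sum computes the dual 4-form. For given a and b only the third index of their line
contributes, and branches whose partial sign is already zero are cut, which keeps the evaluation
small. -/
theorem sum_crossSign_eps7_aux : ∀ p q r s : Fin 7,
    (if sgnC p q * sgnC p r * sgnC p s * sgnC q r * sgnC q s * sgnC r s = 0 then 0 else
      ∑ a, if sgnC p a * sgnC q a * sgnC r a * sgnC s a = 0 then 0 else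
        ∑ b, if sgnC p b * sgnC q b * sgnC r b * sgnC s b * sgnC a b = 0 then 0 else
          crossSign a b * eps7 p q r s a b (thirdC a b)) = 6 * psiC p q r s := by
  decide +kernel

theorem sum_crossSign_eps7 (p q r s : Fin 7) :
    ∑ a, ∑ b, crossSign a b * eps7 p q r s a b (thirdC a b) = 6 * psiC p q r s := by
  rw [← sum_crossSign_eps7_aux]
  split_ifs with h
  · simp [eps7, h]
  · refine Finset.sum_congr rfl fun a _ => ?_
    split_ifs with h
    · simp [eps7, h]
    · refine Finset.sum_congr rfl fun b _ => ?_
      split_ifs with h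
      · simp [eps7, h]
      · rfl

/-- With `sum_crossSign_eps7` and `sum_phiC_phiC`, this evaluates (X ⌟ φ) ∧ (Y ⌟ φ) ∧ φ by
successive contractions instead of a single sum over seven indices. -/
theorem sum_phiC_psiC : ∀ i r s : Fin 7,
    ∑ p, ∑ q, phiC i p q * psiC p q r s = 4 * phiC i r s := by
  decide +kernel

theorem sum_phiC_phiC : ∀ i j : Fin 7,
    ∑ r, ∑ s, phiC i r s * phiC j r s = if i = j then 6 else 0 := by
  decide +kernel

/-- Up to the factor k / 2, the left side is ∇φ for the rescaled metric, as φ is parallel for the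
connection with torsion. The identity shows that the torsion tensor is diagonal, with eigenvalues
proportional to -3 and 1. -/
theorem torsion_components : ∀ m i j k : Fin 7,
    - ∑ p, (gammaC m i p * phiC p j k + gammaC m j p * phiC i p k + gammaC m k p * phiC i j p)
      = torC m * psiC m i j k := by
  decide +kernel

/-- Each basis vector is isolated by one triple, so ψ determines its first argument. This is what
makes the torsion tensor unique. -/
theorem psiC_nondegenerate : ∀ p : Fin 7, ∃ i j k : Fin 7,
    psiC p i j k ≠ 0 ∧ ∀ q, q ≠ p → psiC q i j k = 0 := by
  decide +kernel

/-- The Ricci contraction of the algebraic curvature. After multiplication by k² / 4 the eigenvalues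
are 3k²/2 and -k²/2, which are -k times those of the torsion. -/
theorem sum_rmC : ∀ j k : Fin 7,
    ∑ a, rmC a j k a = if j = k then (if j = 0 then 6 else -2) else 0 := by
  decide +kernel

theorem div_torsion_components : ∀ z : Fin 7,
    ∑ a, (gammaC a a z * torC z + gammaC a z a * torC a) = 0 := by
  decide +kernel

end Components

end G2Flow

/-! ### Index sums, signs, and the components of the transverse (3,0)-form. -/

namespace G2Flow

section Components

theorem sum_fin_succ_fun {α M : Type*} [Fintype α] [DecidableEq α] [AddCommMonoid M] {n : ℕ}
    (F : (Fin (n + 1) → α) → M) : ∑ i, F i = ∑ a, ∑ i, F (Matrix.vecCons a i) := by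
  rw [← Fintype.sum_prod_type']
  exact (Fintype.sum_equiv (Fin.consEquiv fun _ => α) _ _ fun _ => rfl).symm

theorem sum_fin_zero_fun {α M : Type*} [Fintype α] [DecidableEq α] [AddCommMonoid M]
    (F : (Fin 0 → α) → M) : ∑ i, F i = F ![] := by
  rw [Fintype.sum_unique]
  congr 1

theorem eps_eq_prod_sgnC {n : ℕ} (i : Fin n → Fin n) :
    eps i = ∏ b, ∏ a, if a < b then sgnC (i a) (i b) else 1 := by
  refine Finset.prod_congr rfl fun b _ => ?_
  rw [← Finset.prod_filter]
  refine Finset.prod_congr ?_ fun _ _ => rfl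
  ext a
  simp

theorem sgnC_swap {n : ℕ} (i j : Fin n) : sgnC j i = - sgnC i j := by
  unfold sgnC
  split_ifs with h1 h2 <;> first | rfl | (exfalso; omega)

theorem eps_vec7 (p q r s a b c : Fin 7) : eps ![p, q, r, s, a, b, c] = eps7 p q r s a b c := by
  rw [eps_eq_prod_sgnC, eps7]
  simp only [Fin.prod_univ_succ, Fin.prod_univ_zero]
  simp [Fin.lt_def]
  ring

/-- Twelve transpositions move a block of three past a block of four, so no sign appears. -/
theorem eps_vec7' (p q r s a b c : Fin 7) : eps ![a, b, c, p, q, r, s] = eps7 p q r s a b c := by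
  rw [eps_vec7, eps7, eps7]
  rw [sgnC_swap p a, sgnC_swap p b, sgnC_swap p c, sgnC_swap q a, sgnC_swap q b, sgnC_swap q c,
    sgnC_swap r a, sgnC_swap r b, sgnC_swap r c, sgnC_swap s a, sgnC_swap s b, sgnC_swap s c]
  ring

theorem sum_phiC_mul {R : Type*} [CommRing R] (i j : Fin 7) (F : Fin 7 → R) :
    ∑ k, (phiC i j k : R) * F k = crossSign i j * F (thirdC i j) := by
  simp [phiC, Finset.sum_ite_eq]

/-- Antisymmetrized product of the imaginary parts of complex numbers. -/
def imDet (x y : Fin 3 → Fin 3 → ℤ) : ℤ :=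
  ∑ σ : Equiv.Perm (Fin 3), (Equiv.Perm.sign σ : ℤ) *
    (x (σ 0) 0 * x (σ 1) 1 * y (σ 2) 2 + x (σ 0) 0 * y (σ 1) 1 * x (σ 2) 2
      + y (σ 0) 0 * x (σ 1) 1 * x (σ 2) 2 - y (σ 0) 0 * y (σ 1) 1 * y (σ 2) 2)

theorem det_eq_reDet_add_imDet (x y : Fin 3 → Fin 3 → ℤ) :
    (Matrix.of fun a b => ((x a b : ℂ) + y a b * Complex.I)).det
      = (reDet x y : ℂ) + imDet x y * Complex.I := by
  simp only [Matrix.det_apply', reDet, imDet, Fin.prod_univ_three, Matrix.of_apply]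
  push_cast
  rw [Finset.sum_mul, ← Finset.sum_add_distrib]
  refine Finset.sum_congr rfl fun σ _ => ?_
  linear_combination ((Equiv.Perm.sign σ : ℤ) : ℂ) * (↑(x (σ 0) 0) * ↑(y (σ 1) 1) * ↑(y (σ 2) 2)
   + ↑(y (σ 0) 0) * ↑(x (σ 1) 1) * ↑(y (σ 2) 2) + ↑(y (σ 0) 0) * ↑(y (σ 1) 1) * ↑(x (σ 2) 2)
   + ↑(y (σ 0) 0) * ↑(y (σ 1) 1) * ↑(y (σ 2) 2) * Complex.I) * Complex.I_sq

/-- Components of the real part of the standard transverse `(3,0)`-form. -/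
def upsRe (i j k : Fin 6) : ℤ := phiC i.succ j.succ k.succ

/-- Components of the imaginary part of the standard transverse `(3,0)`-form. -/
def upsIm (i j k : Fin 6) : ℤ :=
  -- Type (3,0) gives Im Υ(v, ·, ·) = -Re Υ(Φv, ·, ·). An even i stands for some u, with Φu at the
  -- frame index i + 2; an odd i stands for Φu, and Φ sends it to minus the vector with frame index
  -- i.
  if (i : ℕ) % 2 = 0 then - phiC (Fin.ofNat 7 (i + 2)) j.succ k.succ
  else phiC (Fin.ofNat 7 i) j.succ k.succ

theorem upsRe_eq : ∀ i j k : Fin 6, upsRe i j k = reDet (fun a b => reC a (![i, j, k] b).succ)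
    (fun a b => imC a (![i, j, k] b).succ) := by
  decide +kernel

theorem upsIm_eq : ∀ i j k : Fin 6, upsIm i j k = imDet (fun a b => reC a (![i, j, k] b).succ)
    (fun a b => imC a (![i, j, k] b).succ) := by
  decide +kernel

/-- The Levi-Civita symbol on six indices, with an early exit. -/
def eps6 (p q r a b c : Fin 6) : ℤ :=
  if sgnC p a * sgnC q a * sgnC r a = 0 then 0 else
  if sgnC p b * sgnC q b * sgnC r b * sgnC a b = 0 then 0 else
  (sgnC p q * sgnC p r * sgnC q r) * (sgnC p a * sgnC q a * sgnC r a) *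
   (sgnC p b * sgnC q b * sgnC r b * sgnC a b) *
   (sgnC p c * sgnC q c * sgnC r c * sgnC a c * sgnC b c)

theorem eps_vec6 (p q r a b c : Fin 6) : eps ![p, q, r, a, b, c] = eps6 p q r a b c := by
  have : eps6 p q r a b c = (sgnC p q * sgnC p r * sgnC q r) * (sgnC p a * sgnC q a * sgnC r a) *
   (sgnC p b * sgnC q b * sgnC r b * sgnC a b) *
   (sgnC p c * sgnC q c * sgnC r c * sgnC a c * sgnC b c) := by
    unfold eps6
    split_ifs with h1 h2
    · rw [h1]; ring
    · rw [h2]; ring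
    · rfl
  rw [eps_eq_prod_sgnC, this]
  simp only [Fin.prod_univ_succ, Fin.prod_univ_zero]
  simp [Fin.lt_def]
  ring

theorem sum_eps6_re : ∑ p, ∑ q, ∑ r, (if upsRe p q r = 0 ∧ upsIm p q r = 0 then 0 else
    ∑ a, ∑ b, ∑ c, eps6 p q r a b c *
      (upsRe p q r * upsRe a b c + upsIm p q r * upsIm a b c)) = 0 := by
  decide +kernel

/-- Antisymmetrization carries the factor 3! · 3! = 36, so Υ ∧ Ῡ takes the value -8i on the frame;
in the companion sum the factor is 2!³ = 8 and ω³ takes the value 6. The ratio is the normalization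
-4i/3. -/
theorem sum_eps6_im : ∑ p, ∑ q, ∑ r, (if upsRe p q r = 0 ∧ upsIm p q r = 0 then 0 else
    ∑ a, ∑ b, ∑ c, eps6 p q r a b c *
      (upsIm p q r * upsRe a b c - upsRe p q r * upsIm a b c)) = -288 := by
  decide +kernel

theorem sum_eps6_om : ∑ p, ∑ q, (if omC p.succ q.succ = 0 then 0 else ∑ r, ∑ a,
    if omC r.succ a.succ = 0 then 0 else ∑ b, ∑ c, eps6 p q r a b c *
      (omC p.succ q.succ * omC r.succ a.succ * omC b.succ c.succ)) = 48 := by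
  decide +kernel

end Components

end G2Flow

namespace G2Flow

/-! ### Orthonormal frames -/

section Frames

open Finset

theorem sum_smul_e (v : E7) : ∑ i, v i • e i = v := by
  ext j
  simp [Pi.single_apply]

/-- `b` is an orthonormal frame for `g`. -/
def IsOrthoFrame (g : LinearMap.BilinForm ℝ E7) (b : Fin 7 → E7) : Prop :=
  ∀ i j, g (b i) (b j) = if i = j then 1 else 0

namespace IsOrthoFrame

variable {g : LinearMap.BilinForm ℝ E7} {b : Fin 7 → E7} (hb : IsOrthoFrame g b)

include hb

theorem linearIndependent : LinearIndependent ℝ b := by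
  rw [Fintype.linearIndependent_iff]
  intro c hc i
  have h := congrArg (fun v => g v (b i)) hc
  simpa [hb _ _, LinearMap.sum_apply] using h

/-- The basis given by an orthonormal frame. -/
noncomputable def basis : Module.Basis (Fin 7) ℝ E7 :=
  basisOfLinearIndependentOfCardEqFinrank hb.linearIndependent (by simp)

@[simp]
theorem basis_apply (i : Fin 7) : hb.basis i = b i := by
  simp [basis]

theorem basis_repr (v : E7) (i : Fin 7) : hb.basis.repr v i = g v (b i) := by
  conv_rhs => rw [← hb.basis.sum_repr v]
  simp [hb _ _, LinearMap.sum_apply]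

theorem expand (v : E7) : ∑ i, g v (b i) • b i = v := by
  conv_rhs => rw [← hb.basis.sum_repr v]
  simp [hb.basis_repr]

theorem ext {v w : E7} (h : ∀ i, g v (b i) = g w (b i)) : v = w := by
  rw [← hb.expand v, ← hb.expand w]
  simp [h]

theorem parseval (v w : E7) : g v w = ∑ i, g v (b i) * g w (b i) := by
  conv_lhs => rw [← hb.expand w]
  simp [mul_comm]

theorem symm (v w : E7) : g v w = g w v := by
  rw [hb.parseval, hb.parseval w]
  simp [mul_comm]

theorem pos {v : E7} (hv : v ≠ 0) : 0 < g v v := by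
  rw [hb.parseval]
  refine (Finset.sum_nonneg fun i _ => mul_self_nonneg _).lt_of_ne' fun h => hv ?_
  rw [Finset.sum_eq_zero_iff_of_nonneg fun i _ => mul_self_nonneg _] at h
  refine hb.ext fun i => ?_
  simpa using h i (Finset.mem_univ i)

/-- Orthonormality reads BᵀGB = 1 for the matrix B whose columns are the frame vectors, hence G⁻¹ =
BBᵀ. Every contraction with the inverse metric in coordinates thereby becomes a sum over the frame.
-/
theorem invGram_eq {g' : Tensor2} (hg : ∀ X Y, g' X Y = g X Y) :
    invGram g' = (Matrix.of fun i a => b a i) * (Matrix.of fun i a => b a i).transpose := by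
  refine Matrix.inv_eq_left_inv ?_
  rw [Matrix.mul_assoc]
  refine mul_eq_one_comm.mp ?_
  ext a c
  rw [Matrix.mul_assoc, Matrix.one_apply, ← hb a c]
  conv_rhs => rw [← sum_smul_e (b a), ← sum_smul_e (b c)]
  simp [Matrix.mul_apply, hg, LinearMap.sum_apply, Finset.mul_sum]
  rw [Finset.sum_comm]
  exact Finset.sum_congr rfl fun _ _ => Finset.sum_congr rfl fun _ _ => by ring

theorem sum_invGram_smul {N : Type*} [AddCommGroup N] [Module ℝ N] {g' : Tensor2}
    (hg : ∀ X Y, g' X Y = g X Y) (F : E7 →ₗ[ℝ] E7 →ₗ[ℝ] N) :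
    ∑ i, ∑ j, invGram g' i j • F (e i) (e j) = ∑ a, F (b a) (b a) := by
  simp_rw [hb.invGram_eq hg]
  have h : ∀ a, F (b a) (b a) = ∑ i, ∑ j, (b a i * b a j) • F (e i) (e j) := by
    intro a
    conv_lhs => rw [← sum_smul_e (b a)]
    simp [LinearMap.sum_apply, smul_smul, Finset.smul_sum]
    rw [Finset.sum_comm]
    exact Finset.sum_congr rfl fun _ _ => Finset.sum_congr rfl fun _ _ => by rw [mul_comm]
  simp_rw [h, Matrix.mul_apply, Finset.sum_smul]
  rw [Finset.sum_congr rfl fun i _ => Finset.sum_comm, Finset.sum_comm]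
  rfl

theorem trace_eq {g' : Tensor2} (hg : ∀ X Y, g' X Y = g X Y) (F : LinearMap.BilinForm ℝ E7)
    {F' : Tensor2} (hF : ∀ X Y, F' X Y = F X Y) : trace g' F' = ∑ a, F (b a) (b a) := by
  rw [← hb.sum_invGram_smul hg F]
  simp [trace, hF]

theorem sharp_eq {g' : Tensor2} (hg : ∀ X Y, g' X Y = g X Y) (α : E7 →ₗ[ℝ] ℝ)
    {α' : E7 → ℝ} (hα : ∀ X, α' X = α X) : sharp g' α' = ∑ a, α (b a) • b a := by
  have := hb.sum_invGram_smul hg (LinearMap.mk₂ ℝ (fun X Y : E7 => α X • Y)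
    (by intros; simp [add_smul]) (by intros; simp [smul_smul]) (by intros; simp)
    (by intros; simp [smul_smul, mul_comm]))
  simp only [LinearMap.mk₂_apply] at this
  rw [← this]
  simp [sharp, hα, smul_smul]

theorem inner_sharp {g' : Tensor2} (hg : ∀ X Y, g' X Y = g X Y) (α : E7 →ₗ[ℝ] ℝ)
    {α' : E7 → ℝ} (hα : ∀ X, α' X = α X) (Z : E7) : g (sharp g' α') Z = α Z := by
  rw [hb.sharp_eq hg α hα]
  conv_rhs => rw [← hb.expand Z]
  simp [LinearMap.sum_apply, mul_comm, hb.symm Z]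

theorem sharp_eq_of_inner {g' : Tensor2} (hg : ∀ X Y, g' X Y = g X Y) 
    {α' : E7 → ℝ} {w : E7} (hα : ∀ X, α' X = g w X) : sharp g' α' = w := by
  refine hb.ext fun i => ?_
  rw [hb.inner_sharp hg (g w) hα]

theorem contract {g' : Tensor2} (hg : ∀ X Y, g' X Y = g X Y) {k : ℕ}
    (A B : MultilinearMap ℝ (fun _ : Fin k => E7) ℝ) :
    ∑ i : Fin k → Fin 7, ∑ j : Fin k → Fin 7,
      (∏ a, invGram g' (i a) (j a)) * A (fun a => e (i a)) * B (fun a => e (j a))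
      = ∑ i : Fin k → Fin 7, A (fun a => b (i a)) * B (fun a => b (i a)) := by
  have h : ∀ (A : MultilinearMap ℝ (fun _ : Fin k => E7) ℝ) (i : Fin k → Fin 7),
      A (fun a => b (i a)) = ∑ m : Fin k → Fin 7, (∏ a, b (i a) (m a)) * A (fun a => e (m a)) := by
    intro A i
    have h1 : (fun a => b (i a)) = fun a => ∑ m, b (i a) m • e m := 
      funext fun a => (sum_smul_e (b (i a))).symm
    conv_lhs => rw [h1]
    rw [MultilinearMap.map_sum]
    refine Finset.sum_congr rfl fun m _ => ?_
    rw [MultilinearMap.map_smul_univ, smul_eq_mul]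
  simp_rw [h, hb.invGram_eq hg, Finset.sum_mul_sum, Matrix.mul_apply, Matrix.of_apply,
    Matrix.transpose_apply, Matrix.of_apply, Finset.prod_univ_sum, Fintype.piFinset_univ,
    Finset.sum_mul]
  rw [Finset.sum_congr rfl fun i _ => Finset.sum_comm, Finset.sum_comm]
  refine Finset.sum_congr rfl fun m _ => Finset.sum_congr rfl fun i _ =>
    Finset.sum_congr rfl fun j _ => ?_
  rw [Finset.prod_mul_distrib]
  ring

theorem normSq_eq {g' : Tensor2} (hg : ∀ X Y, g' X Y = g X Y) {k : ℕ}
    (A : MultilinearMap ℝ (fun _ : Fin k => E7) ℝ) {A' : (Fin k → E7) → ℝ}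
    (hA : ∀ v, A' v = A v) : normSq g' A' = ∑ i : Fin k → Fin 7, A (fun a => b (i a)) ^ 2 := by
  simp_rw [sq, ← hb.contract hg, normSq, hA]

end IsOrthoFrame

end Frames

end G2Flow

/-! ### Metric, volume form and dual 4-form read off an adapted frame. -/

namespace G2Flow

section MetricOfFrame

open Finset

/-- `b` is a frame in which `φ` is the standard 3-form. -/
def IsG2Frame (φ : Alt 3) (b : Fin 7 → E7) : Prop :=
  ∀ i j k, φ ![b i, b j, b k] = phiC i j k

theorem sum_crossSign_eps7_real (p q r s : Fin 7) :
    ∑ a, ∑ b, ∑ c, ((eps7 p q r s a b c : ℤ) : ℝ) * (phiC a b c : ℝ) = 6 * psiC p q r s := by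
  have := sum_crossSign_eps7 p q r s
  rw [← Int.cast_inj (α := ℝ)] at this
  push_cast at this
  rw [← this]
  refine Finset.sum_congr rfl fun a _ => Finset.sum_congr rfl fun b _ => ?_
  rw [← sum_phiC_mul a b (fun c => (eps7 p q r s a b c : ℝ))]
  exact Finset.sum_congr rfl fun c _ => mul_comm _ _

theorem IsG2Frame.apply_left {φ : Alt 3} {g : LinearMap.BilinForm ℝ E7} {b : Fin 7 → E7}
    (hb : IsOrthoFrame g b) (hφ : IsG2Frame φ b) (X : E7) (p q : Fin 7) :
    φ ![X, b p, b q] = ∑ i, g X (b i) * phiC i p q := by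
  have h : ∀ v, φ ![v, b p, b q] = φ.curryLeft v ![b p, b q] := fun v => rfl
  rw [h]
  conv_lhs => rw [← hb.expand X]
  rw [map_sum, ContinuousAlternatingMap.sum_apply]
  simp [hφ _ _ _]

theorem sum_comm_pairs {ι M : Type*} [Fintype ι] [AddCommMonoid M] (F : ι → ι → ι → ι → M) :
    ∑ r, ∑ s, ∑ i, ∑ j, F r s i j = ∑ i, ∑ j, ∑ r, ∑ s, F r s i j := by
  have h : ∀ G : ι → ι → M, ∑ i, ∑ j, G i j = ∑ x : ι × ι, G x.1 x.2 :=
    fun G => (Fintype.sum_prod_type' G).symm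
  simp only [h]
  exact Finset.sum_comm

/-- Contracting the Levi-Civita symbol with the last φ gives 6ψ, contracting ψ with X ⌟ φ gives 4 (X
⌟ φ), and the remaining contraction of φ with φ gives 6g. The product 6 · 4 · 6 is divided by the
antisymmetrization factor 2! · 2! · 3! = 24. -/
theorem wedge_curryLeft_apply_frame {φ : Alt 3} {g : LinearMap.BilinForm ℝ E7} {b : Fin 7 → E7}
    (hb : IsOrthoFrame g b) (hφ : IsG2Frame φ b) (X Y : E7) :
    (wedge (wedge (φ.curryLeft X) (φ.curryLeft Y)) φ : Alt 7) b = 6 * g X Y := by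
  have h := factorial_smul_wedge_wedge (φ.curryLeft X) (φ.curryLeft Y) φ b
  simp only [sum_fin_succ_fun, sum_fin_zero_fun] at h
  have h2 : ∀ p q r s a b' c : Fin 7, (φ.curryLeft X) (fun x =>
      b ((![p, q, r, s, a, b', c] : Fin 7 → Fin 7) (Fin.castAdd 3 (Fin.castAdd 2 x)))) = φ ![X, b p, b q] ∧
      (φ.curryLeft Y) (fun x =>
      b ((![p, q, r, s, a, b', c] : Fin 7 → Fin 7) (Fin.castAdd 3 (Fin.natAdd 2 x)))) = φ ![Y, b r, b s] ∧
      φ (fun x => b ((![p, q, r, s, a, b', c] : Fin 7 → Fin 7) (Fin.natAdd 4 x))) = phiC a b' c := by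
    intro p q r s a b' c
    refine ⟨?_, ?_, ?_⟩
    · rw [ContinuousAlternatingMap.curryLeft_apply_apply]
      congr 1
      ext i : 1
      fin_cases i <;> rfl
    · rw [ContinuousAlternatingMap.curryLeft_apply_apply]
      congr 1
      ext i : 1
      fin_cases i <;> rfl
    · rw [← hφ]
      congr 1
      ext i : 1
      fin_cases i <;> rfl
  have h3 : (24 : ℝ) * (wedge (wedge (φ.curryLeft X) (φ.curryLeft Y)) φ : Alt 7) b
      = ∑ p, ∑ q, ∑ r, ∑ s, ∑ a, ∑ b', ∑ c, (eps7 p q r s a b' c : ℝ) *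
        (φ ![X, b p, b q] * φ ![Y, b r, b s] * phiC a b' c) := by
    rw [nsmul_eq_mul] at h
    refine Eq.trans ?_ (h.trans ?_)
    · norm_num [Nat.factorial]
    · refine Finset.sum_congr rfl fun p _ => Finset.sum_congr rfl fun q _ =>
        Finset.sum_congr rfl fun r _ => Finset.sum_congr rfl fun s _ =>
        Finset.sum_congr rfl fun a _ => Finset.sum_congr rfl fun b' _ =>
        Finset.sum_congr rfl fun c _ => ?_
      obtain ⟨e1, e2, e3⟩ := h2 p q r s a b' c
      exact congrArg₂ _ (congrArg _ (eps_vec7 p q r s a b' c)) 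
        (congrArg₂ _ (congrArg₂ _ e1 e2) e3)
  have h4 : ∀ p q r s : Fin 7, ∑ a, ∑ b', ∑ c, (eps7 p q r s a b' c : ℝ) *
        (φ ![X, b p, b q] * φ ![Y, b r, b s] * phiC a b' c)
        = φ ![X, b p, b q] * φ ![Y, b r, b s] * (6 * psiC p q r s) := by
    intro p q r s
    rw [← sum_crossSign_eps7_real]
    simp only [Finset.mul_sum]
    refine Finset.sum_congr rfl fun a _ => Finset.sum_congr rfl fun b' _ =>
        Finset.sum_congr rfl fun c _ => ?_
    ring
  simp only [h4] at h3
  have h5 : ∀ r s : Fin 7, ∑ p, ∑ q, φ ![X, b p, b q] * psiC p q r s = 4 * φ ![X, b r, b s] := by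
    intro r s
    simp only [hφ.apply_left hb, Finset.sum_mul, Finset.mul_sum]
    rw [Finset.sum_congr rfl fun p _ => Finset.sum_comm, Finset.sum_comm]
    refine Finset.sum_congr rfl fun i _ => ?_
    have := sum_phiC_psiC i r s
    rw [← Int.cast_inj (α := ℝ)] at this
    push_cast at this
    simp only [mul_assoc, ← Finset.mul_sum, this]
    ring
  have h6 : ∑ r, ∑ s, φ ![X, b r, b s] * φ ![Y, b r, b s] = 6 * g X Y := by
    simp only [hφ.apply_left hb, Finset.sum_mul_sum]
    rw [hb.parseval X Y]
    have : ∀ i j : Fin 7, ∑ r, ∑ s, g X (b i) * (phiC i r s : ℝ) * (g Y (b j) * phiC j r s)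
        = g X (b i) * g Y (b j) * (if i = j then 6 else 0) := by
      intro i j
      have := sum_phiC_phiC i j
      rw [← Int.cast_inj (α := ℝ)] at this
      push_cast at this
      rw [← this]
      simp only [Finset.mul_sum]
      exact Finset.sum_congr rfl fun r _ => Finset.sum_congr rfl fun s _ => by ring
    rw [sum_comm_pairs]
    simp only [this, Finset.sum_ite_eq, mul_ite, mul_zero, Finset.mem_univ, if_true]
    rw [Finset.mul_sum]
    exact Finset.sum_congr rfl fun _ _ => by ring
  have h7 : ∑ p, ∑ q, ∑ r, ∑ s, φ ![X, b p, b q] * φ ![Y, b r, b s] * (6 * psiC p q r s : ℝ)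
      = 24 * (6 * g X Y) := by
    rw [← h6]
    rw [sum_comm_pairs, Finset.mul_sum]
    refine Finset.sum_congr rfl fun r _ => ?_
    rw [Finset.mul_sum]
    refine Finset.sum_congr rfl fun s _ => ?_
    have := h5 r s
    calc _ = 6 * φ ![Y, b r, b s] * ∑ p, ∑ q, φ ![X, b p, b q] * psiC p q r s := by
          simp only [Finset.mul_sum]
          exact Finset.sum_congr rfl fun _ _ => Finset.sum_congr rfl fun _ _ => by ring
      _ = _ := by rw [this]; ring
  linarith

/-- 7-forms on ℝ⁷ are determined by their value on one basis, so the defining formula only has to be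
tested on the frame. -/
theorem IsG2Frame.isMetricOf {φ : Alt 3} {g : LinearMap.BilinForm ℝ E7} {b : Fin 7 → E7}
    (hb : IsOrthoFrame g b) (hφ : IsG2Frame φ b) : ∃ vol, IsMetricOf φ g vol ∧ vol b = 1 := by
  let W : E7 → E7 → Alt 7 := fun X Y => wedge (wedge (φ.curryLeft X) (φ.curryLeft Y)) φ
  have hW : ∀ X Y, W X Y b = 6 * g X Y := wedge_curryLeft_apply_frame hb hφ
  have hdet : ∀ (θ : Alt 7) (v : Fin 7 → E7), θ v = θ b * hb.basis.det v := by
    intro θ v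
    have := AlternatingMap.eq_smul_basis_det hb.basis θ.toAlternatingMap
    have h2 := congrArg (fun F => F v) this
    simp only [AlternatingMap.smul_apply, smul_eq_mul] at h2
    rw [show (⇑hb.basis) = b from funext hb.basis_apply] at h2
    exact h2
  -- Since g(b₀, b₀) = 1, the formula forces this choice of volume form.
  let vol : Alt 7 := (1 / 6 : ℝ) • W (b 0) (b 0)
  have hvb : vol b = 1 := by
    change (1 / 6 : ℝ) * W (b 0) (b 0) b = 1
    rw [hW, hb]
    norm_num
  refine ⟨vol, ⟨hb.symm, fun X hX => hb.pos hX, fun v => ?_, fun X Y => ?_⟩, hvb⟩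
  · have hM : Matrix.of (fun i j => g (v i) (v j))
        = (hb.basis.toMatrix v).transpose * hb.basis.toMatrix v := by
      ext i j
      simp only [Matrix.of_apply, Matrix.mul_apply, Matrix.transpose_apply,
        Module.Basis.toMatrix_apply, hb.basis_repr]
      exact hb.parseval _ _
    rw [hdet, hvb, one_mul, Module.Basis.det_apply, sq, hM, Matrix.det_mul, Matrix.det_transpose]
  · ext v
    change W X Y v = (6 * g X Y) * vol v
    rw [hdet, hdet vol, hW, hvb]
    ring

/-- If the volume vanished, the Gram matrix would be singular and its kernel would supply a nonzero
null vector of g. -/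
theorem IsMetricOf.apply_e_ne_zero {φ : Alt 3} {g : LinearMap.BilinForm ℝ E7} {vol : Alt 7}
    (h : IsMetricOf φ g vol) : vol e ≠ 0 := by
  intro h0
  have h1 := h.vol_sq e
  rw [h0, zero_pow two_ne_zero] at h1
  obtain ⟨v, hv, hv0⟩ := Matrix.exists_mulVec_eq_zero_iff.mpr h1.symm
  have hw : (∑ i, v i • e i : E7) ≠ 0 := by
    intro hw
    refine hv (funext fun i => ?_)
    have := congrArg (fun w : E7 => w i) hw
    simpa [Pi.single_apply] using this
  refine (h.pos _ hw).ne' ?_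
  have h2 : ∀ i, ∑ j, v j * g (e i) (e j) = 0 := by
    intro i
    have := congrFun hv0 i
    simpa [Matrix.mulVec, dotProduct, mul_comm] using this
  simp only [map_sum, map_smul, LinearMap.sum_apply, LinearMap.smul_apply, smul_eq_mul]
  simp [fun i j => h.symm (e i) (e j), h2]

/-- The formula fixes g ⊗ vol, so g = c g' and vol' = c vol with c > 0 by positivity. Comparing
determinants of Gram matrices gives c⁷ from the metrics and c² from the volumes, hence c⁹ = 1. -/
theorem IsMetricOf.unique {φ : Alt 3} {g g' : LinearMap.BilinForm ℝ E7} {vol vol' : Alt 7}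
    (h : IsMetricOf φ g vol) (h' : IsMetricOf φ g' vol') : g = g' ∧ vol = vol' := by
  have hA := h.apply_e_ne_zero
  have hA' := h'.apply_e_ne_zero
  have hf : ∀ X Y (v : Fin 7 → E7), g X Y * vol v = g' X Y * vol' v := by
    intro X Y v
    have h1 := congrArg (fun θ : Alt 7 => θ v) ((h.formula X Y).symm.trans (h'.formula X Y))
    have h2 : 6 * g X Y * vol v = 6 * g' X Y * vol' v := h1
    linarith
  have he : e 0 ≠ 0 := by
    intro h0
    have := congrArg (fun w : E7 => w 0) h0
    simp at this
  obtain ⟨c, hc⟩ : ∃ c, c = vol' e / vol e := ⟨_, rfl⟩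
  have hg : ∀ X Y, g X Y = c * g' X Y := by
    intro X Y
    rw [hc]
    field_simp
    linarith [hf X Y e]
  have hv' : vol' e = c * vol e := by
    rw [hc]
    field_simp
  have hcpos : 0 < c := by
    have h1 := h.pos _ he
    rw [hg] at h1
    exact pos_of_mul_pos_left h1 (h'.pos _ he).le
  have h9 : c ^ 9 = 1 := by
    have h1 := h.vol_sq e
    have h2 : Matrix.of (fun i j => g (e i) (e j)) = c • Matrix.of (fun i j => g' (e i) (e j)) := by
      ext i j
      simp [hg]
    rw [h2, Matrix.det_smul, ← h'.vol_sq e, hv'] at h1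
    simp only [Fintype.card_fin] at h1
    have h3 : vol e ^ 2 * (c ^ 9 - 1) = 0 := by linear_combination -h1
    rcases mul_eq_zero.mp h3 with h4 | h4
    · exact absurd h4 (pow_ne_zero 2 hA)
    · linarith
  have hc1 : c = 1 := (pow_eq_one_iff_of_nonneg hcpos.le (by norm_num)).mp h9
  have hgg : ∀ X Y, g X Y = g' X Y := fun X Y => by rw [hg, hc1, one_mul]
  refine ⟨LinearMap.ext₂ hgg, ?_⟩
  ext v
  have h1 := hf (e 0) (e 0) v
  rw [hgg] at h1
  exact mul_left_cancel₀ (h'.pos _ he).ne' h1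

theorem IsMetricOf.metricPair_eq {φ : Alt 3} {g : LinearMap.BilinForm ℝ E7} {vol : Alt 7}
    (h : IsMetricOf φ g vol) : metricPair φ = (g, vol) := by
  have h1 : IsMetricOf φ (metricPair φ).1 (metricPair φ).2 :=
    Classical.epsilon_spec (p := fun p : LinearMap.BilinForm ℝ E7 × Alt 7 => IsMetricOf φ p.1 p.2)
      ⟨(g, vol), h⟩
  obtain ⟨h2, h3⟩ := h1.unique h
  exact Prod.ext h2 h3

theorem IsG2Frame.metric_eq {φ : Alt 3} {g : LinearMap.BilinForm ℝ E7} {b : Fin 7 → E7}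
    (hb : IsOrthoFrame g b) (hφ : IsG2Frame φ b) (X Y : E7) : metric φ X Y = g X Y := by
  obtain ⟨vol, h, -⟩ := hφ.isMetricOf hb
  rw [metric, h.metricPair_eq]

theorem IsG2Frame.volForm_frame {φ : Alt 3} {g : LinearMap.BilinForm ℝ E7} {b : Fin 7 → E7}
    (hb : IsOrthoFrame g b) (hφ : IsG2Frame φ b) (i : Fin 7 → Fin 7) :
    volForm φ (fun a => b (i a)) = eps i := by
  obtain ⟨vol, h, hv⟩ := hφ.isMetricOf hb
  rw [volForm, h.metricPair_eq]
  by_cases hi : Function.Injective i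
  · let σ : Equiv.Perm (Fin 7) := Equiv.ofBijective i (Finite.injective_iff_bijective.mp hi)
    have h1 := vol.toAlternatingMap.map_perm b σ
    have h2 : vol (fun a => b (i a)) = Equiv.Perm.sign σ • vol b := h1
    rw [h2, hv, show eps i = Equiv.Perm.sign σ from eps_perm σ]
    simp [Units.smul_def]
  · rw [eps_eq_zero hi]
    simp only [Function.Injective, not_forall] at hi
    obtain ⟨a, c, hac, hne⟩ := hi
    simpa using vol.map_eq_zero_of_eq (fun a => b (i a)) (congrArg b hac) hne

/-- The dual 4-form as a multilinear map. -/
noncomputable def psiMulti (φ : Alt 3) : MultilinearMap ℝ (fun _ : Fin 4 => E7) ℝ :=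
  (1 / 6 : ℝ) • ∑ i : Fin 3 → Fin 7, ∑ j : Fin 3 → Fin 7,
    ((∏ a, invGram (metric φ) (i a) (j a)) * φ (fun a => e (i a))) •
    ((volForm φ).toMultilinearMap.domDomCongr finSumFinEquiv.symm).currySum (fun a => e (j a))

theorem currySum_apply_append {k l : ℕ} (θ : MultilinearMap ℝ (fun _ : Fin (k + l) => E7) ℝ)
    (w : Fin k → E7) (v : Fin l → E7) :
    (θ.domDomCongr finSumFinEquiv.symm).currySum w v = θ (Fin.append w v) := by
  rw [MultilinearMap.currySum_apply, MultilinearMap.domDomCongr_apply]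
  congr 1
  funext x
  refine Fin.addCases (fun i => ?_) (fun i => ?_) x <;> simp

theorem psiMulti_apply (φ : Alt 3) (v : Fin 4 → E7) : psiMulti φ v = psi φ v := by
  have h := fun w => currySum_apply_append (k := 3) (l := 4) (volForm φ).toMultilinearMap w v
  simp only [psiMulti, psi, smul_apply, _root_.sum_apply, smul_eq_mul, h]
  rfl

/-- The contraction of φ with the volume form may be carried out in the frame, where the volume form
is the Levi-Civita symbol. -/
theorem IsG2Frame.psi_frame {φ : Alt 3} {g : LinearMap.BilinForm ℝ E7} {b : Fin 7 → E7}
    (hb : IsOrthoFrame g b) (hφ : IsG2Frame φ b) (p q r s : Fin 7) :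
    psi φ ![b p, b q, b r, b s] = psiC p q r s := by
  let B : MultilinearMap ℝ (fun _ : Fin 3 => E7) ℝ :=
    { toFun := fun w => volForm φ (Fin.append w ![b p, b q, b r, b s])
      map_update_add' := by
        intro _ w i x y
        have h := fun w => currySum_apply_append (k := 3) (l := 4) (volForm φ).toMultilinearMap w
          ![b p, b q, b r, b s]
        simp only [ContinuousMultilinearMap.coe_coe, ContinuousAlternatingMap.coe_toContinuousMultilinearMap] at h
        rw [← h, ← h, ← h, MultilinearMap.map_update_add]
        rfl
      map_update_smul' := by
        intro _ w i c x
        have h := fun w => currySum_apply_append (k := 3) (l := 4) (volForm φ).toMultilinearMap w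
          ![b p, b q, b r, b s]
        simp only [ContinuousMultilinearMap.coe_coe, ContinuousAlternatingMap.coe_toContinuousMultilinearMap] at h
        rw [← h, ← h, MultilinearMap.map_update_smul]
        rfl }
  have h1 := hb.contract (hφ.metric_eq hb) φ.toMultilinearMap B
  have h2 : psi φ ![b p, b q, b r, b s] = 1 / 6 * ∑ i : Fin 3 → Fin 7,
      φ (fun a => b (i a)) * volForm φ (Fin.append (fun a => b (i a)) ![b p, b q, b r, b s]) := by
    rw [psi]
    congr 1
  rw [h2]
  simp only [sum_fin_succ_fun, sum_fin_zero_fun]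
  have h3 : ∀ a b' c : Fin 7, φ (fun x => b ((![a, b', c] : Fin 3 → Fin 7) x))
      * volForm φ (Fin.append (fun x => b ((![a, b', c] : Fin 3 → Fin 7) x)) ![b p, b q, b r, b s])
      = (eps7 p q r s a b' c : ℝ) * phiC a b' c := by
    intro a b' c
    rw [← eps_vec7', ← hφ.volForm_frame hb, ← hφ a b' c, mul_comm]
    congr 2
    · ext x : 1
      fin_cases x <;> rfl
    · ext x : 1
      fin_cases x <;> rfl
  have h4 := sum_crossSign_eps7_real p q r s
  rw [Finset.sum_congr rfl fun a _ => Finset.sum_congr rfl fun b' _ =>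
    Finset.sum_congr rfl fun c _ => h3 a b' c, h4]
  ring

end MetricOfFrame

end G2Flow

namespace G2Flow

/-! ### Contact metric structures and transverse `(3,0)`-forms at a point -/

section Pointwise

/-- An almost contact metric structure on `ℝ⁷`. -/
structure IsAlmostContact (g : E7 →L[ℝ] E7 →L[ℝ] ℝ) (η : E7 →L[ℝ] ℝ) (ξ : E7)
    (Φ : E7 →L[ℝ] E7) : Prop where
  symm : ∀ X Y, g X Y = g Y X
  pos : ∀ X, X ≠ 0 → 0 < g X X
  η_ξ : η ξ = 1
  Φ_sq : ∀ X, Φ (Φ X) = -X + η X • ξ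
  g_Φ : ∀ X Y, g (Φ X) (Φ Y) = g X Y - η X * η Y

/-- A unitary triple spanning the contact distribution. -/
structure IsUnitary (g : E7 →L[ℝ] E7 →L[ℝ] ℝ) (η : E7 →L[ℝ] ℝ)
    (Φ : E7 →L[ℝ] E7) (u : Fin 3 → E7) : Prop where
  η_u : ∀ a, η (u a) = 0
  g_u : ∀ a b, g (u a) (u b) = if a = b then 1 else 0
  g_Φu : ∀ a b, g (Φ (u a)) (u b) = 0

/-- A trilinear form is alternating of type `(3,0)`. -/
structure IsTypeThreeZero (Φ : E7 →L[ℝ] E7) (P : E7 →L[ℝ] E7 →L[ℝ] E7 →L[ℝ] ℂ) : Prop where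
  swap₁ : ∀ X Y Z, P X Y Z = - P Y X Z
  swap₂ : ∀ X Y Z, P X Y Z = - P X Z Y
  type : ∀ X Y Z, P (Φ X) Y Z = Complex.I * P X Y Z

namespace IsAlmostContact

variable {g : E7 →L[ℝ] E7 →L[ℝ] ℝ} {η : E7 →L[ℝ] ℝ} {ξ : E7} {Φ : E7 →L[ℝ] E7}
variable (h : IsAlmostContact g η ξ Φ)

include h

/-- Applying Φ² = -1 + η ⊗ ξ to Φξ, with Φ²ξ = 0, shows that Φξ is a multiple of ξ; applying Φ once
more shows that the square of the coefficient is zero. -/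
theorem Φ_ξ : Φ ξ = 0 := by
  have h1 : Φ (Φ ξ) = 0 := by rw [h.Φ_sq, h.η_ξ]; simp
  have h2 : Φ (Φ (Φ ξ)) = 0 := by rw [h1, map_zero]
  rw [h.Φ_sq] at h2
  have h3 : Φ ξ = η (Φ ξ) • ξ := (neg_add_eq_zero.mp h2)
  have h4 : η (Φ ξ) * η (Φ ξ) = 0 := by
    have h5 := h1
    rw [h3, map_smul, h3] at h5
    have h6 := congrArg η h5
    simpa [h.η_ξ] using h6
  rw [h3, mul_self_eq_zero.mp h4, zero_smul]

theorem η_Φ (X : E7) : η (Φ X) = 0 := by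
  have h1 : Φ (Φ (Φ X)) = - Φ X := by rw [h.Φ_sq X]; simp [h.Φ_ξ]
  rw [h.Φ_sq (Φ X)] at h1
  have h2 : η (Φ X) • ξ = 0 := by simpa using h1
  have h3 := congrArg η h2
  simpa [h.η_ξ] using h3

theorem g_ξ (X : E7) : g ξ X = η X := by
  have h1 := h.g_Φ ξ X
  rw [h.Φ_ξ, h.η_ξ] at h1
  simp only [map_zero, zero_apply] at h1
  linarith

theorem g_ξ' (X : E7) : g X ξ = η X := by rw [h.symm, h.g_ξ]

theorem skew (X Y : E7) : g (Φ X) Y = - g X (Φ Y) := by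
  have h1 := h.g_Φ X (Φ Y)
  rw [h.Φ_sq, h.η_Φ] at h1
  simp only [map_add, map_neg, map_smul, h.g_ξ', h.η_Φ, smul_zero, mul_zero] at h1
  linarith

theorem om_swap (X Y : E7) : g (Φ X) Y = - g (Φ Y) X := by
  rw [h.skew, h.symm]

/-- Five linear conditions on ℝ⁷ have a nonzero solution. Five is what the last vector of a unitary
triple needs: ξ, u₀, Φu₀, u₁, Φu₁. -/
theorem exists_unit_orthogonal (s : Fin 5 → E7) : ∃ u, g u u = 1 ∧ ∀ i, g (s i) u = 0 := by
  let L : E7 →ₗ[ℝ] (Fin 5 → ℝ) := LinearMap.pi fun i => (g (s i) : E7 →ₗ[ℝ] ℝ)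
  have hker : LinearMap.ker L ≠ ⊥ := LinearMap.ker_ne_bot_of_finrank_lt (by simp)
  obtain ⟨v, hv, hv0⟩ := (Submodule.ne_bot_iff _).mp hker
  have hLv : ∀ i, g (s i) v = 0 := fun i => congrFun (LinearMap.mem_ker.mp hv) i
  have hpos := h.pos v hv0
  refine ⟨(Real.sqrt (g v v))⁻¹ • v, ?_, fun i => by simp [hLv]⟩
  have h1 := Real.mul_self_sqrt hpos.le
  have h2 : Real.sqrt (g v v) ≠ 0 := (Real.sqrt_pos.mpr hpos).ne'
  simp only [map_smul, smul_apply, smul_eq_mul]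
  field_simp
  rw [sq, h1]

theorem exists_unitary : ∃ u, IsUnitary g η Φ u := by
  obtain ⟨u₀, h00, h0⟩ := h.exists_unit_orthogonal fun _ => ξ
  -- The list of constraints has length five, so ξ is repeated as padding.
  obtain ⟨u₁, h11, h1⟩ := h.exists_unit_orthogonal ![ξ, u₀, Φ u₀, ξ, ξ]
  obtain ⟨u₂, h22, h2⟩ := h.exists_unit_orthogonal ![ξ, u₀, Φ u₀, u₁, Φ u₁]
  have self : ∀ v, g (Φ v) v = 0 := fun v => by linarith [h.om_swap v v]
  have e0 := h0 0
  have a0 := h1 0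
  have a1 := h1 1
  have a2 := h1 2
  have b0 := h2 0
  have b1 := h2 1
  have b2 := h2 2
  have b3 := h2 3
  have b4 := h2 4
  simp only [Matrix.cons_val, h.g_ξ] at e0 a0 a1 a2 b0 b1 b2 b3 b4
  refine ⟨![u₀, u₁, u₂], ⟨fun a => ?_, fun a b => ?_, fun a b => ?_⟩⟩
  · fin_cases a <;> simpa
  · fin_cases a <;> fin_cases b <;> simp [*, h.symm u₁ u₀, h.symm u₂ u₀, h.symm u₂ u₁]
  · fin_cases a <;> fin_cases b <;>
      simp [*, h.om_swap u₁ u₀, h.om_swap u₂ u₀, h.om_swap u₂ u₁]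

end IsAlmostContact

/-- The frame `ξ, u₀, Φu₀, u₁, Φu₁, u₂, Φu₂`. -/
noncomputable def unitaryFrame (ξ : E7) (Φ : E7 →L[ℝ] E7) (u : Fin 3 → E7) : Fin 7 → E7 :=
  ![ξ, u 0, Φ (u 0), u 1, Φ (u 1), u 2, Φ (u 2)]

/-- A continuous bilinear form as a bilinear form. -/
noncomputable def toBilin (g : E7 →L[ℝ] E7 →L[ℝ] ℝ) : LinearMap.BilinForm ℝ E7 :=
  LinearMap.mk₂ ℝ (fun X Y => g X Y) (by simp) (by simp) (by simp) (by simp)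

@[simp]
theorem toBilin_apply (g : E7 →L[ℝ] E7 →L[ℝ] ℝ) (X Y : E7) : toBilin g X Y = g X Y := rfl

/-- The complex coordinates of a vector with respect to a unitary triple. -/
noncomputable def zCoord (g : E7 →L[ℝ] E7 →L[ℝ] ℝ) (Φ : E7 →L[ℝ] E7) (u : Fin 3 → E7)
    (a : Fin 3) (v : E7) : ℂ := g v (u a) + g v (Φ (u a)) * Complex.I

section Unitary

variable {g : E7 →L[ℝ] E7 →L[ℝ] ℝ} {η : E7 →L[ℝ] ℝ} {ξ : E7} {Φ : E7 →L[ℝ] E7}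
variable (h : IsAlmostContact g η ξ Φ) {u : Fin 3 → E7} (hu : IsUnitary g η Φ u)

include h hu

theorem IsUnitary.g_Φu' (a b : Fin 3) : g (u a) (Φ (u b)) = 0 := by
  rw [h.symm, hu.g_Φu]

theorem IsUnitary.g_ΦuΦu (a b : Fin 3) : g (Φ (u a)) (Φ (u b)) = if a = b then 1 else 0 := by
  rw [h.g_Φ, hu.g_u, hu.η_u, zero_mul, sub_zero]

theorem IsUnitary.isOrthoFrame : IsOrthoFrame (toBilin g) (unitaryFrame ξ Φ u) := by
  intro i j
  fin_cases i <;> fin_cases j <;>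
    simp [unitaryFrame, h.g_ξ, h.g_ξ', h.η_ξ, h.η_Φ, hu.η_u, hu.g_u, hu.g_Φu, hu.g_Φu' h,
      hu.g_ΦuΦu h]

theorem IsUnitary.η_frame (i : Fin 7) : η (unitaryFrame ξ Φ u i) = etaC i := by
  fin_cases i <;> simp [unitaryFrame, h.η_ξ, h.η_Φ, hu.η_u, etaC]

theorem IsUnitary.zCoord_frame (a : Fin 3) (i : Fin 7) :
    zCoord g Φ u a (unitaryFrame ξ Φ u i) = reC a i + imC a i * Complex.I := by
  fin_cases a <;> fin_cases i <;>
    simp [unitaryFrame, zCoord, h.g_ξ, hu.η_u, h.η_Φ, hu.g_u, hu.g_Φu, hu.g_Φu' h, hu.g_ΦuΦu h,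
      reC, imC]

theorem IsUnitary.om_frame (i j : Fin 7) :
    g (Φ (unitaryFrame ξ Φ u i)) (unitaryFrame ξ Φ u j) = omC i j := by
  fin_cases i <;> fin_cases j <;>
    simp [unitaryFrame, h.Φ_ξ, h.Φ_sq, h.g_ξ', h.η_Φ, hu.η_u, hu.g_u, hu.g_Φu,
      hu.g_Φu' h, hu.g_ΦuΦu h, omC, Fin.sum_univ_three, reC, imC]

theorem IsUnitary.expand (v : E7) :
    v = η v • ξ + ∑ a, (g v (u a) • u a + g v (Φ (u a)) • Φ (u a)) := by
  conv_lhs => rw [← (hu.isOrthoFrame h).expand v]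
  simp [Fin.sum_univ_succ, unitaryFrame, h.g_ξ']
  abel

/-- A (3,0)-form annihilates ξ because Φξ = 0, and it is complex linear for Φ; so it sees only the
complex coordinates of a vector. -/
theorem IsUnitary.typeThreeZero_left {P : E7 →L[ℝ] E7 →L[ℝ] E7 →L[ℝ] ℂ}
    (hP : IsTypeThreeZero Φ P) (v Y Z : E7) :
    P v Y Z = ∑ a, zCoord g Φ u a v * P (u a) Y Z := by
  have hξ : P ξ Y Z = 0 := by
    have h1 := hP.type ξ Y Z
    rw [h.Φ_ξ] at h1
    simpa using h1.symm
  conv_lhs => rw [hu.expand h v]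
  simp [_root_.sum_apply, hξ, hP.type, zCoord, add_mul, mul_assoc]

/-- A transverse `(3,0)`-form is a multiple of `dz₀ ∧ dz₁ ∧ dz₂`. -/
theorem IsUnitary.typeThreeZero_eq {P : E7 →L[ℝ] E7 →L[ℝ] E7 →L[ℝ] ℂ}
    (hP : IsTypeThreeZero Φ P) (v : Fin 3 → E7) :
    P (v 0) (v 1) (v 2) = P (u 0) (u 1) (u 2) *
      (Matrix.of fun a b => zCoord g Φ u a (v b)).det := by
  have h2 : ∀ X Y Z, P X Y Z = ∑ a, zCoord g Φ u a Y * P X (u a) Z := by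
    intro X Y Z
    rw [hP.swap₁, hu.typeThreeZero_left h hP, ← Finset.sum_neg_distrib]
    exact Finset.sum_congr rfl fun a _ => by rw [hP.swap₁ X (u a) Z]; ring
  have h3 : ∀ X Y Z, P X Y Z = ∑ a, zCoord g Φ u a Z * P X Y (u a) := by
    intro X Y Z
    rw [hP.swap₂, h2, ← Finset.sum_neg_distrib]
    exact Finset.sum_congr rfl fun a _ => by rw [hP.swap₂ X Y (u a)]; ring
  have s1 : ∀ X Z, P X X Z = 0 := fun X Z => by
    have := hP.swap₁ X X Z
    exact self_eq_neg.mp this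
  have s2 : ∀ X Z, P X Z Z = 0 := fun X Z => by
    have := hP.swap₂ X Z Z
    exact self_eq_neg.mp this
  have s3 : ∀ X Z, P X Z X = 0 := fun X Z => by rw [hP.swap₁, s2, neg_zero]
  rw [hu.typeThreeZero_left h hP]
  simp_rw [h2 _ (v 1) (v 2), h3 _ _ (v 2)]
  simp only [Fin.sum_univ_three, s1, s2, s3, Matrix.det_fin_three, Matrix.of_apply]
  have e1 : P (u 0) (u 2) (u 1) = - P (u 0) (u 1) (u 2) := hP.swap₂ _ _ _
  have e2 : P (u 1) (u 0) (u 2) = - P (u 0) (u 1) (u 2) := hP.swap₁ _ _ _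
  have e3 : P (u 1) (u 2) (u 0) = P (u 0) (u 1) (u 2) := by
    rw [hP.swap₂, e2, neg_neg]
  have e4 : P (u 2) (u 0) (u 1) = P (u 0) (u 1) (u 2) := by
    rw [hP.swap₁, e1, neg_neg]
  have e5 : P (u 2) (u 1) (u 0) = - P (u 0) (u 1) (u 2) := by
    rw [hP.swap₂, e4]
  rw [e1, e2, e3, e4, e5]
  ring

theorem IsUnitary.typeThreeZero_frame {P : E7 →L[ℝ] E7 →L[ℝ] E7 →L[ℝ] ℂ}
    (hP : IsTypeThreeZero Φ P) (i : Fin 3 → Fin 7) :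
    P (unitaryFrame ξ Φ u (i 0)) (unitaryFrame ξ Φ u (i 1)) (unitaryFrame ξ Φ u (i 2))
      = P (u 0) (u 1) (u 2) * ((reDet (fun a b => reC a (i b)) (fun a b => imC a (i b)) : ℂ)
        + imDet (fun a b => reC a (i b)) (fun a b => imC a (i b)) * Complex.I) := by
  rw [hu.typeThreeZero_eq h hP fun b => unitaryFrame ξ Φ u (i b), ← det_eq_reDet_add_imDet]
  simp only [hu.zCoord_frame h]

/-- Multiplying the first vector of a unitary triple by a phase. -/
theorem IsUnitary.exists_normalized {P : E7 →L[ℝ] E7 →L[ℝ] E7 →L[ℝ] ℂ}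
    (hP : IsTypeThreeZero Φ P) (hn : ‖P (u 0) (u 1) (u 2)‖ = 1) :
    ∃ u', IsUnitary g η Φ u' ∧ P (u' 0) (u' 1) (u' 2) = 1 := by
  obtain ⟨c, hc⟩ : ∃ c, c = P (u 0) (u 1) (u 2) := ⟨_, rfl⟩
  rw [← hc] at hn
  have hc2 : c.re * c.re + c.im * c.im = 1 := by
    rw [← Complex.normSq_apply, Complex.normSq_eq_norm_sq, hn, one_pow]
  -- The complex number c̄, acting through Φ, multiplies u₀; complex linearity then gives the value
  -- c̄c = 1.
  refine ⟨![c.re • u 0 - c.im • Φ (u 0), u 1, u 2], ⟨fun a => ?_, fun a b => ?_, fun a b => ?_⟩, ?_⟩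
  · fin_cases a <;> simp [hu.η_u, h.η_Φ]
  · fin_cases a <;> fin_cases b <;> simp [hu.g_u, hu.g_Φu, hu.g_Φu' h, hu.g_ΦuΦu h, hc2]
  · fin_cases a <;> fin_cases b <;> simp [hu.g_u, hu.g_Φu, hu.g_Φu' h, hu.g_ΦuΦu h, h.Φ_sq, hu.η_u]
    ring
  · simp only [Matrix.cons_val, map_sub, map_smul, sub_apply, smul_apply, hP.type, ← hc]
    apply Complex.ext
    · simp; linarith
    · simp; ring

end Unitary

end Pointwise

end G2Flow

/-! ### Unit length of the transverse holomorphic volume form. -/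

namespace G2Flow

section Unitary

variable {g : E7 →L[ℝ] E7 →L[ℝ] ℝ} {η : E7 →L[ℝ] ℝ} {ξ : E7} {Φ : E7 →L[ℝ] E7}
variable (h : IsAlmostContact g η ξ Φ) {u : Fin 3 → E7} (hu : IsUnitary g η Φ u)

include h hu

/-- The norm of a transverse holomorphic volume form. -/
theorem IsUnitary.norm_eq_one {Υ : E7 [⋀^Fin 3]→L[ℝ] ℂ} {om : E7 [⋀^Fin 2]→L[ℝ] ℝ}
    {P : E7 →L[ℝ] E7 →L[ℝ] E7 →L[ℝ] ℂ} (hP : IsTypeThreeZero Φ P)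
    (hΥ : ∀ X Y Z, Υ ![X, Y, Z] = P X Y Z) (hom : ∀ X Y, om ![X, Y] = g (Φ X) Y)
    (hw : ∀ v : Fin 6 → E7,
      wedge Υ ((Complex.conjCLE : ℂ →L[ℝ] ℂ).compContinuousAlternatingMap Υ) v
        = -(4 * Complex.I / 3) * (wedge (wedge om om) om v : ℝ)) :
    ‖P (u 0) (u 1) (u 2)‖ = 1 := by
  obtain ⟨c, hc⟩ : ∃ c, c = P (u 0) (u 1) (u 2) := ⟨_, rfl⟩
  rw [← hc]
  let v : Fin 6 → E7 := fun i => unitaryFrame ξ Φ u i.succ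
  have hΥv : ∀ i j k : Fin 6, Υ ![v i, v j, v k] = c * (upsRe i j k + upsIm i j k * Complex.I) := by
    intro i j k
    rw [hΥ, upsRe_eq, upsIm_eq, hc]
    exact hu.typeThreeZero_frame h hP fun b => (![i, j, k] b).succ
  have homv : ∀ i j : Fin 6, om ![v i, v j] = omC i.succ j.succ := by
    intro i j
    rw [hom]
    exact hu.om_frame h _ _
  have hvec3 : ∀ p q r a b' c' : Fin 6,
      (fun x => v ((![p, q, r, a, b', c'] : Fin 6 → Fin 6) (Fin.castAdd 3 x))) = ![v p, v q, v r] ∧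
      (fun x => v ((![p, q, r, a, b', c'] : Fin 6 → Fin 6) (Fin.natAdd 3 x))) = ![v a, v b', v c'] := by
    intro p q r a b' c'
    constructor <;> · ext i : 1; fin_cases i <;> rfl
  have hvec2 : ∀ p q r a b' c' : Fin 6,
      (fun x => v ((![p, q, r, a, b', c'] : Fin 6 → Fin 6) (Fin.castAdd 2 (Fin.castAdd 2 x))))
        = ![v p, v q] ∧
      (fun x => v ((![p, q, r, a, b', c'] : Fin 6 → Fin 6) (Fin.castAdd 2 (Fin.natAdd 2 x))))
        = ![v r, v a] ∧
      (fun x => v ((![p, q, r, a, b', c'] : Fin 6 → Fin 6) (Fin.natAdd 4 x))) = ![v b', v c'] := by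
    intro p q r a b' c'
    refine ⟨?_, ?_, ?_⟩ <;> · ext i : 1; fin_cases i <;> rfl
  have h1 := (factorial_smul_wedge Υ
    ((Complex.conjCLE : ℂ →L[ℝ] ℂ).compContinuousAlternatingMap Υ) v).trans
    (sum_perm_eq_sum_eps (R := ℂ) (n := 3 + 3) fun i => Υ (fun x => v (i (Fin.castAdd 3 x))) *
      (Complex.conjCLE : ℂ →L[ℝ] ℂ).compContinuousAlternatingMap Υ
        (fun x => v (i (Fin.natAdd 3 x))))
  have h2 := factorial_smul_wedge_wedge om om om v
  simp only [sum_fin_succ_fun, sum_fin_zero_fun] at h1 h2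
  have h3 : (8 : ℝ) * (wedge (wedge om om) om : Alt 6) v = 48 := by
    have e48 : (48 : ℝ) = ((∑ p, ∑ q, ∑ r, ∑ a, ∑ b, ∑ c, eps6 p q r a b c *
      (omC p.succ q.succ * omC r.succ a.succ * omC b.succ c.succ) : ℤ) : ℝ) := by
      have : (48 : ℝ) = ((48 : ℤ) : ℝ) := by norm_num
      rw [this, ← sum_eps6_om, Int.cast_inj]
      refine Finset.sum_congr rfl fun p _ => Finset.sum_congr rfl fun q _ => ?_
      split_ifs with h0
      · simp [h0]
      · refine Finset.sum_congr rfl fun r _ => Finset.sum_congr rfl fun a _ => ?_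
        split_ifs with h0
        · simp [h0]
        · rfl
    rw [e48]
    push_cast
    rw [nsmul_eq_mul] at h2
    refine Eq.trans ?_ (h2.trans ?_)
    · norm_num [Nat.factorial]
    · refine Finset.sum_congr rfl fun p _ => Finset.sum_congr rfl fun q _ =>
        Finset.sum_congr rfl fun r _ => Finset.sum_congr rfl fun a _ =>
        Finset.sum_congr rfl fun b' _ => Finset.sum_congr rfl fun c' _ => ?_
      obtain ⟨e1, e2, e3⟩ := hvec2 p q r a b' c'
      exact congrArg₂ _ (congrArg _ (eps_vec6 p q r a b' c'))
        (congrArg₂ _ (congrArg₂ _ ((congrArg om e1).trans (homv p q))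
          ((congrArg om e2).trans (homv r a))) ((congrArg om e3).trans (homv b' c')))
  have h4 : (36 : ℂ) * wedge Υ ((Complex.conjCLE : ℂ →L[ℝ] ℂ).compContinuousAlternatingMap Υ) v
      = (c * starRingEnd ℂ c) * (-288 * Complex.I) := by
    have ere : ((∑ p, ∑ q, ∑ r, ∑ a, ∑ b, ∑ c, eps6 p q r a b c *
        (upsRe p q r * upsRe a b c + upsIm p q r * upsIm a b c) : ℤ) : ℂ) = 0 := by
      rw [← Int.cast_zero, ← sum_eps6_re, Int.cast_inj]
      refine Finset.sum_congr rfl fun p _ => Finset.sum_congr rfl fun q _ =>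
        Finset.sum_congr rfl fun r _ => ?_
      split_ifs with h0
      · simp [h0.1, h0.2]
      · rfl
    have eim : ((∑ p, ∑ q, ∑ r, ∑ a, ∑ b, ∑ c, eps6 p q r a b c *
        (upsIm p q r * upsRe a b c - upsRe p q r * upsIm a b c) : ℤ) : ℂ) = -288 := by
      have : (-288 : ℂ) = ((-288 : ℤ) : ℂ) := by norm_num
      rw [this, ← sum_eps6_im, Int.cast_inj]
      refine Finset.sum_congr rfl fun p _ => Finset.sum_congr rfl fun q _ =>
        Finset.sum_congr rfl fun r _ => ?_
      split_ifs with h0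
      · simp [h0.1, h0.2]
      · rfl
    have e0 : (c * starRingEnd ℂ c) * (-288 * Complex.I)
        = (c * starRingEnd ℂ c) * (0 + -288 * Complex.I) := by ring
    rw [e0, ← ere, ← eim]
    push_cast
    simp only [Finset.sum_mul, Finset.mul_sum, ← Finset.sum_add_distrib]
    rw [nsmul_eq_mul] at h1
    refine Eq.trans ?_ (h1.trans ?_)
    · norm_num [Nat.factorial]
    · refine Finset.sum_congr rfl fun p _ => Finset.sum_congr rfl fun q _ =>
        Finset.sum_congr rfl fun r _ => Finset.sum_congr rfl fun a _ =>
        Finset.sum_congr rfl fun b' _ => Finset.sum_congr rfl fun c' _ => ?_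
      obtain ⟨e1, e2⟩ := hvec3 p q r a b' c'
      have e3 : Υ (fun x => v ((![p, q, r, a, b', c'] : Fin 6 → Fin 6) (Fin.castAdd 3 x)))
          = c * (upsRe p q r + upsIm p q r * Complex.I) := (congrArg Υ e1).trans (hΥv p q r)
      have e4 : (Complex.conjCLE : ℂ →L[ℝ] ℂ).compContinuousAlternatingMap Υ
          (fun x => v ((![p, q, r, a, b', c'] : Fin 6 → Fin 6) (Fin.natAdd 3 x)))
          = starRingEnd ℂ c * (upsRe a b' c' - upsIm a b' c' * Complex.I) := by
        rw [ContinuousLinearMap.compContinuousAlternatingMap_coe, Function.comp_apply, e2, hΥv]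
        simp [sub_eq_add_neg]
      refine (congrArg₂ _ (congrArg _ (eps_vec6 p q r a b' c')) (congrArg₂ _ e3 e4)).trans ?_
      linear_combination (-(eps6 p q r a b' c' : ℂ) * c * starRingEnd ℂ c * upsIm p q r *
        upsIm a b' c') * Complex.I_sq
  have h5 : (wedge (wedge om om) om : Alt 6) v = 6 := by linarith
  have h6 := hw v
  -- The normalization evaluates to -(4i/3) · 6 = -8i on the frame, while the left side is |c|²
  -- times -8i.
  have h7 : c * starRingEnd ℂ c = 1 := by
    have h8 : ((wedge (wedge om om) om : Alt 6) v : ℂ) = 6 := by rw [h5]; norm_num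
    have h9 : (36 : ℂ) * (-(4 * Complex.I / 3) * 6) = (c * starRingEnd ℂ c) * (-288 * Complex.I) := by
      rw [← h8, ← h4]
      exact congrArg _ h6.symm
    have hI : (288 * Complex.I : ℂ) ≠ 0 := by simp
    refine mul_right_cancel₀ hI ?_
    linear_combination h9
  rw [Complex.mul_conj, Complex.normSq_eq_norm_sq] at h7
  have h8 : ‖c‖ ^ 2 = 1 := by exact_mod_cast h7
  exact (pow_eq_one_iff_of_nonneg (norm_nonneg c) two_ne_zero).mp h8

end Unitary

end G2Flow

set_option maxSynthPendingDepth 5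

namespace G2Flow

/-! ### Contact Calabi-Yau structures on open subsets of `ℝ⁷` -/

section Local

/-- A contact Calabi-Yau structure on an open subset of `ℝ⁷`. -/
structure LocalCCY (U : Set E7) where
  g : E7 → E7 →L[ℝ] E7 →L[ℝ] ℝ
  η : E7 → E7 →L[ℝ] ℝ
  ξ : E7 → E7
  Φ : E7 → E7 →L[ℝ] E7
  Υ : E7 → E7 →L[ℝ] E7 →L[ℝ] E7 →L[ℝ] ℂ
  isOpen : IsOpen U
  smooth_g : ContDiffOn ℝ ∞ g U
  smooth_η : ContDiffOn ℝ ∞ η U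
  smooth_ξ : ContDiffOn ℝ ∞ ξ U
  smooth_Φ : ContDiffOn ℝ ∞ Φ U
  smooth_Υ : ContDiffOn ℝ ∞ Υ U
  contact : ∀ y ∈ U, IsAlmostContact (g y) (η y) (ξ y) (Φ y)
  dη_eq : ∀ y ∈ U, ∀ X Y, fderiv ℝ η y X Y - fderiv ℝ η y Y X = g y (Φ y X) Y
  normal : ∀ y ∈ U, ∀ X Y, fderiv ℝ Φ y (Φ y X) Y - fderiv ℝ Φ y (Φ y Y) X
    - Φ y (fderiv ℝ Φ y X Y) + Φ y (fderiv ℝ Φ y Y X) + g y (Φ y X) Y • ξ y = 0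
  typeThreeZero : ∀ y ∈ U, IsTypeThreeZero (Φ y) (Υ y)
  dΥ_eq : ∀ y ∈ U, ∀ A B C D, fderiv ℝ Υ y A B C D - fderiv ℝ Υ y B A C D
    + fderiv ℝ Υ y C A B D - fderiv ℝ Υ y D A B C = 0
  norm_Υ : ∀ y ∈ U, ∀ u, IsUnitary (g y) (η y) (Φ y) u → ‖Υ y (u 0) (u 1) (u 2)‖ = 1

theorem fderiv_clm_apply_apply {F F' : Type*} [NormedAddCommGroup F] [NormedSpace ℝ F]
    [NormedAddCommGroup F'] [NormedSpace ℝ F'] {c : E7 → F →L[ℝ] F'} {u : E7 → F} {y : E7}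
    (hc : DifferentiableAt ℝ c y) (hu : DifferentiableAt ℝ u y) (X : E7) :
    fderiv ℝ (fun z => c z (u z)) y X = fderiv ℝ c y X (u y) + c y (fderiv ℝ u y X) := by
  rw [fderiv_clm_apply hc hu]
  simp [add_comm]

theorem fderiv_clm_apply_const {F F' : Type*} [NormedAddCommGroup F] [NormedSpace ℝ F]
    [NormedAddCommGroup F'] [NormedSpace ℝ F'] {c : E7 → F →L[ℝ] F'} {y : E7}
    (hc : DifferentiableAt ℝ c y) (v : F) (X : E7) :
    fderiv ℝ (fun z => c z v) y X = fderiv ℝ c y X v := by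
  rw [fderiv_clm_apply_apply hc (differentiableAt_const v)]
  simp

theorem fderiv_congr_of_isOpen {F : Type*} [NormedAddCommGroup F] [NormedSpace ℝ F] {U : Set E7}
    (hU : IsOpen U) {f f' : E7 → F} (h : ∀ z ∈ U, f z = f' z) {y : E7} (hy : y ∈ U) :
    fderiv ℝ f y = fderiv ℝ f' y :=
  Filter.EventuallyEq.fderiv_eq (Filter.eventually_of_mem (hU.mem_nhds hy) h)

namespace LocalCCY

variable {U : Set E7} (L : LocalCCY U)

/-- The transverse Kähler form. -/
noncomputable def om (y : E7) : E7 →L[ℝ] E7 →L[ℝ] ℝ := (L.g y).comp (L.Φ y)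

@[simp]
theorem om_apply (y X Y : E7) : L.om y X Y = L.g y (L.Φ y X) Y := rfl

theorem smooth_om : ContDiffOn ℝ ∞ L.om U := L.smooth_g.clm_comp L.smooth_Φ

include L in
theorem diff {F : Type*} [NormedAddCommGroup F] [NormedSpace ℝ F] {f : E7 → F}
    (hf : ContDiffOn ℝ ∞ f U) {y : E7} (hy : y ∈ U) : DifferentiableAt ℝ f y :=
  (hf.contDiffAt (L.isOpen.mem_nhds hy)).differentiableAt (by simp)

/-- The right hand side of the Koszul formula for the metric connection with torsion `ω ⊗ ξ`. -/
noncomputable def koszul (y : E7) : E7 →L[ℝ] E7 →L[ℝ] E7 →L[ℝ] ℝ :=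
  (1 / 2 : ℝ) • (fderiv ℝ L.g y + (fderiv ℝ L.g y).flip
    - ((ContinuousLinearMap.flipₗᵢ ℝ E7 E7 ℝ).toContinuousLinearEquiv :
        (E7 →L[ℝ] E7 →L[ℝ] ℝ) →L[ℝ] (E7 →L[ℝ] E7 →L[ℝ] ℝ)).comp
        (fderiv ℝ L.g y).flip
    + ((ContinuousLinearMap.smulRightL ℝ E7 (E7 →L[ℝ] ℝ)).flip (L.η y)).comp (L.om y)
    - ((ContinuousLinearMap.smulRightL ℝ E7 (E7 →L[ℝ] ℝ)) (L.η y)).comp (L.om y)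
    - (L.η y).smulRight (L.om y))

theorem koszul_apply (y X Y Z : E7) : L.koszul y X Y Z =
    (1 / 2) * (fderiv ℝ L.g y X Y Z + fderiv ℝ L.g y Y X Z - fderiv ℝ L.g y Z X Y
      + L.om y X Y * L.η y Z - L.η y Y * L.om y X Z - L.η y X * L.om y Y Z) := by
  simp [koszul]

/-- The Christoffel symbols of the metric connection with torsion `ω ⊗ ξ`. -/
noncomputable def G (y : E7) : E7 →L[ℝ] E7 →L[ℝ] E7 :=
  (ContinuousLinearMap.compL ℝ E7 (E7 →L[ℝ] ℝ) E7 (L.g y).inverse).comp (L.koszul y)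

theorem G_apply (y X Y : E7) : L.G y X Y = (L.g y).inverse (L.koszul y X Y) := rfl

theorem exists_equiv {y : E7} (hy : y ∈ U) : ∃ e : E7 ≃L[ℝ] (E7 →L[ℝ] ℝ), (e : E7 →L[ℝ] _) = L.g y := by
  have h := L.contact y hy
  obtain ⟨u, hu⟩ := h.exists_unitary
  have hb := hu.isOrthoFrame h
  have hinj : Function.Injective (L.g y) := by
    intro v w hvw
    exact hb.ext fun i => by simp [hvw]
  have hsurj : Function.Surjective (L.g y) := by
    intro α
    refine ⟨∑ i, α (unitaryFrame (L.ξ y) (L.Φ y) u i) • unitaryFrame (L.ξ y) (L.Φ y) u i, ?_⟩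
    ext Z
    conv_rhs => rw [← hb.expand Z]
    simp [_root_.sum_apply, mul_comm, h.symm Z]
  refine ⟨(LinearEquiv.ofBijective (L.g y : E7 →ₗ[ℝ] (E7 →L[ℝ] ℝ)) ⟨hinj, hsurj⟩).toContinuousLinearEquiv, ?_⟩
  ext
  rfl

include L in
theorem smooth_fderiv {F : Type*} [NormedAddCommGroup F] [NormedSpace ℝ F] {f : E7 → F}
    (hf : ContDiffOn ℝ ∞ f U) : ContDiffOn ℝ ∞ (fderiv ℝ f) U :=
  hf.fderiv_of_isOpen L.isOpen (by simp)

theorem smooth_koszul : ContDiffOn ℝ ∞ L.koszul U := by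
  have hg := L.smooth_fderiv L.smooth_g
  refine contDiffOn_clm_apply.mpr fun X => contDiffOn_clm_apply.mpr fun Y =>
    contDiffOn_clm_apply.mpr fun Z => ?_
  simp only [koszul_apply]
  have h1 := fun X Y Z : E7 => ((hg.clm_apply (contDiffOn_const (c := X))).clm_apply
    (contDiffOn_const (c := Y))).clm_apply (contDiffOn_const (c := Z))
  have h2 := fun X Y : E7 => (L.smooth_om.clm_apply (contDiffOn_const (c := X))).clm_apply
    (contDiffOn_const (c := Y))
  have h3 := fun X : E7 => L.smooth_η.clm_apply (contDiffOn_const (c := X))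
  exact contDiffOn_const.mul ((((((h1 X Y Z).add (h1 Y X Z)).sub (h1 Z X Y)).add
    ((h2 X Y).mul (h3 Z))).sub ((h3 Y).mul (h2 X Z))).sub ((h3 X).mul (h2 Y Z)))

theorem smooth_G : ContDiffOn ℝ ∞ L.G U := by
  have hinv : ContDiffOn ℝ ∞ (fun y => (L.g y).inverse) U := by
    intro y hy
    obtain ⟨e, he⟩ := L.exists_equiv hy
    have h1 := contDiffAt_map_inverse (n := ∞) (𝕜 := ℝ) e
    rw [he] at h1
    exact h1.comp_contDiffWithinAt y (L.smooth_g y hy)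
  refine contDiffOn_clm_apply.mpr fun X => contDiffOn_clm_apply.mpr fun Y => ?_
  exact hinv.clm_apply ((L.smooth_koszul.clm_apply contDiffOn_const).clm_apply contDiffOn_const)

section Identities

variable {y : E7} (hy : y ∈ U)

include hy

theorem g_G (X Y Z : E7) : L.g y (L.G y X Y) Z = L.koszul y X Y Z := by
  obtain ⟨e, he⟩ := L.exists_equiv hy
  rw [G_apply, ← he, ContinuousLinearMap.inverse_equiv]
  exact congrArg (fun α : E7 →L[ℝ] ℝ => α Z) (e.apply_symm_apply _)

theorem ext_g {V W : E7} (h : ∀ Z, L.g y V Z = L.g y W Z) : V = W := by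
  obtain ⟨e, he⟩ := L.exists_equiv hy
  refine e.injective ?_
  ext Z
  have := h Z
  rw [← he] at this
  exact this

theorem fderiv_g_symm (X Y Z : E7) : fderiv ℝ L.g y X Y Z = fderiv ℝ L.g y X Z Y := by
  have hd := L.diff L.smooth_g hy
  have h : ∀ Y Z, fderiv ℝ (fun z => L.g z Y Z) y X = fderiv ℝ L.g y X Y Z := by
    intro Y Z
    rw [fderiv_clm_apply_const (hd.clm_apply (differentiableAt_const Y)), fderiv_clm_apply_const hd]
  rw [← h, ← h, fderiv_congr_of_isOpen L.isOpen (fun z hz => (L.contact z hz).symm Y Z) hy]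

/-- The connection is metric. -/
theorem fderiv_g (X Y Z : E7) :
    fderiv ℝ L.g y X Y Z = L.g y (L.G y X Y) Z + L.g y Y (L.G y X Z) := by
  have h := L.contact y hy
  rw [h.symm Y, L.g_G hy, L.g_G hy, koszul_apply, koszul_apply]
  simp only [om_apply]
  rw [h.om_swap Z Y, L.fderiv_g_symm hy X Z Y, L.fderiv_g_symm hy Z X Y,
    L.fderiv_g_symm hy Y X Z]
  ring

/-- The connection has torsion `ω ⊗ ξ`. -/
theorem torsion_G (X Y : E7) : L.G y X Y - L.G y Y X = L.om y X Y • L.ξ y := by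
  have h := L.contact y hy
  refine L.ext_g hy fun Z => ?_
  simp only [map_sub, map_smul, sub_apply, smul_apply, L.g_G hy, koszul_apply, om_apply, smul_eq_mul,
    h.g_ξ]
  rw [h.om_swap Y X, L.fderiv_g_symm hy Z X Y]
  ring

end Identities

end LocalCCY

end Local

end G2Flow

/-! ### The Reeb field is Killing; η and ξ are parallel. -/

namespace G2Flow

namespace LocalCCY

variable {U : Set E7} (L : LocalCCY U)

section Parallel

variable {y : E7} (hy : y ∈ U)

include hy

theorem eq_zero_of_Φ_of_η {v : E7} (h1 : L.Φ y v = 0) (h2 : L.η y v = 0) : v = 0 := by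
  have h := (L.contact y hy).Φ_sq v
  rw [h1, h2] at h
  simpa using h.symm

theorem fderiv_om_apply (X Y Z : E7) : fderiv ℝ L.om y X Y Z
    = fderiv ℝ (fderiv ℝ L.η) y X Y Z - fderiv ℝ (fderiv ℝ L.η) y X Z Y := by
  have hd := L.diff (L.smooth_fderiv L.smooth_η) hy
  have ho := L.diff L.smooth_om hy
  have h1 : ∀ Y Z, fderiv ℝ (fun z => fderiv ℝ L.η z Y Z) y X
      = fderiv ℝ (fderiv ℝ L.η) y X Y Z := by
    intro Y Z
    rw [fderiv_clm_apply_const (hd.clm_apply (differentiableAt_const Y)), fderiv_clm_apply_const hd]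
  have hd1 : ∀ Y Z, DifferentiableAt ℝ (fun z => fderiv ℝ L.η z Y Z) y := fun Y Z =>
    (hd.clm_apply (differentiableAt_const Y)).clm_apply (differentiableAt_const Z)
  rw [← h1, ← h1, ← fderiv_clm_apply_const ho, ← fderiv_clm_apply_const
    (ho.clm_apply (differentiableAt_const Y)),
    show (fun z => L.om z Y Z) = fun z => L.g z (L.Φ z Y) Z from rfl,
    ← fderiv_congr_of_isOpen L.isOpen (fun z hz => L.dη_eq z hz Y Z) hy]
  rw [show (fun z => fderiv ℝ L.η z Y Z - fderiv ℝ L.η z Z Y)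
    = (fun z => fderiv ℝ L.η z Y Z) - fun z => fderiv ℝ L.η z Z Y from rfl,
    fderiv_sub (hd1 Y Z) (hd1 Z Y)]
  rfl

/-- The transverse Kähler form is closed. -/
theorem dom_eq_zero (X Y Z : E7) : fderiv ℝ L.om y X Y Z + fderiv ℝ L.om y Y Z X
    + fderiv ℝ L.om y Z X Y = 0 := by
  have hs : IsSymmSndFDerivAt ℝ L.η y :=
    (L.smooth_η.contDiffAt (L.isOpen.mem_nhds hy)).isSymmSndFDerivAt
      (by simp; exact ENat.LEInfty.out)
  rw [L.fderiv_om_apply hy, L.fderiv_om_apply hy, L.fderiv_om_apply hy, hs X Y, hs X Z, hs Y Z]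
  ring

theorem fderiv_om (X Y Z : E7) : fderiv ℝ L.om y X Y Z
    = fderiv ℝ L.g y X (L.Φ y Y) Z + L.g y (fderiv ℝ L.Φ y X Y) Z := by
  have hg := L.diff L.smooth_g hy
  have hΦ := (L.diff L.smooth_Φ hy).clm_apply (differentiableAt_const Y)
  have ho := L.diff L.smooth_om hy
  rw [← fderiv_clm_apply_const ho]
  change fderiv ℝ (fun z => L.g z (L.Φ z Y)) y X Z = _
  rw [fderiv_clm_apply_apply hg hΦ, fderiv_clm_apply_const (L.diff L.smooth_Φ hy)]
  rfl

theorem fderiv_Φ_ξ (X : E7) : fderiv ℝ L.Φ y X (L.ξ y) = - L.Φ y (fderiv ℝ L.ξ y X) := by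
  have h := fderiv_congr_of_isOpen L.isOpen (fun z hz => (L.contact z hz).Φ_ξ) hy
  have h2 := congrArg (fun F => F X) h
  rw [fderiv_clm_apply_apply (L.diff L.smooth_Φ hy) (L.diff L.smooth_ξ hy)] at h2
  rw [fderiv_fun_const] at h2
  exact eq_neg_of_add_eq_zero_left h2

theorem fderiv_η_ξ (X : E7) : fderiv ℝ L.η y X (L.ξ y) = - L.η y (fderiv ℝ L.ξ y X) := by
  have h := fderiv_congr_of_isOpen L.isOpen (fun z hz => (L.contact z hz).η_ξ) hy
  have h2 := congrArg (fun F => F X) h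
  rw [fderiv_clm_apply_apply (L.diff L.smooth_η hy) (L.diff L.smooth_ξ hy)] at h2
  rw [fderiv_fun_const] at h2
  exact eq_neg_of_add_eq_zero_left h2

theorem fderiv_η_Φ (X Y : E7) : fderiv ℝ L.η y X (L.Φ y Y) = - L.η y (fderiv ℝ L.Φ y X Y) := by
  have h := fderiv_congr_of_isOpen L.isOpen (fun z hz => (L.contact z hz).η_Φ Y) hy
  have h2 := congrArg (fun F => F X) h
  rw [fderiv_clm_apply_apply (L.diff L.smooth_η hy)
    ((L.diff L.smooth_Φ hy).clm_apply (differentiableAt_const Y)),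
    fderiv_clm_apply_const (L.diff L.smooth_Φ hy), fderiv_fun_const] at h2
  exact eq_neg_of_add_eq_zero_left h2

theorem fderiv_om_ξ (X Y : E7) :
    fderiv ℝ L.om y X (L.ξ y) Y = - L.om y (fderiv ℝ L.ξ y X) Y := by
  have h := fderiv_congr_of_isOpen L.isOpen (f := fun z => L.om z (L.ξ z)) (f' := fun _ => 0)
    (fun z hz => by ext Z; simp [(L.contact z hz).Φ_ξ]) hy
  have h2 := congrArg (fun F => F X Y) h
  simp only [fderiv_clm_apply_apply (L.diff L.smooth_om hy) (L.diff L.smooth_ξ hy)] at h2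
  rw [fderiv_fun_const] at h2
  exact eq_neg_of_add_eq_zero_left h2

theorem om_swap (X Y : E7) : L.om y X Y = - L.om y Y X := (L.contact y hy).om_swap X Y

theorem om_ξ (X : E7) : L.om y (L.ξ y) X = 0 := by simp [(L.contact y hy).Φ_ξ]

theorem om_ξ' (X : E7) : L.om y X (L.ξ y) = 0 := by rw [L.om_swap hy, L.om_ξ hy, neg_zero]

theorem fderiv_om_swap (X Y Z : E7) : fderiv ℝ L.om y X Y Z = - fderiv ℝ L.om y X Z Y := by
  rw [L.fderiv_om_apply hy, L.fderiv_om_apply hy]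
  ring

/-- The Reeb field preserves `Φ`. -/
theorem lie_Φ (X : E7) : fderiv ℝ L.Φ y (L.ξ y) X - fderiv ℝ L.ξ y (L.Φ y X)
    + L.Φ y (fderiv ℝ L.ξ y X) = 0 := by
  have h := L.contact y hy
  -- A vector killed by Φ and η is zero. The Φ-part is the normality condition with ξ as second
  -- argument; the η-part uses ξ ⌟ dη = 0.
  refine L.eq_zero_of_Φ_of_η hy ?_ ?_
  · have h1 := L.normal y hy X (L.ξ y)
    rw [h.Φ_ξ, L.fderiv_Φ_ξ hy, L.fderiv_Φ_ξ hy, h.g_ξ', h.η_Φ] at h1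
    simp only [map_zero, zero_apply, zero_smul, map_neg, sub_zero, add_zero] at h1
    simp only [map_add, map_sub]
    rw [← h1]
    abel
  · simp only [map_add, map_sub, h.η_Φ]
    have h1 := L.fderiv_η_Φ hy (L.ξ y) X
    have h2 := L.fderiv_η_ξ hy (L.Φ y X)
    have h3 := L.dη_eq y hy (L.ξ y) (L.Φ y X)
    rw [h.Φ_ξ] at h3
    simp only [map_zero, zero_apply] at h3
    linarith

/-- Cartan's formula: η(ξ) is constant and ξ ⌟ dη = 0. -/
theorem lie_η (X : E7) : fderiv ℝ L.η y (L.ξ y) X + L.η y (fderiv ℝ L.ξ y X) = 0 := by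
  have h2 := L.fderiv_η_ξ hy X
  have h3 := L.dη_eq y hy (L.ξ y) X
  rw [(L.contact y hy).Φ_ξ] at h3
  simp only [map_zero, zero_apply] at h3
  linarith

/-- Cartan's formula again, with dω = 0 and ξ ⌟ ω = 0. -/
theorem lie_om (X Y : E7) : fderiv ℝ L.om y (L.ξ y) X Y + L.om y (fderiv ℝ L.ξ y X) Y
    + L.om y X (fderiv ℝ L.ξ y Y) = 0 := by
  have h1 := L.dom_eq_zero hy (L.ξ y) X Y
  rw [L.fderiv_om_swap hy X Y, L.fderiv_om_ξ hy, L.fderiv_om_ξ hy] at h1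
  have h2 := L.om_swap hy (fderiv ℝ L.ξ y Y) X
  linarith

/-- The Reeb field is a Killing field. -/
theorem lie_g (X Y : E7) : fderiv ℝ L.g y (L.ξ y) X Y + L.g y (fderiv ℝ L.ξ y X) Y
    + L.g y X (fderiv ℝ L.ξ y Y) = 0 := by
  have h := L.contact y hy
  have hη := L.diff L.smooth_η hy
  have ho := L.diff L.smooth_om hy
  have hg := L.diff L.smooth_g hy
  have hΦ := L.diff L.smooth_Φ hy
  have hηX := fun X => hη.clm_apply (differentiableAt_const X)
  have hΦX := fun X => hΦ.clm_apply (differentiableAt_const X)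
  have hoX := fun X => ho.clm_apply (differentiableAt_const X)
  -- The metric is η ⊗ η + ω(·, Φ·), and the Reeb field preserves each of η, ω and Φ.
  have hgo : ∀ z ∈ U, ∀ X Y, L.g z X Y = L.η z X * L.η z Y + L.om z X (L.Φ z Y) := by
    intro z hz X Y
    have := (L.contact z hz).g_Φ X Y
    rw [om_apply]
    linarith
  have h1 := congrArg (fun F => F (L.ξ y))
    (fderiv_congr_of_isOpen L.isOpen (fun z hz => hgo z hz X Y) hy)
  rw [fderiv_clm_apply_const (hg.clm_apply (differentiableAt_const X)), fderiv_clm_apply_const hg,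
    fderiv_fun_add ((hηX X).fun_mul (hηX Y)) ((hoX X).clm_apply (hΦX Y)),
    fderiv_fun_mul (hηX X) (hηX Y)] at h1
  simp only [add_apply, smul_apply, smul_eq_mul] at h1
  rw [fderiv_clm_apply_apply (hoX X) (hΦX Y), fderiv_clm_apply_const hη,
    fderiv_clm_apply_const hη, fderiv_clm_apply_const ho, fderiv_clm_apply_const hΦ] at h1
  rw [h1, hgo y hy (fderiv ℝ L.ξ y X), hgo y hy X]
  have h2 := L.lie_η hy X
  have h3 := L.lie_η hy Y
  have h4 := L.lie_om hy X (L.Φ y Y)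
  have h5 := congrArg (L.om y X) (L.lie_Φ hy Y)
  simp only [map_add, map_sub, map_zero] at h5
  linear_combination L.η y Y * h2 + L.η y X * h3 + h4 + h5

theorem fderiv_η_eq (X Y : E7) : fderiv ℝ L.η y X Y
    = fderiv ℝ L.g y X (L.ξ y) Y + L.g y (fderiv ℝ L.ξ y X) Y := by
  have hg := L.diff L.smooth_g hy
  have h1 := congrArg (fun F => F X Y) (fderiv_congr_of_isOpen L.isOpen (f := L.η)
    (f' := fun z => L.g z (L.ξ z)) (fun z hz => by ext Z; rw [(L.contact z hz).g_ξ]) hy)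
  simp only [fderiv_clm_apply_apply hg (L.diff L.smooth_ξ hy)] at h1
  rw [h1]
  rfl

/-- `η` is parallel. -/
theorem fderiv_η (X Y : E7) : fderiv ℝ L.η y X Y = L.η y (L.G y X Y) := by
  have h := L.contact y hy
  have hE : ∀ X Y, fderiv ℝ L.η y X Y - L.η y (L.G y X Y)
      = L.g y (L.G y X (L.ξ y) + fderiv ℝ L.ξ y X) Y := by
    intro X Y
    rw [L.fderiv_η_eq hy, L.fderiv_g hy, h.g_ξ]
    simp
    ring
  -- The covariant derivative of η is symmetric because the torsion ω ⊗ ξ accounts for all of dη,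
  -- and skew because ξ is a Killing field; so it vanishes.
  have hsymm : ∀ X Y, fderiv ℝ L.η y X Y - L.η y (L.G y X Y)
      = fderiv ℝ L.η y Y X - L.η y (L.G y Y X) := by
    intro X Y
    have h1 := L.dη_eq y hy X Y
    have h2 := congrArg (L.η y) (L.torsion_G hy X Y)
    simp only [map_sub, map_smul, h.η_ξ, om_apply, smul_eq_mul, mul_one] at h2
    linarith
  have hskew : ∀ X Y, fderiv ℝ L.η y X Y - L.η y (L.G y X Y)
      = - (fderiv ℝ L.η y Y X - L.η y (L.G y Y X)) := by
    intro X Y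
    rw [hE, hE]
    have h1 := L.lie_g hy X Y
    have h2 : ∀ X, L.G y (L.ξ y) X = L.G y X (L.ξ y) := by
      intro X
      have := L.torsion_G hy (L.ξ y) X
      rw [L.om_ξ hy, zero_smul] at this
      exact sub_eq_zero.mp this
    rw [L.fderiv_g hy, h2, h2] at h1
    have h3 := h.symm X (L.G y Y (L.ξ y) + fderiv ℝ L.ξ y Y)
    simp only [map_add, add_apply] at h3 ⊢
    linarith
  have h1 := hsymm X Y
  have h2 := hskew X Y
  linarith

/-- `ξ` is parallel. -/
theorem fderiv_ξ (X : E7) : fderiv ℝ L.ξ y X = - L.G y X (L.ξ y) := by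
  have h := L.contact y hy
  refine L.ext_g hy fun Z => ?_
  have h1 := L.fderiv_η_eq hy X Z
  rw [L.fderiv_η hy, L.fderiv_g hy, h.g_ξ] at h1
  simp only [map_neg, neg_apply]
  linarith

end Parallel

end LocalCCY

end G2Flow

/-! ### Φ and ω are parallel. -/

namespace G2Flow

namespace LocalCCY

variable {U : Set E7} (L : LocalCCY U)

section Parallel

variable {y : E7} (hy : y ∈ U)

include hy

theorem G_ξ (X : E7) : L.G y (L.ξ y) X = L.G y X (L.ξ y) := by
  have := L.torsion_G hy (L.ξ y) X
  rw [L.om_ξ hy, zero_smul] at this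
  exact sub_eq_zero.mp this

theorem fderiv_Φ_Φ (X Y : E7) : fderiv ℝ L.Φ y X (L.Φ y Y) + L.Φ y (fderiv ℝ L.Φ y X Y)
    = L.η y (L.G y X Y) • L.ξ y - L.η y Y • L.G y X (L.ξ y) := by
  have hΦ := L.diff L.smooth_Φ hy
  have hη := L.diff L.smooth_η hy
  have hξ := L.diff L.smooth_ξ hy
  have h1 := congrArg (fun F => F X)
    (fderiv_congr_of_isOpen L.isOpen (fun z hz => (L.contact z hz).Φ_sq Y) hy)
  rw [fderiv_clm_apply_apply hΦ (hΦ.clm_apply (differentiableAt_const Y)),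
    fderiv_clm_apply_const hΦ, fderiv_const_add,
    fderiv_fun_smul (hη.clm_apply (differentiableAt_const Y)) hξ] at h1
  rw [h1]
  simp only [add_apply, smul_apply, ContinuousLinearMap.smulRight_apply]
  rw [fderiv_clm_apply_const hη, L.fderiv_η hy, L.fderiv_ξ hy, smul_neg]
  abel

/-- The covariant derivative of `Φ`. -/
noncomputable def defectΦ (y X Y : E7) : E7 :=
  fderiv ℝ L.Φ y X Y - L.Φ y (L.G y X Y) + L.G y X (L.Φ y Y)

/-- The skewness of ω, differentiated with a metric connection. -/
theorem defectΦ_skew (X Y Z : E7) :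
    L.g y (L.defectΦ y X Y) Z = - L.g y (L.defectΦ y X Z) Y := by
  have h := L.contact y hy
  have h1 := L.fderiv_om_swap hy X Y Z
  rw [L.fderiv_om hy, L.fderiv_om hy, L.fderiv_g hy, L.fderiv_g hy] at h1
  have h2 := h.om_swap Y (L.G y X Z)
  have h3 := h.om_swap Z (L.G y X Y)
  simp only [defectΦ, map_add, map_sub, add_apply, sub_apply]
  linarith

/-- This is dω = 0 written with the connection; the torsion drops out because ξ ⌟ ω = 0. -/
theorem defectΦ_cyclic (X Y Z : E7) : L.g y (L.defectΦ y X Y) Z + L.g y (L.defectΦ y Y Z) X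
    + L.g y (L.defectΦ y Z X) Y = 0 := by
  have h := L.contact y hy
  have h1 := L.dom_eq_zero hy X Y Z
  rw [L.fderiv_om hy, L.fderiv_om hy, L.fderiv_om hy, L.fderiv_g hy, L.fderiv_g hy,
    L.fderiv_g hy] at h1
  have ht : ∀ X Y Z, L.om y (L.G y X Y) Z - L.om y (L.G y Y X) Z = 0 := by
    intro X Y Z
    have := congrArg (fun v => L.om y v Z) (L.torsion_G hy X Y)
    simp only [map_sub, map_smul, sub_apply, smul_apply, L.om_ξ hy] at this
    rw [this, smul_zero]
  have t1 := ht X Y Z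
  have t2 := ht Y Z X
  have t3 := ht Z X Y
  have s1 := L.om_swap hy Y (L.G y X Z)
  have s2 := L.om_swap hy Z (L.G y Y X)
  have s3 := L.om_swap hy X (L.G y Z Y)
  simp only [om_apply] at t1 t2 t3 s1 s2 s3
  simp only [defectΦ, map_add, map_sub, add_apply, sub_apply]
  linarith

/-- Differentiating Φ² = -1 + η ⊗ ξ, with η and ξ parallel, shows that the derivative of Φ
anticommutes with Φ; and Φ is skew for g. -/
theorem defectΦ_Φ (X Y Z : E7) :
    L.g y (L.defectΦ y X (L.Φ y Y)) Z = L.g y (L.defectΦ y X Y) (L.Φ y Z) := by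
  have h := L.contact y hy
  have h1 : L.defectΦ y X (L.Φ y Y) + L.Φ y (L.defectΦ y X Y) = 0 := by
    have h2 := L.fderiv_Φ_Φ hy X Y
    rw [← eq_sub_iff_add_eq] at h2
    simp only [defectΦ, map_add, map_sub, h2, h.Φ_sq, map_neg, map_smul]
    abel
  have h2 := congrArg (fun v => L.g y v Z) h1
  have h3 := h.skew (L.defectΦ y X Y) Z
  simp only [map_add, add_apply, map_zero, zero_apply] at h2
  linarith

/-- Normality written with the connection: the torsion ω ⊗ ξ absorbs the term dη ⊗ ξ. -/
theorem defectΦ_normal (X Y : E7) : L.defectΦ y (L.Φ y X) Y - L.Φ y (L.defectΦ y X Y)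
    = L.defectΦ y (L.Φ y Y) X - L.Φ y (L.defectΦ y Y X) := by
  have h := L.contact y hy
  have h1 := L.normal y hy X Y
  have ht : ∀ X Y, L.Φ y (L.G y X Y) = L.Φ y (L.G y Y X) := by
    intro X Y
    have := congrArg (L.Φ y) (L.torsion_G hy X Y)
    rw [map_sub, map_smul, h.Φ_ξ, smul_zero] at this
    exact sub_eq_zero.mp this
  have h2 := L.torsion_G hy (L.Φ y X) (L.Φ y Y)
  rw [om_apply, h.Φ_sq] at h2
  have h3 : L.g y (-X + L.η y X • L.ξ y) (L.Φ y Y) = L.g y (L.Φ y X) Y := by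
    simp only [map_add, map_neg, map_smul, add_apply, neg_apply, smul_apply, h.g_ξ, h.η_Φ,
      smul_zero, add_zero, h.skew]
  rw [h3] at h2
  have h4 : L.Φ y (L.Φ y (L.G y X Y)) = L.Φ y (L.Φ y (L.G y Y X)) := congrArg _ (ht X Y)
  rw [← sub_eq_zero]
  have h5 : L.defectΦ y (L.Φ y X) Y - L.Φ y (L.defectΦ y X Y)
      - (L.defectΦ y (L.Φ y Y) X - L.Φ y (L.defectΦ y Y X))
      = (fderiv ℝ L.Φ y (L.Φ y X) Y - fderiv ℝ L.Φ y (L.Φ y Y) X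
        - L.Φ y (fderiv ℝ L.Φ y X Y) + L.Φ y (fderiv ℝ L.Φ y Y X) + L.g y (L.Φ y X) Y • L.ξ y)
      - (L.Φ y (L.G y (L.Φ y X) Y) - L.Φ y (L.G y Y (L.Φ y X)))
      + (L.Φ y (L.G y (L.Φ y Y) X) - L.Φ y (L.G y X (L.Φ y Y)))
      + (L.Φ y (L.Φ y (L.G y X Y)) - L.Φ y (L.Φ y (L.G y Y X)))
      + (L.G y (L.Φ y X) (L.Φ y Y) - L.G y (L.Φ y Y) (L.Φ y X) - L.g y (L.Φ y X) Y • L.ξ y) := by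
    simp only [defectΦ, map_add, map_sub]
    abel
  rw [h5, h1, ht (L.Φ y X) Y, ht (L.Φ y Y) X, h4, h2]
  simp

/-- The transverse form of the classical fact that an integrable almost Hermitian structure with
closed Kähler form has parallel complex structure. It is linear algebra for the tensor g((∇_X Φ)Y,
Z), using the four preceding symmetries; the ξ-direction is settled by Φξ = 0 and the parallelism of
ξ. -/
theorem defectΦ_eq_zero (X Y : E7) : L.defectΦ y X Y = 0 := by
  have h := L.contact y hy
  let B : E7 → E7 → E7 → ℝ := fun X Y Z => L.g y (L.defectΦ y X Y) Z
  have hskew : ∀ X Y Z, B X Y Z = - B X Z Y := L.defectΦ_skew hy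
  have hcyc : ∀ X Y Z, B X Y Z + B Y Z X + B Z X Y = 0 := L.defectΦ_cyclic hy
  have hΦ : ∀ X Y Z, B X (L.Φ y Y) Z = B X Y (L.Φ y Z) := L.defectΦ_Φ hy
  have hP : ∀ X Y Z, B (L.Φ y X) Y Z + B X Y (L.Φ y Z) = B (L.Φ y Y) X Z + B Y X (L.Φ y Z) := by
    intro X Y Z
    have h1 := congrArg (fun v => L.g y v Z) (L.defectΦ_normal hy X Y)
    simp only [map_sub, sub_apply, h.skew] at h1
    linarith
  -- A combination of the normality identity over the three cyclic permutations of the arguments.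
  have hQ : ∀ X Y Z, B (L.Φ y X) Y Z = - B X Y (L.Φ y Z) := by
    intro X Y Z
    have a1 := hP X Y Z
    have a2 := hP Y Z X
    have a3 := hP Z X Y
    have s1 := hskew (L.Φ y X) Y Z
    have s2 := hskew (L.Φ y Y) Z X
    have s3 := hskew (L.Φ y Z) X Y
    have t1 : B X Y (L.Φ y Z) = - B X Z (L.Φ y Y) := by rw [← hΦ, hskew]
    have t2 : B Y Z (L.Φ y X) = - B Y X (L.Φ y Z) := by rw [← hΦ, hskew]
    have t3 : B Z X (L.Φ y Y) = - B Z Y (L.Φ y X) := by rw [← hΦ, hskew]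
    linarith
  -- Adding the cyclic identities at (ΦX, Y, Z) and at (X, Y, ΦZ) cancels everything except twice
  -- this term.
  have hR : ∀ Y Z X, B Y (L.Φ y Z) X = 0 := by
    intro Y Z X
    have a1 := hcyc (L.Φ y X) Y Z
    have a2 := hcyc X Y (L.Φ y Z)
    rw [hQ, hΦ Z X Y] at a1
    have a3 : B Y Z (L.Φ y X) = B Y (L.Φ y Z) X := (hΦ _ _ _).symm
    have a4 := hQ Z X Y
    linarith
  have hξ : L.defectΦ y X (L.ξ y) = 0 := by
    rw [defectΦ, L.fderiv_Φ_ξ hy, L.fderiv_ξ hy, h.Φ_ξ]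
    simp
  have hadd : ∀ V W, L.defectΦ y X (V + W) = L.defectΦ y X V + L.defectΦ y X W := by
    intro V W
    simp only [defectΦ, map_add]
    abel
  have hsmul : ∀ (c : ℝ) V, L.defectΦ y X (c • V) = c • L.defectΦ y X V := by
    intro c V
    simp only [defectΦ, map_smul, smul_sub, smul_add]
  have h1 : Y = (-1 : ℝ) • L.Φ y (L.Φ y Y) + L.η y Y • L.ξ y := by
    rw [h.Φ_sq]
    simp
  rw [h1, hadd, hsmul, hsmul, hξ, smul_zero, add_zero]
  have h2 : L.defectΦ y X (L.Φ y (L.Φ y Y)) = 0 := by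
    refine L.ext_g hy fun Z => ?_
    rw [map_zero]
    exact hR X (L.Φ y Y) Z
  rw [h2, smul_zero]

/-- `Φ` is parallel. -/
theorem fderiv_Φ (X Y : E7) :
    fderiv ℝ L.Φ y X Y = L.Φ y (L.G y X Y) - L.G y X (L.Φ y Y) := by
  have h := L.defectΦ_eq_zero hy X Y
  rw [defectΦ] at h
  rw [← sub_eq_zero, ← h]
  abel

/-- `ω` is parallel. -/
theorem fderiv_om_eq (X Y Z : E7) :
    fderiv ℝ L.om y X Y Z = L.om y (L.G y X Y) Z + L.om y Y (L.G y X Z) := by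
  rw [L.fderiv_om hy, L.fderiv_g hy, L.fderiv_Φ hy]
  simp only [om_apply, map_sub, sub_apply]
  ring

end Parallel

end LocalCCY

end G2Flow

/-! ### Endomorphisms acting on tensors, and the covariant derivative of Υ. -/

namespace G2Flow

section Action

variable {F : Type*} [NormedAddCommGroup F] [NormedSpace ℝ F]

/-- The action of an endomorphism on one more covariant slot. -/
noncomputable def covAct (ρ : (E7 →L[ℝ] E7) →L[ℝ] F →L[ℝ] F) :
    (E7 →L[ℝ] E7) →L[ℝ] (E7 →L[ℝ] F) →L[ℝ] (E7 →L[ℝ] F) :=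
  (ContinuousLinearMap.compL ℝ E7 E7 F).flip + (ContinuousLinearMap.compL ℝ E7 F F).comp ρ

@[simp]
theorem covAct_apply (ρ : (E7 →L[ℝ] E7) →L[ℝ] F →L[ℝ] F) (A : E7 →L[ℝ] E7) (P : E7 →L[ℝ] F)
    (X : E7) : covAct ρ A P X = P (A X) + ρ A (P X) := rfl

/-- The action of an endomorphism on trilinear forms. -/
noncomputable def act3 : (E7 →L[ℝ] E7) →L[ℝ] (E7 →L[ℝ] E7 →L[ℝ] E7 →L[ℝ] ℂ) →L[ℝ]
    (E7 →L[ℝ] E7 →L[ℝ] E7 →L[ℝ] ℂ) := covAct (covAct (covAct 0))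

theorem act3_apply (A : E7 →L[ℝ] E7) (P : E7 →L[ℝ] E7 →L[ℝ] E7 →L[ℝ] ℂ) (X Y Z : E7) :
    act3 A P X Y Z = P (A X) Y Z + P X (A Y) Z + P X Y (A Z) := by
  simp [act3, add_assoc]

end Action

namespace LocalCCY

variable {U : Set E7} (L : LocalCCY U)

/-- The covariant derivative of `Υ`. -/
noncomputable def defectΥ (y : E7) : E7 →L[ℝ] E7 →L[ℝ] E7 →L[ℝ] E7 →L[ℝ] ℂ :=
  fderiv ℝ L.Υ y - (act3.flip (L.Υ y)).comp (L.G y)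

theorem defectΥ_apply (y X A B C : E7) : L.defectΥ y X A B C = fderiv ℝ L.Υ y X A B C
    - (L.Υ y (L.G y X A) B C + L.Υ y A (L.G y X B) C + L.Υ y A B (L.G y X C)) := by
  rw [← act3_apply]
  rfl

section Parallel

variable {y : E7} (hy : y ∈ U)

include hy

theorem fderiv_Υ_apply (X A B C : E7) :
    fderiv ℝ (fun z => L.Υ z A B C) y X = fderiv ℝ L.Υ y X A B C := by
  have hd := L.diff L.smooth_Υ hy
  have hd1 := hd.clm_apply (differentiableAt_const A)
  rw [fderiv_clm_apply_const (hd1.clm_apply (differentiableAt_const B)),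
    fderiv_clm_apply_const hd1, fderiv_clm_apply_const hd]

theorem Υ_ξ (A B : E7) : L.Υ y (L.ξ y) A B = 0 := by
  have h1 := (L.typeThreeZero y hy).type (L.ξ y) A B
  rw [(L.contact y hy).Φ_ξ] at h1
  simpa using h1.symm

/-- Φ is parallel, so covariant differentiation preserves the type (3,0). -/
theorem defectΥ_type (X : E7) : IsTypeThreeZero (L.Φ y) (L.defectΥ y X) := by
  have hd := L.diff L.smooth_Υ hy
  have hΦ := L.diff L.smooth_Φ hy
  have hP := L.typeThreeZero y hy
  refine ⟨fun A B C => ?_, fun A B C => ?_, fun A B C => ?_⟩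
  · have h1 := congrArg (fun F => F X) (fderiv_congr_of_isOpen L.isOpen
      (fun z hz => (L.typeThreeZero z hz).swap₁ A B C) hy)
    rw [fderiv_fun_neg, neg_apply, L.fderiv_Υ_apply hy, L.fderiv_Υ_apply hy] at h1
    rw [defectΥ_apply, defectΥ_apply, h1, hP.swap₁ (L.G y X A), hP.swap₁ A (L.G y X B),
      hP.swap₁ A B (L.G y X C)]
    ring
  · have h1 := congrArg (fun F => F X) (fderiv_congr_of_isOpen L.isOpen
      (fun z hz => (L.typeThreeZero z hz).swap₂ A B C) hy)
    rw [fderiv_fun_neg, neg_apply, L.fderiv_Υ_apply hy, L.fderiv_Υ_apply hy] at h1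
    rw [defectΥ_apply, defectΥ_apply, h1, hP.swap₂ (L.G y X A), hP.swap₂ A (L.G y X B),
      hP.swap₂ A B (L.G y X C)]
    ring
  · have h1 := congrArg (fun F => F X) (fderiv_congr_of_isOpen L.isOpen
      (fun z hz => (L.typeThreeZero z hz).type A B C) hy)
    have hd1 := hd.clm_apply (hΦ.clm_apply (differentiableAt_const A))
    have hd2 := ((hd.clm_apply (differentiableAt_const A)).clm_apply
      (differentiableAt_const B)).clm_apply (differentiableAt_const C)
    rw [fderiv_clm_apply_const (hd1.clm_apply (differentiableAt_const B)),
      fderiv_clm_apply_const hd1, fderiv_clm_apply_apply hd (hΦ.clm_apply (differentiableAt_const A)),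
      fderiv_clm_apply_const hΦ, L.fderiv_Φ hy, fderiv_const_mul hd2, smul_apply,
      L.fderiv_Υ_apply hy] at h1
    simp only [add_apply, map_sub, sub_apply, smul_eq_mul, hP.type] at h1
    rw [defectΥ_apply, defectΥ_apply, hP.type, hP.type]
    linear_combination h1

/-- This is dΥ = 0 written with the connection; the torsion drops out because ξ ⌟ Υ = 0. -/
theorem defectΥ_closed (A B C D : E7) : L.defectΥ y A B C D - L.defectΥ y B A C D
    + L.defectΥ y C A B D - L.defectΥ y D A B C = 0 := by
  have hP := L.typeThreeZero y hy
  have h1 := L.dΥ_eq y hy A B C D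
  have ht : ∀ X Y V W, L.Υ y (L.G y X Y) V W = L.Υ y (L.G y Y X) V W := by
    intro X Y V W
    have := congrArg (fun v => L.Υ y v V W) (L.torsion_G hy X Y)
    simp only [map_sub, map_smul, sub_apply, smul_apply, L.Υ_ξ hy, smul_zero] at this
    exact sub_eq_zero.mp this
  have e1 : ∀ X Y V, L.Υ y X Y V = L.Υ y V X Y := fun X Y V => by
    rw [hP.swap₂, hP.swap₁, neg_neg]
  simp only [defectΥ_apply]
  rw [hP.swap₁ B (L.G y A C), hP.swap₁ A (L.G y B C), hP.swap₁ A (L.G y C B),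
    hP.swap₁ A (L.G y D B), e1 B C (L.G y A D), e1 A C (L.G y B D), e1 A B (L.G y C D),
    e1 A B (L.G y D C), ht B A, ht C A, ht D A, ht C B, ht D B, ht D C]
  linear_combination h1

/-- Υ is a unit multiple of dz₀ ∧ dz₁ ∧ dz₂, so |Υ(v)|² = |det Z|² for the matrix Z of complex
coordinates, and Z*Z is the Hermitian Gram matrix. Thus |Υ|² is expressed through g, η and ω alone.
-/
theorem normSq_Υ (v : Fin 3 → E7) : L.Υ y (v 0) (v 1) (v 2) * starRingEnd ℂ (L.Υ y (v 0) (v 1) (v 2))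
    = (Matrix.of fun b c => ((L.g y (v b) (v c) - L.η y (v b) * L.η y (v c) : ℝ) : ℂ)
        + L.om y (v b) (v c) * Complex.I).det := by
  have h := L.contact y hy
  obtain ⟨u, hu⟩ := h.exists_unitary
  have h1 := L.norm_Υ y hy u hu
  rw [hu.typeThreeZero_eq h (L.typeThreeZero y hy) v, map_mul]
  have h2 : L.Υ y (u 0) (u 1) (u 2) * starRingEnd ℂ (L.Υ y (u 0) (u 1) (u 2)) = 1 := by
    rw [Complex.mul_conj, Complex.normSq_eq_norm_sq, h1]
    norm_num
  set Z := Matrix.of fun a b => zCoord (L.g y) (L.Φ y) u a (v b) with hZ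
  have h3 : (Matrix.of fun b c => ((L.g y (v b) (v c) - L.η y (v b) * L.η y (v c) : ℝ) : ℂ)
        + L.om y (v b) (v c) * Complex.I) = Z.conjTranspose * Z := by
    ext b c
    have e1 := (hu.isOrthoFrame h).parseval (v b) (v c)
    have e2 : L.g y (v b) (v c) - L.η y (v b) * L.η y (v c) = ∑ a, (L.g y (v b) (u a) * L.g y (v c) (u a)
        + L.g y (v b) (L.Φ y (u a)) * L.g y (v c) (L.Φ y (u a))) := by
      simp [Fin.sum_univ_succ, unitaryFrame, h.g_ξ'] at e1
      rw [e1, Fin.sum_univ_three]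
      ring
    have e3 : L.om y (v b) (v c) = ∑ a, (L.g y (v b) (u a) * L.g y (v c) (L.Φ y (u a))
        - L.g y (v b) (L.Φ y (u a)) * L.g y (v c) (u a)) := by
      have := (hu.isOrthoFrame h).parseval (L.Φ y (v b)) (v c)
      simp [Fin.sum_univ_succ, unitaryFrame, h.g_ξ', h.skew (v b), h.Φ_ξ, h.Φ_sq, hu.η_u] at this
      rw [om_apply, h.skew, this, Fin.sum_univ_three]
      ring
    rw [Matrix.mul_apply, Matrix.of_apply, e2, e3]
    simp only [Matrix.conjTranspose_apply, hZ, Matrix.of_apply, zCoord]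
    push_cast
    rw [Finset.sum_mul, ← Finset.sum_add_distrib]
    refine Finset.sum_congr rfl fun a _ => ?_
    simp
    linear_combination ((L.g y (v b) (L.Φ y (u a)) : ℂ) * L.g y (v c) (L.Φ y (u a))) * Complex.I_sq
  rw [h3, Matrix.det_mul, Matrix.det_conjTranspose]
  simp only [Complex.star_def]
  linear_combination Z.det * (starRingEnd ℂ) Z.det * h2

end Parallel

end LocalCCY

end G2Flow

/-! ### Υ is parallel. -/

namespace G2Flow

/-- The derivative of a `3 × 3` determinant at the identity matrix is the trace. -/
theorem hasFDerivAt_det_one {m : Fin 3 → Fin 3 → E7 → ℂ} {y : E7}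
    (hm : ∀ b c, DifferentiableAt ℝ (m b c) y) (h1 : ∀ b c, m b c y = if b = c then 1 else 0) :
    HasFDerivAt (fun z => (Matrix.of fun b c => m b c z).det) (∑ b, fderiv ℝ (m b b) y) y := by
  have h := fun b c => (hm b c).hasFDerivAt
  simp only [Matrix.det_fin_three, Matrix.of_apply]
  have h2 := (((((((h 0 0).fun_mul (h 1 1)).fun_mul (h 2 2)).fun_sub
    (((h 0 0).fun_mul (h 1 2)).fun_mul (h 2 1))).fun_sub
    (((h 0 1).fun_mul (h 1 0)).fun_mul (h 2 2))).fun_add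
    (((h 0 1).fun_mul (h 1 2)).fun_mul (h 2 0))).fun_add
    (((h 0 2).fun_mul (h 1 0)).fun_mul (h 2 1))).fun_sub
    (((h 0 2).fun_mul (h 1 1)).fun_mul (h 2 0))
  refine h2.congr_fderiv ?_
  ext X
  simp [h1, Fin.sum_univ_three]
  ring

/-- Alternation and complex linearity keep only the coordinate of A(u_b) along u_b, so an
endomorphism acts on a (3,0)-form through its complex trace. -/
theorem IsUnitary.act_eq {g : E7 →L[ℝ] E7 →L[ℝ] ℝ} {η : E7 →L[ℝ] ℝ} {ξ : E7}
    {Φ : E7 →L[ℝ] E7} (h : IsAlmostContact g η ξ Φ) {u : Fin 3 → E7} (hu : IsUnitary g η Φ u)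
    {P : E7 →L[ℝ] E7 →L[ℝ] E7 →L[ℝ] ℂ} (hP : IsTypeThreeZero Φ P) (A : E7 → E7) :
    P (A (u 0)) (u 1) (u 2) + P (u 0) (A (u 1)) (u 2) + P (u 0) (u 1) (A (u 2))
      = P (u 0) (u 1) (u 2) * ∑ b, zCoord g Φ u b (A (u b)) := by
  have e1 := hu.typeThreeZero_eq h hP ![A (u 0), u 1, u 2]
  have e2 := hu.typeThreeZero_eq h hP ![u 0, A (u 1), u 2]
  have e3 := hu.typeThreeZero_eq h hP ![u 0, u 1, A (u 2)]
  simp only [Matrix.det_fin_three, Matrix.of_apply, Matrix.cons_val, zCoord, hu.g_u,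
    hu.g_Φu' h] at e1 e2 e3
  rw [e1, e2, e3]
  simp [Fin.sum_univ_three, zCoord]
  ring

namespace LocalCCY

variable {U : Set E7} (L : LocalCCY U)

section Parallel

variable {y : E7} (hy : y ∈ U)

include hy

theorem exists_normalized : ∃ u, IsUnitary (L.g y) (L.η y) (L.Φ y) u
    ∧ L.Υ y (u 0) (u 1) (u 2) = 1 := by
  have h := L.contact y hy
  obtain ⟨v, hv⟩ := h.exists_unitary
  exact hv.exists_normalized h (L.typeThreeZero y hy) (L.norm_Υ y hy v hv)

/-- The derivative of |Υ|² computed twice: from Υ itself, and from the Hermitian Gram determinant,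
whose derivative at the identity is a trace. The traces agree, which leaves nothing for the real
part. -/
theorem re_defectΥ {u : Fin 3 → E7} (hu : IsUnitary (L.g y) (L.η y) (L.Φ y) u)
    (h1 : L.Υ y (u 0) (u 1) (u 2) = 1) (X : E7) :
    (L.defectΥ y X (u 0) (u 1) (u 2)).re = 0 := by
  have h := L.contact y hy
  have hg := L.diff L.smooth_g hy
  have hη := L.diff L.smooth_η hy
  have ho := L.diff L.smooth_om hy
  have hd := L.diff L.smooth_Υ hy
  have hF := ((hd.clm_apply (differentiableAt_const (u 0))).clm_apply
      (differentiableAt_const (u 1))).clm_apply (differentiableAt_const (u 2))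
  have hc : HasFDerivAt (fun z => starRingEnd ℂ (L.Υ z (u 0) (u 1) (u 2)))
      ((Complex.conjCLE : ℂ →L[ℝ] ℂ).comp (fderiv ℝ (fun z => L.Υ z (u 0) (u 1) (u 2)) y)) y :=
    (Complex.conjCLE : ℂ →L[ℝ] ℂ).hasFDerivAt.comp y hF.hasFDerivAt
  have e1 := (hF.hasFDerivAt.mul hc).fderiv
  have hdg : ∀ b c, DifferentiableAt ℝ (fun z => L.g z (u b) (u c)) y := fun b c =>
    (hg.clm_apply (differentiableAt_const _)).clm_apply (differentiableAt_const _)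
  have hdη : ∀ b, DifferentiableAt ℝ (fun z => L.η z (u b)) y := fun b =>
    hη.clm_apply (differentiableAt_const _)
  have hdo : ∀ b c, DifferentiableAt ℝ (fun z => L.om z (u b) (u c)) y := fun b c =>
    (ho.clm_apply (differentiableAt_const _)).clm_apply (differentiableAt_const _)
  have hr : ∀ b c, DifferentiableAt ℝ
      (fun z => L.g z (u b) (u c) - L.η z (u b) * L.η z (u c)) y := fun b c =>
    (hdg b c).fun_sub ((hdη b).fun_mul (hdη c))
  have cast : ∀ {f : E7 → ℝ}, DifferentiableAt ℝ f y →
      HasFDerivAt (fun z => (f z : ℂ)) (Complex.ofRealCLM.comp (fderiv ℝ f y)) y := fun hf =>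
    Complex.ofRealCLM.hasFDerivAt.comp y hf.hasFDerivAt
  have e2 := (hasFDerivAt_det_one (m := fun b c z =>
      ((L.g z (u b) (u c) - L.η z (u b) * L.η z (u c) : ℝ) : ℂ) + L.om z (u b) (u c) * Complex.I)
    (fun b c => (cast (hr b c)).differentiableAt.fun_add
      ((cast (hdo b c)).differentiableAt.mul_const _))
    (fun b c => by
      simp only [om_apply, hu.g_u, hu.g_Φu, hu.η_u]
      split_ifs <;> simp)).fderiv
  have e3 := fderiv_congr_of_isOpen L.isOpen (fun z hz => L.normSq_Υ hz u) hy
  -- On the diagonal ω vanishes by skewness, and the derivative of η ⊗ η vanishes because η(u_b) =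
  -- 0.
  have e4 : ∀ b, fderiv ℝ (fun z => ((L.g z (u b) (u b) - L.η z (u b) * L.η z (u b) : ℝ) : ℂ)
      + L.om z (u b) (u b) * Complex.I) y X = 2 * (L.g y (L.G y X (u b)) (u b) : ℂ) := by
    intro b
    have hz : ∀ z ∈ U, ((L.g z (u b) (u b) - L.η z (u b) * L.η z (u b) : ℝ) : ℂ)
        + L.om z (u b) (u b) * Complex.I
        = ((L.g z (u b) (u b) - L.η z (u b) * L.η z (u b) : ℝ) : ℂ) := by
      intro z hz
      rw [self_eq_neg.mp (L.om_swap hz (u b) (u b))]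
      simp
    rw [fderiv_congr_of_isOpen L.isOpen hz hy, (cast (hr b b)).fderiv,
      fderiv_fun_sub (hdg b b) ((hdη b).fun_mul (hdη b)), fderiv_fun_mul (hdη b) (hdη b)]
    simp only [ContinuousLinearMap.comp_apply, Complex.ofRealCLM_apply, sub_apply, add_apply,
      hu.η_u, zero_smul, zero_apply]
    rw [fderiv_clm_apply_const (hg.clm_apply (differentiableAt_const _)),
      fderiv_clm_apply_const hg, L.fderiv_g hy, h.symm (u b)]
    push_cast
    ring
  have e5 := congrArg (fun F => F X) (e1.symm.trans (e3.trans e2))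
  simp only [_root_.sum_apply, e4, add_apply, smul_apply, ContinuousLinearMap.comp_apply, h1,
    L.fderiv_Υ_apply hy] at e5
  have e6 : fderiv ℝ L.Υ y X (u 0) (u 1) (u 2) = L.defectΥ y X (u 0) (u 1) (u 2)
      + ∑ b, zCoord (L.g y) (L.Φ y) u b (L.G y X (u b)) := by
    rw [defectΥ_apply, hu.act_eq h (L.typeThreeZero y hy), h1]
    ring
  have e7 := congrArg Complex.re e5
  rw [e6] at e7
  simp [zCoord, Fin.sum_univ_three] at e7
  linarith

/-- The transverse holomorphic volume form is parallel. -/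
theorem defectΥ_eq_zero (X A B C : E7) : L.defectΥ y X A B C = 0 := by
  have h := L.contact y hy
  obtain ⟨u, hu, h1⟩ := L.exists_normalized hy
  obtain ⟨θ, hθ⟩ : ∃ θ : E7 → ℂ, θ = fun X => L.defectΥ y X (u 0) (u 1) (u 2) := ⟨_, rfl⟩
  have hre : ∀ X, (θ X).re = 0 := by rw [hθ]; exact L.re_defectΥ hy hu h1
  have hT := L.defectΥ_type hy
  have hΥ := hu.typeThreeZero_eq h (L.typeThreeZero y hy)
  have hD : ∀ X (v : Fin 3 → E7), L.defectΥ y X (v 0) (v 1) (v 2) = θ X * L.Υ y (v 0) (v 1) (v 2) := by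
    intro X v
    rw [hu.typeThreeZero_eq h (hT X), hΥ, h1, hθ]
    ring
  have hD' : ∀ X A B C, L.defectΥ y X A B C = θ X * L.Υ y A B C := fun X A B C =>
    hD X ![A, B, C]
  have hξ : θ (L.ξ y) = 0 := by
    have e := L.defectΥ_closed hy (L.ξ y) (u 0) (u 1) (u 2)
    simp only [hD', L.Υ_ξ hy, h1] at e
    simpa using e
  -- Write the derivative of Υ as θ ⊗ Υ, so that θ ∧ Υ = 0. Evaluated on X, u₀, u₁, u₂, all terms
  -- except θ(X) are complex linear in X, hence so is θ. A complex linear form with purely imaginary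
  -- values is zero.
  have key : ∀ X, θ (L.Φ y X) = Complex.I * θ X := by
    intro X
    have e := L.defectΥ_closed hy X (u 0) (u 1) (u 2)
    have e' := L.defectΥ_closed hy (L.Φ y X) (u 0) (u 1) (u 2)
    simp only [hD', (L.typeThreeZero y hy).type, h1] at e e'
    linear_combination e' - Complex.I * e
  have him : ∀ X, θ X = 0 := by
    intro X
    have h3 := congrArg Complex.re (key X)
    rw [hre] at h3
    apply Complex.ext (hre X)
    simpa using h3
  rw [hD', him, zero_mul]

theorem fderiv_Υ (X : E7) : fderiv ℝ L.Υ y X = act3 (L.G y X) (L.Υ y) := by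
  ext A B C : 3
  have := L.defectΥ_eq_zero hy X A B C
  rw [defectΥ_apply] at this
  rw [act3_apply]
  exact sub_eq_zero.mp this

end Parallel

end LocalCCY

end G2Flow

namespace G2Flow

/-! ### Curvature of the connection -/

section Action

variable {F : Type*} [NormedAddCommGroup F] [NormedSpace ℝ F]

/-- `ρ` is an action: an antihomomorphism of Lie algebras. -/
def IsAction (ρ : (E7 →L[ℝ] E7) →L[ℝ] F →L[ℝ] F) : Prop :=
  ∀ A B v, ρ A (ρ B v) - ρ B (ρ A v) = ρ (B.comp A - A.comp B) v

theorem isAction_zero : IsAction (0 : (E7 →L[ℝ] E7) →L[ℝ] F →L[ℝ] F) := fun A B v => by simp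

theorem IsAction.covAct {ρ : (E7 →L[ℝ] E7) →L[ℝ] F →L[ℝ] F} (h : IsAction ρ) :
    IsAction (covAct ρ) := by
  intro A B P
  ext X
  have h1 := h A B (P X)
  simp only [sub_apply, covAct_apply, map_add, map_sub, ContinuousLinearMap.comp_apply] at h1 ⊢
  rw [sub_eq_sub_iff_add_eq_add] at h1 ⊢
  calc _ = P (B (A X)) + ρ B (P (A X)) + ρ A (P (B X)) + P (A (B X))
        + (ρ A (ρ B (P X)) + ρ (A.comp B) (P X)) := by abel
    _ = _ := by rw [h1]; abel

/-- The action on vector fields, where parallel means ∂_X ξ = -G_X ξ. -/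
theorem isAction_neg : IsAction (-ContinuousLinearMap.id ℝ (E7 →L[ℝ] E7)) := fun A B v => by
  simp

theorem act3_isAction : IsAction act3 := isAction_zero.covAct.covAct.covAct

end Action

namespace LocalCCY

variable {U : Set E7} (L : LocalCCY U)

/-- The curvature of the connection `G`. -/
noncomputable def R (y X Y : E7) : E7 →L[ℝ] E7 :=
  fderiv ℝ L.G y X Y - fderiv ℝ L.G y Y X + (L.G y X).comp (L.G y Y) - (L.G y Y).comp (L.G y X)

theorem R_apply (y X Y Z : E7) : L.R y X Y Z = fderiv ℝ L.G y X Y Z - fderiv ℝ L.G y Y X Z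
    + L.G y X (L.G y Y Z) - L.G y Y (L.G y X Z) := rfl

theorem R_swap (y X Y Z : E7) : L.R y X Y Z = - L.R y Y X Z := by
  simp only [R_apply]
  abel

section Parallel

variable {y : E7} (hy : y ∈ U)

include hy

/-- The curvature annihilates parallel tensor fields. -/
theorem curvature_act {F : Type*} [NormedAddCommGroup F] [NormedSpace ℝ F]
    {ρ : (E7 →L[ℝ] E7) →L[ℝ] F →L[ℝ] F} (hρ : IsAction ρ) {t : E7 → F}
    (ht : ContDiffOn ℝ ∞ t U) (hpar : ∀ z ∈ U, ∀ X, fderiv ℝ t z X = ρ (L.G z X) (t z))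
    (X Y : E7) : ρ (L.R y X Y) (t y) = 0 := by
  have hs : IsSymmSndFDerivAt ℝ t y :=
    (ht.contDiffAt (L.isOpen.mem_nhds hy)).isSymmSndFDerivAt (by simp; exact ENat.LEInfty.out)
  have hd := L.diff (L.smooth_fderiv ht) hy
  have hG := L.diff L.smooth_G hy
  -- The equation for a parallel tensor is differentiated once more; symmetry of the second
  -- derivative then leaves exactly the action of the curvature.
  have h1 : ∀ X Y, fderiv ℝ (fderiv ℝ t) y X Y
      = ρ (fderiv ℝ L.G y X Y) (t y) + ρ (L.G y Y) (ρ (L.G y X) (t y)) := by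
    intro X Y
    rw [← fderiv_clm_apply_const hd, fderiv_congr_of_isOpen L.isOpen (fun z hz => hpar z hz Y) hy]
    have hGY := hG.clm_apply (differentiableAt_const Y)
    rw [fderiv_clm_apply_apply (c := fun z => ρ (L.G z Y)) (ρ.differentiableAt.comp y hGY) (L.diff ht hy), hpar y hy]
    congr 2
    have := (ρ.hasFDerivAt.comp y hGY.hasFDerivAt).fderiv
    rw [show (fun z => ρ (L.G z Y)) = ρ ∘ fun z => L.G z Y from rfl, this]
    simp [fderiv_clm_apply_const hG]
  have h2 := hs X Y
  rw [h1, h1] at h2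
  have h3 := hρ (L.G y Y) (L.G y X) (t y)
  rw [R]
  simp only [map_sub, map_add, sub_apply, add_apply] at h3 ⊢
  rw [← sub_eq_zero] at h2
  rw [← h2]
  rw [sub_eq_iff_eq_add] at h3
  rw [h3]
  abel

theorem R_g (X Y Z W : E7) : L.g y (L.R y X Y Z) W = - L.g y Z (L.R y X Y W) := by
  have := L.curvature_act hy isAction_zero.covAct.covAct L.smooth_g (fun z hz X => by
    ext Y Z
    rw [L.fderiv_g hz]
    simp) X Y
  have := congrArg (fun F => F Z W) this
  simp at this
  linarith

theorem R_om (X Y Z W : E7) : L.om y (L.R y X Y Z) W = - L.om y Z (L.R y X Y W) := by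
  have := L.curvature_act hy isAction_zero.covAct.covAct L.smooth_om (fun z hz X => by
    ext Y Z
    rw [L.fderiv_om_eq hz]
    simp) X Y
  have := congrArg (fun F => F Z W) this
  simp at this
  simp
  linarith

theorem R_ξ (X Y : E7) : L.R y X Y (L.ξ y) = 0 := by
  have := L.curvature_act hy isAction_neg L.smooth_ξ (fun z hz X => by
    rw [L.fderiv_ξ hz]
    simp) X Y
  simpa using this

theorem η_R (X Y Z : E7) : L.η y (L.R y X Y Z) = 0 := by
  rw [← (L.contact y hy).g_ξ', L.R_g hy, L.R_ξ hy, map_zero, neg_zero]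

theorem R_Φ (X Y Z : E7) : L.R y X Y (L.Φ y Z) = L.Φ y (L.R y X Y Z) := by
  refine L.ext_g hy fun W => ?_
  have := L.R_om hy X Y Z W
  rw [om_apply, om_apply] at this
  rw [this, L.R_g hy]

/-- Infinitesimal holonomy in 𝔰𝔲(3) rather than 𝔲(3): since Υ is parallel and nonzero, the curvature
has zero complex trace, and this is its imaginary part. -/
theorem R_Υ {u : Fin 3 → E7} (hu : IsUnitary (L.g y) (L.η y) (L.Φ y) u) (X Y : E7) :
    ∑ b, L.g y (L.R y X Y (u b)) (L.Φ y (u b)) = 0 := by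
  have h := L.contact y hy
  have h1 := L.curvature_act hy act3_isAction L.smooth_Υ (fun z hz X => L.fderiv_Υ hz X) X Y
  have h2 := congrArg (fun F => F (u 0) (u 1) (u 2)) h1
  simp only [act3_apply, zero_apply] at h2
  rw [hu.act_eq h (L.typeThreeZero y hy)] at h2
  have h3 : L.Υ y (u 0) (u 1) (u 2) ≠ 0 := by
    rw [← norm_ne_zero_iff, L.norm_Υ y hy u hu]
    exact one_ne_zero
  have h4 := congrArg Complex.im ((mul_eq_zero.mp h2).resolve_left h3)
  simpa [zCoord] using h4

/-- Differentiate the torsion identity and take the cyclic sum. The derivatives of ω cancel by dω =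
0, and those of ξ cancel against the quadratic terms. -/
theorem bianchi (X Y Z : E7) : L.R y X Y Z + L.R y Y Z X + L.R y Z X Y = 0 := by
  have hG := L.diff L.smooth_G hy
  have ho := L.diff L.smooth_om hy
  have hξ := L.diff L.smooth_ξ hy
  have h1 : ∀ X Y Z, fderiv ℝ L.G y X Y Z - fderiv ℝ L.G y X Z Y
      = fderiv ℝ L.om y X Y Z • L.ξ y - L.om y Y Z • L.G y X (L.ξ y) := by
    intro X Y Z
    have e := congrArg (fun F => F X) (fderiv_congr_of_isOpen L.isOpen
      (fun z hz => L.torsion_G hz Y Z) hy)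
    have d : ∀ Y Z, DifferentiableAt ℝ (fun z => L.G z Y Z) y := fun Y Z =>
      (hG.clm_apply (differentiableAt_const Y)).clm_apply (differentiableAt_const Z)
    have d' : ∀ Y Z, fderiv ℝ (fun z => L.G z Y Z) y X = fderiv ℝ L.G y X Y Z := fun Y Z => by
      rw [fderiv_clm_apply_const (hG.clm_apply (differentiableAt_const Y)),
        fderiv_clm_apply_const hG]
    have do' := (ho.clm_apply (differentiableAt_const Y)).clm_apply (differentiableAt_const Z)
    rw [fderiv_fun_sub (d Y Z) (d Z Y), fderiv_fun_smul do' hξ] at e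
    simp only [sub_apply, add_apply, smul_apply, ContinuousLinearMap.smulRight_apply, d',
      L.fderiv_ξ hy] at e
    rw [fderiv_clm_apply_const (ho.clm_apply (differentiableAt_const Y)),
      fderiv_clm_apply_const ho] at e
    rw [e, smul_neg]
    abel
  have h2 : ∀ X Y Z, L.G y X (L.G y Y Z) - L.G y X (L.G y Z Y) = L.om y Y Z • L.G y X (L.ξ y) := by
    intro X Y Z
    rw [← map_sub, L.torsion_G hy, map_smul]
  have h3 : (fderiv ℝ L.om y X Y Z + fderiv ℝ L.om y Y Z X + fderiv ℝ L.om y Z X Y) • L.ξ y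
      = 0 := by rw [L.dom_eq_zero hy, zero_smul]
  rw [add_smul, add_smul] at h3
  have e1 := h1 X Y Z
  have e2 := h1 Y Z X
  have e3 := h1 Z X Y
  have e4 := h2 X Y Z
  have e5 := h2 Y Z X
  have e6 := h2 Z X Y
  simp only [R_apply]
  rw [← h3]
  rw [← sub_eq_zero] at e1 e2 e3 e4 e5 e6 ⊢
  have : ∀ a b c d e f : E7, a = 0 → b = 0 → c = 0 → d = 0 → e = 0 → f = 0 →
      a + b + c + d + e + f = 0 := by
    rintro a b c d e f rfl rfl rfl rfl rfl rfl
    simp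
  rw [← this _ _ _ _ _ _ e1 e2 e3 e4 e5 e6]
  abel

/-- The usual consequence of the two skew symmetries and the first Bianchi identity, which holds
here without torsion terms. -/
theorem R_pair (X Y Z W : E7) : L.g y (L.R y X Y Z) W = L.g y (L.R y Z W X) Y := by
  have h := L.contact y hy
  have b : ∀ X Y Z W, L.g y (L.R y X Y Z) W + L.g y (L.R y Y Z X) W + L.g y (L.R y Z X Y) W = 0 := by
    intro X Y Z W
    have := congrArg (fun v => L.g y v W) (L.bianchi hy X Y Z)
    simpa using this
  have s : ∀ X Y Z W, L.g y (L.R y X Y Z) W = - L.g y (L.R y Y X Z) W := by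
    intro X Y Z W
    rw [L.R_swap y X Y, map_neg, neg_apply]
  have k : ∀ X Y Z W, L.g y (L.R y X Y Z) W = - L.g y (L.R y X Y W) Z := by
    intro X Y Z W
    rw [L.R_g hy, h.symm]
  linarith [b X Y Z W, b Y Z W X, b Z W X Y, b W X Y Z, k X Y Z W, s X Y Z W, k Y Z X W, s Y Z X W,
    k Z X Y W, s Z X Y W, k Z W X Y, s Z W X Y, k X W Y Z, s X W Y Z, k Y W X Z, s Y W X Z,
    k Y Z W X, k Z W Y X, s Z W Y X, k W Y Z X, s W Y Z X, k W X Y Z, k W X Z Y, s W X Z Y,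
    k X Y W Z, s X Y W Z, k X Z W Y, k W Y X Z, s Z X W Y, k Z X W Y, s W X Y Z, s X Z W Y,
    k X W Z Y]

theorem R_ξ_left (Y Z : E7) : L.R y (L.ξ y) Y Z = 0 := by
  refine L.ext_g hy fun W => ?_
  rw [L.R_pair hy, L.R_ξ hy]
  simp

/-- The connection is transversely Ricci-flat. -/
theorem ricci_R {u : Fin 3 → E7} (hu : IsUnitary (L.g y) (L.η y) (L.Φ y) u) (Y Z : E7) :
    ∑ a, (L.g y (L.R y (u a) Y Z) (u a) + L.g y (L.R y (L.Φ y (u a)) Y Z) (L.Φ y (u a))) = 0 := by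
  have h := L.contact y hy
  -- The Ricci form. It is antisymmetric by pair symmetry, and symmetric by the Bianchi identity
  -- together with the vanishing complex trace; so it is zero. Since R commutes with Φ, the Ricci
  -- contraction at (Y, Z) is minus this form at (Y, -ΦZ).
  let S : E7 → E7 → ℝ := fun Y Z => ∑ a, (L.g y (L.R y (u a) Y Z) (L.Φ y (u a))
    - L.g y (L.R y (L.Φ y (u a)) Y Z) (u a))
  have s : ∀ X Y Z W, L.g y (L.R y X Y Z) W = - L.g y (L.R y Y X Z) W := by
    intro X Y Z W
    rw [L.R_swap y X Y, map_neg, neg_apply]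
  have k : ∀ X Y Z W, L.g y (L.R y X Y Z) W = - L.g y (L.R y X Y W) Z := by
    intro X Y Z W
    rw [L.R_g hy, h.symm]
  have anti : ∀ Y Z, S Y Z = - S Z Y := by
    intro Y Z
    simp only [S]
    rw [← Finset.sum_neg_distrib]
    refine Finset.sum_congr rfl fun a _ => ?_
    rw [L.R_pair hy, k, s, L.R_pair hy (L.Φ y (u a)) Y, k Z (u a), s Z (u a)]
    ring
  have sym : ∀ Y Z, S Y Z = S Z Y := by
    intro Y Z
    rw [← sub_eq_zero]
    simp only [S]
    rw [← Finset.sum_sub_distrib]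
    have e := L.R_Υ hy hu Y Z
    have e' : -2 * ∑ b, L.g y (L.R y Y Z (u b)) (L.Φ y (u b)) = 0 := by rw [e, mul_zero]
    rw [← e', Finset.mul_sum]
    refine Finset.sum_congr rfl fun a _ => ?_
    have b1 := congrArg (fun v => L.g y v (L.Φ y (u a))) (L.bianchi hy (u a) Y Z)
    have b2 := congrArg (fun v => L.g y v (u a)) (L.bianchi hy (L.Φ y (u a)) Y Z)
    simp only [map_add, add_apply, map_zero, zero_apply] at b1 b2
    have b3 : L.g y (L.R y Y Z (L.Φ y (u a))) (u a) = - L.g y (L.R y Y Z (u a)) (L.Φ y (u a)) := by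
      rw [L.R_Φ hy, h.skew]
    rw [s Z (u a) Y] at b1
    rw [s Z (L.Φ y (u a)) Y, b3] at b2
    linarith
  have hS : ∀ Y Z, S Y Z = 0 := fun Y Z => self_eq_neg.mp ((sym Y Z).trans (anti Z Y))
  have hZ : Z = L.Φ y (- L.Φ y Z) + L.η y Z • L.ξ y := by
    rw [map_neg, h.Φ_sq]
    simp
  rw [hZ]
  simp only [map_add, map_smul, L.R_ξ hy, smul_zero, add_zero]
  rw [← neg_eq_zero, ← hS Y (-L.Φ y Z), ← Finset.sum_neg_distrib]
  refine Finset.sum_congr rfl fun a _ => ?_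
  rw [L.R_Φ hy _ _ (-L.Φ y Z), L.R_Φ hy _ _ (-L.Φ y Z), h.skew, h.g_Φ, L.η_R hy]
  ring

end Parallel

end LocalCCY

end G2Flow

namespace G2Flow

namespace LocalCCY

variable {U : Set E7} (L : LocalCCY U) (f h : ℝ)

/-! ### The rescaled metric and its Levi-Civita connection -/

/-- The metric `f² η² + h² g_𝒟`. -/
noncomputable def gT (y : E7) : E7 →L[ℝ] E7 →L[ℝ] ℝ :=
  h ^ 2 • L.g y + (f ^ 2 - h ^ 2) • (L.η y).smulRight (L.η y)

@[simp]
theorem gT_apply (y X Y : E7) :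
    L.gT f h y X Y = h ^ 2 * L.g y X Y + (f ^ 2 - h ^ 2) * (L.η y X * L.η y Y) := by
  simp [gT]

/-- The 3-form `f h² η ∧ ω + h³ Re Υ`. -/
noncomputable def phiT (y : E7) : E7 →L[ℝ] E7 →L[ℝ] E7 →L[ℝ] ℝ :=
  (f * h ^ 2) • ((L.η y).smulRight (L.om y)
    - (ContinuousLinearMap.smulRightL ℝ E7 (E7 →L[ℝ] ℝ) (L.η y)).comp (L.om y)
    + ((ContinuousLinearMap.smulRightL ℝ E7 (E7 →L[ℝ] ℝ)).flip (L.η y)).comp (L.om y))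
  + h ^ 3 • (ContinuousLinearMap.compL ℝ E7 (E7 →L[ℝ] ℂ) (E7 →L[ℝ] ℝ)
      (ContinuousLinearMap.compL ℝ E7 ℂ ℝ Complex.reCLM)).comp (L.Υ y)

@[simp]
theorem phiT_apply (y X Y Z : E7) : L.phiT f h y X Y Z
    = f * h ^ 2 * (L.η y X * L.om y Y Z - L.η y Y * L.om y X Z + L.om y X Y * L.η y Z)
      + h ^ 3 * (L.Υ y X Y Z).re := by
  simp [phiT]
  ring

/-- The difference between the Levi-Civita connection of `gT` and the connection `G`. -/
noncomputable def C (y : E7) : E7 →L[ℝ] E7 →L[ℝ] E7 :=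
  -- The skew part cancels the torsion ω ⊗ ξ; the symmetric part keeps the sum metric for f² η² + h²
  -- g_𝒟.
  (-(1 / 2) : ℝ) • ((ContinuousLinearMap.smulRightL ℝ E7 E7).flip (L.ξ y)).comp (L.om y)
    + (f ^ 2 / (2 * h ^ 2)) • ((L.η y).smulRight (L.Φ y)
      + (ContinuousLinearMap.smulRightL ℝ E7 E7 (L.η y)).comp (L.Φ y))

theorem C_apply (y X Y : E7) : L.C f h y X Y = (-(1 / 2) : ℝ) • L.om y X Y • L.ξ y
    + (f ^ 2 / (2 * h ^ 2)) • (L.η y X • L.Φ y Y + L.η y Y • L.Φ y X) := by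
  simp [C]

/-- The orthonormal frame of `gT` given by a unitary triple. -/
noncomputable def frameT (y : E7) (u : Fin 3 → E7) (i : Fin 7) : E7 :=
  (if i = 0 then f⁻¹ else h⁻¹) • unitaryFrame (L.ξ y) (L.Φ y) u i

theorem frameT_zero (y : E7) (u : Fin 3 → E7) : L.frameT f h y u 0 = f⁻¹ • L.ξ y := by
  simp [frameT, unitaryFrame]

section Parallel

variable {f h} (hf : f ≠ 0) (hh : h ≠ 0) {y : E7} (hy : y ∈ U)

section Frame

variable {u : Fin 3 → E7} (hu : IsUnitary (L.g y) (L.η y) (L.Φ y) u)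

include hy hu

theorem η_frameT (i : Fin 7) : L.η y (L.frameT f h y u i) = f⁻¹ * etaC i := by
  rw [frameT, map_smul, hu.η_frame (L.contact y hy), smul_eq_mul]
  split_ifs with hi
  · rfl
  · simp [etaC, hi]

theorem om_frameT (i j : Fin 7) :
    L.om y (L.frameT f h y u i) (L.frameT f h y u j) = (h ^ 2)⁻¹ * omC i j := by
  have e : ∀ i A, L.om y (L.frameT f h y u i) A
      = h⁻¹ * L.om y (unitaryFrame (L.ξ y) (L.Φ y) u i) A := by
    intro i A
    rw [frameT, map_smul, smul_apply, smul_eq_mul]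
    split_ifs with hi
    · subst hi
      simp only [unitaryFrame, Matrix.cons_val_zero, L.om_ξ hy, mul_zero]
    · rfl
  rw [e, L.om_swap hy, e, L.om_swap hy (unitaryFrame (L.ξ y) (L.Φ y) u j), om_apply,
    hu.om_frame (L.contact y hy)]
  ring

theorem Υ_frameT (h1 : L.Υ y (u 0) (u 1) (u 2) = 1) (i j k : Fin 7) :
    (L.Υ y (L.frameT f h y u i) (L.frameT f h y u j) (L.frameT f h y u k)).re
      = (h ^ 3)⁻¹ * reDet (fun a b => reC a (![i, j, k] b)) (fun a b => imC a (![i, j, k] b)) := by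
  have hP := L.typeThreeZero y hy
  have e : ∀ i A B, L.Υ y (L.frameT f h y u i) A B
      = h⁻¹ • L.Υ y (unitaryFrame (L.ξ y) (L.Φ y) u i) A B := by
    intro i A B
    rw [frameT, map_smul]
    split_ifs with hi
    · subst hi
      simp [unitaryFrame, L.Υ_ξ hy]
    · rfl
  rw [e, hP.swap₁, e, hP.swap₂, hP.swap₁, e, hP.swap₁ _ (unitaryFrame (L.ξ y) (L.Φ y) u j),
    hP.swap₂ (unitaryFrame (L.ξ y) (L.Φ y) u j), hP.swap₁ (unitaryFrame (L.ξ y) (L.Φ y) u j)]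
  have := hu.typeThreeZero_frame (L.contact y hy) hP ![i, j, k]
  simp only [Matrix.cons_val] at this
  rw [this, h1]
  simp
  ring

include hf hh

theorem isOrthoFrame : IsOrthoFrame (toBilin (L.gT f h y)) (L.frameT f h y u) := by
  intro i j
  have h1 := hu.isOrthoFrame (L.contact y hy) i j
  simp only [toBilin_apply] at h1
  rw [toBilin_apply, gT_apply, L.η_frameT hy hu, L.η_frameT hy hu]
  simp only [frameT, map_smul, smul_apply, smul_eq_mul, h1, etaC]
  by_cases hi : i = 0 <;> by_cases hj : j = 0
  · simp [hi, hj]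
    field_simp
    ring
  · simp [hi, hj, Ne.symm hj]
  · simp [hi, hj]
  · by_cases hij : i = j
    · subst hij
      simp [hi]
      field_simp
    · simp [hi, hj, hij]

theorem isG2Frame (h1 : L.Υ y (u 0) (u 1) (u 2) = 1) {φ : Alt 3}
    (hφ : ∀ X Y Z, φ ![X, Y, Z] = L.phiT f h y X Y Z) : IsG2Frame φ (L.frameT f h y u) := by
  intro i j k
  rw [hφ, phiT_apply, L.η_frameT hy hu, L.η_frameT hy hu, L.η_frameT hy hu, L.om_frameT hy hu,
    L.om_frameT hy hu, L.om_frameT hy hu, L.Υ_frameT hy hu h1, phiC_eq]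
  push_cast
  field_simp

/-- In the orthonormal frame, f and h enter only through f / h², which multiplies universal
integers. -/
theorem C_frameT (i j : Fin 7) : L.C f h y (L.frameT f h y u i) (L.frameT f h y u j)
    = ∑ p, (f / h ^ 2 / 2 * gammaC i j p) • L.frameT f h y u p := by
  have hc := L.contact y hy
  have hb := L.isOrthoFrame hf hh hy hu
  refine hb.ext fun p => ?_
  have e1 : ∀ i, L.gT f h y (L.Φ y (L.frameT f h y u i)) (L.frameT f h y u p) = omC i p := by
    intro i
    have := L.om_frameT (f := f) (h := h) hy hu i p
    rw [om_apply] at this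
    rw [gT_apply, this, hc.η_Φ]
    field_simp
    ring
  have e2 : L.gT f h y (L.ξ y) (L.frameT f h y u p) = f * etaC p := by
    rw [gT_apply, hc.g_ξ, hc.η_ξ, L.η_frameT hy hu]
    field_simp
    ring
  have e3 : ∀ a p, L.gT f h y (L.frameT f h y u a) (L.frameT f h y u p) = if a = p then 1 else 0 :=
    hb
  have e4 : L.gT f h y (∑ q, (f / h ^ 2 / 2 * gammaC i j q) • L.frameT f h y u q)
      (L.frameT f h y u p) = f / h ^ 2 / 2 * gammaC i j p := by
    simp only [map_sum, map_smul, _root_.sum_apply, smul_apply, e3]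
    simp
  rw [toBilin_apply, toBilin_apply, e4]
  rw [C_apply]
  simp only [map_add, map_smul, add_apply, smul_apply, smul_eq_mul, e1, e2, L.om_frameT hy hu,
    L.η_frameT hy hu, gammaC]
  push_cast
  field_simp
  ring

end Frame

include hy

theorem fderiv_η_apply (X A : E7) : fderiv ℝ (fun z => L.η z A) y X = L.η y (L.G y X A) := by
  rw [fderiv_clm_apply_const (L.diff L.smooth_η hy), L.fderiv_η hy]

theorem fderiv_om_apply_apply (X A B : E7) : fderiv ℝ (fun z => L.om z A B) y X
    = L.om y (L.G y X A) B + L.om y A (L.G y X B) := by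
  have ho := L.diff L.smooth_om hy
  rw [fderiv_clm_apply_const (ho.clm_apply (differentiableAt_const A)),
    fderiv_clm_apply_const ho, L.fderiv_om_eq hy]

theorem fderiv_g_apply (X A B : E7) : fderiv ℝ (fun z => L.g z A B) y X
    = L.g y (L.G y X A) B + L.g y A (L.G y X B) := by
  have ho := L.diff L.smooth_g hy
  rw [fderiv_clm_apply_const (ho.clm_apply (differentiableAt_const A)),
    fderiv_clm_apply_const ho, L.fderiv_g hy]

theorem diff_η (A : E7) : DifferentiableAt ℝ (fun z => L.η z A) y :=
  (L.diff L.smooth_η hy).clm_apply (differentiableAt_const A)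

theorem diff_om (A B : E7) : DifferentiableAt ℝ (fun z => L.om z A B) y :=
  ((L.diff L.smooth_om hy).clm_apply (differentiableAt_const A)).clm_apply
    (differentiableAt_const B)

theorem diff_g (A B : E7) : DifferentiableAt ℝ (fun z => L.g z A B) y :=
  ((L.diff L.smooth_g hy).clm_apply (differentiableAt_const A)).clm_apply
    (differentiableAt_const B)

/-- The rescaled metric has constant coefficients in the parallel tensors g and η, so the same
connection is metric for every f and h. -/
theorem fderiv_gT_apply (X A B : E7) : fderiv ℝ (fun z => L.gT f h z A B) y X
    = L.gT f h y (L.G y X A) B + L.gT f h y A (L.G y X B) := by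
  simp only [gT_apply]
  have hg := (L.diff_g hy A B).hasFDerivAt
  have hη := fun A => (L.diff_η hy A).hasFDerivAt
  rw [((hg.const_mul (h ^ 2)).fun_add (((hη A).fun_mul (hη B)).const_mul (f ^ 2 - h ^ 2))).fderiv]
  simp only [add_apply, smul_apply, smul_eq_mul, L.fderiv_g_apply hy, L.fderiv_η_apply hy]
  ring

theorem fderiv_phiT_apply (X A B D : E7) : fderiv ℝ (fun z => L.phiT f h z A B D) y X
    = L.phiT f h y (L.G y X A) B D + L.phiT f h y A (L.G y X B) D
      + L.phiT f h y A B (L.G y X D) := by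
  have ho := fun A B => (L.diff_om hy A B).hasFDerivAt
  have hη := fun A => (L.diff_η hy A).hasFDerivAt
  have hd : DifferentiableAt ℝ (fun z => L.Υ z A B D) y :=
    (((L.diff L.smooth_Υ hy).clm_apply (differentiableAt_const A)).clm_apply
      (differentiableAt_const B)).clm_apply (differentiableAt_const D)
  have hr : HasFDerivAt (fun z => (L.Υ z A B D).re)
      (Complex.reCLM.comp (fderiv ℝ (fun z => L.Υ z A B D) y)) y :=
    Complex.reCLM.hasFDerivAt.comp y hd.hasFDerivAt
  simp only [phiT_apply]
  rw [(((((hη A).fun_mul (ho B D)).fun_sub ((hη B).fun_mul (ho A D))).fun_add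
    ((ho A B).fun_mul (hη D))).const_mul (f * h ^ 2) |>.fun_add (hr.const_mul (h ^ 3))).fderiv]
  simp only [add_apply, sub_apply, smul_apply, smul_eq_mul, ContinuousLinearMap.comp_apply,
    L.fderiv_om_apply_apply hy, L.fderiv_η_apply hy, L.fderiv_Υ_apply hy, L.fderiv_Υ hy, act3_apply,
    Complex.reCLM_apply, Complex.add_re]
  ring

/-- The difference tensor is built from ω, ξ, η and Φ with constant coefficients, hence is parallel.
-/
theorem hasFDerivAt_C (A B : E7) : ∃ F' : E7 →L[ℝ] E7, HasFDerivAt (fun z => L.C f h z A B) F' y ∧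
    ∀ X, F' X = L.C f h y (L.G y X A) B + L.C f h y A (L.G y X B) - L.G y X (L.C f h y A B) := by
  have ho := (L.diff_om hy A B).hasFDerivAt
  have hη := fun A => (L.diff_η hy A).hasFDerivAt
  have hξ := (L.diff L.smooth_ξ hy).hasFDerivAt
  have hΦ := fun A => ((L.diff L.smooth_Φ hy).clm_apply (differentiableAt_const A)).hasFDerivAt
  simp only [C_apply]
  refine ⟨_, ((ho.fun_smul hξ).fun_const_smul (-(1 / 2) : ℝ)).fun_add
    ((((hη A).fun_smul (hΦ B)).fun_add ((hη B).fun_smul (hΦ A))).fun_const_smul (f ^ 2 / (2 * h ^ 2))),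
    fun X => ?_⟩
  simp only [add_apply, smul_apply, ContinuousLinearMap.smulRight_apply,
    L.fderiv_om_apply_apply hy, L.fderiv_η_apply hy, L.fderiv_ξ hy,
    fderiv_clm_apply_const (L.diff L.smooth_Φ hy), L.fderiv_Φ hy, map_add, map_smul]
  module

include hf hh

/-- The Levi-Civita connection of `gT`. -/
theorem christoffel_eq {g' : E7 → Tensor2} (hg : ∀ z ∈ U, ∀ X Y, g' z X Y = L.gT f h z X Y)
    (X Y : E7) : christoffel g' y X Y = L.G y X Y + L.C f h y X Y := by
  have hc := L.contact y hy
  obtain ⟨u, hu⟩ := hc.exists_unitary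
  have hb := L.isOrthoFrame hf hh hy hu
  refine hb.sharp_eq_of_inner (hg y hy) fun Z => ?_
  have e : ∀ X Y Z, fderiv ℝ (fun z => g' z Y Z) y X
      = L.gT f h y (L.G y X Y) Z + L.gT f h y Y (L.G y X Z) := by
    intro X Y Z
    rw [fderiv_congr_of_isOpen L.isOpen (fun z hz => hg z hz Y Z) hy, L.fderiv_gT_apply hy]
  have t : ∀ X Y Z, L.gT f h y (L.G y X Y) Z = L.gT f h y (L.G y Y X) Z
      + L.om y X Y * (f ^ 2 * L.η y Z) := by
    intro X Y Z
    have := congrArg (fun v => L.gT f h y v Z) (L.torsion_G hy X Y)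
    simp only [map_sub, map_smul, sub_apply, smul_apply, gT_apply (X := L.ξ y), hc.g_ξ, hc.η_ξ,
      smul_eq_mul] at this
    linear_combination this
  have s : ∀ X Y, L.gT f h y X Y = L.gT f h y Y X := hb.symm
  rw [e, e, e, toBilin_apply, map_add, add_apply, C_apply]
  simp only [map_add, map_smul, add_apply, smul_apply, smul_eq_mul]
  have g1 : L.gT f h y (L.ξ y) Z = f ^ 2 * L.η y Z := by
    rw [gT_apply, hc.g_ξ, hc.η_ξ]
    ring
  have g2 : ∀ X, L.gT f h y (L.Φ y X) Z = h ^ 2 * L.om y X Z := by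
    intro X
    rw [gT_apply, hc.η_Φ, om_apply]
    ring
  rw [g1, g2, g2, s Y (L.G y X Z), s X (L.G y Y Z), s X (L.G y Z Y), t X Z Y, t Y Z X, t Y X Z,
    L.om_swap hy Y X]
  field_simp
  ring

/-- The curvature of `gT`. -/
theorem curvature_eq {g' : E7 → Tensor2} (hg : ∀ z ∈ U, ∀ X Y, g' z X Y = L.gT f h z X Y)
    (X Y Z : E7) : curvature (leviCivita g') y X Y Z = L.R y X Y Z
      + (L.C f h y X (L.C f h y Y Z) - L.C f h y Y (L.C f h y X Z)
        + L.om y X Y • L.C f h y (L.ξ y) Z) := by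
  have hG := L.diff L.smooth_G hy
  have h1 : ∀ Y Z, ∀ z ∈ U, leviCivita g' (fun _ => Y) (fun _ => Z) z
      = L.G z Y Z + L.C f h z Y Z := by
    intro Y Z z hz
    simp [leviCivita, L.christoffel_eq hf hh hz hg]
  have h2 : ∀ X Y Z, leviCivita g' (fun _ => X) (leviCivita g' (fun _ => Y) fun _ => Z) y
      = fderiv ℝ L.G y X Y Z + L.C f h y (L.G y X Y) Z + L.C f h y Y (L.G y X Z)
        - L.G y X (L.C f h y Y Z) + (L.G y X (L.G y Y Z) + L.G y X (L.C f h y Y Z)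
        + L.C f h y X (L.G y Y Z) + L.C f h y X (L.C f h y Y Z)) := by
    intro X Y Z
    obtain ⟨F', hF, hF'⟩ := L.hasFDerivAt_C (f := f) (h := h) hy Y Z
    have hGYZ := (hG.clm_apply (differentiableAt_const Y)).clm_apply (differentiableAt_const Z)
    rw [leviCivita, fderiv_congr_of_isOpen L.isOpen (h1 Y Z) hy, h1 Y Z y hy,
      L.christoffel_eq hf hh hy hg, (hGYZ.hasFDerivAt.fun_add hF).fderiv, add_apply, hF',
      fderiv_clm_apply_const (hG.clm_apply (differentiableAt_const Y)), fderiv_clm_apply_const hG]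
    simp only [map_add]
    abel
  rw [curvature, h2, h2, R_apply]
  -- As C is parallel, the terms mixing G and C cancel up to the torsion of G, which leaves this
  -- one.
  have h3 : L.C f h y (L.G y X Y) Z - L.C f h y (L.G y Y X) Z = L.om y X Y • L.C f h y (L.ξ y) Z := by
    rw [← sub_apply, ← map_sub, L.torsion_G hy, map_smul, smul_apply]
  rw [← h3]
  abel

end Parallel

end LocalCCY

end G2Flow

/-! ### The torsion tensor of the rescaled 3-form. -/

namespace G2Flow

/-- A curried quadrilinear form as a multilinear map. -/
noncomputable def uncurry4 (P : E7 →L[ℝ] E7 →L[ℝ] E7 →L[ℝ] E7 →L[ℝ] ℝ) :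
    MultilinearMap ℝ (fun _ : Fin 4 => E7) ℝ where
  toFun v := P (v 0) (v 1) (v 2) (v 3)
  map_update_add' := by
    intro inst v i x y
    obtain rfl : inst = instDecidableEqFin 4 := Subsingleton.elim _ _
    fin_cases i <;> simp [Function.update]
  map_update_smul' := by
    intro inst v i c x
    obtain rfl : inst = instDecidableEqFin 4 := Subsingleton.elim _ _
    fin_cases i <;> simp [Function.update]

/-- A curried trilinear form as a multilinear map. -/
noncomputable def uncurry3 (P : E7 →L[ℝ] E7 →L[ℝ] E7 →L[ℝ] ℝ) :
    MultilinearMap ℝ (fun _ : Fin 3 => E7) ℝ where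
  toFun v := P (v 0) (v 1) (v 2)
  map_update_add' := by
    intro inst v i x y
    obtain rfl : inst = instDecidableEqFin 3 := Subsingleton.elim _ _
    fin_cases i <;> simp [Function.update]
  map_update_smul' := by
    intro inst v i c x
    obtain rfl : inst = instDecidableEqFin 3 := Subsingleton.elim _ _
    fin_cases i <;> simp [Function.update]

/-- A curried bilinear form as a multilinear map. -/
noncomputable def uncurry2 (P : E7 →L[ℝ] E7 →L[ℝ] ℝ) :
    MultilinearMap ℝ (fun _ : Fin 2 => E7) ℝ where
  toFun v := P (v 0) (v 1)
  map_update_add' := by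
    intro inst v i x y
    obtain rfl : inst = instDecidableEqFin 2 := Subsingleton.elim _ _
    fin_cases i <;> simp [Function.update]
  map_update_smul' := by
    intro inst v i c x
    obtain rfl : inst = instDecidableEqFin 2 := Subsingleton.elim _ _
    fin_cases i <;> simp [Function.update]

theorem update_vec3 (v : Fin 3 → E7) (w : E7) : Function.update v 0 w = ![w, v 1, v 2] ∧
    Function.update v 1 w = ![v 0, w, v 2] ∧ Function.update v 2 w = ![v 0, v 1, w] := by
  refine ⟨?_, ?_, ?_⟩ <;> funext i <;> fin_cases i <;> simp [Function.update]

theorem eq_vec3 (v : Fin 3 → E7) : v = ![v 0, v 1, v 2] := by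
  funext i
  fin_cases i <;> rfl

theorem sum_update_vec3 (F : Alt 3) (A : E7 → E7) (v : Fin 3 → E7) :
    ∑ i, F (Function.update v i (A (v i)))
      = F ![A (v 0), v 1, v 2] + F ![v 0, A (v 1), v 2] + F ![v 0, v 1, A (v 2)] := by
  rw [Fin.sum_univ_three, (update_vec3 v _).1, (update_vec3 v _).2.1, (update_vec3 v _).2.2]

theorem IsG2Frame.psi_nondegenerate {φ : Alt 3} {g : LinearMap.BilinForm ℝ E7} {b : Fin 7 → E7}
    (hb : IsOrthoFrame g b) (hφ : IsG2Frame φ b) {w w' : E7}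
    (h : ∀ v : Fin 3 → E7, psi φ (Fin.cons w v) = psi φ (Fin.cons w' v)) : w = w' := by
  have e : ∀ w i j k, psi φ (Fin.cons w ![b i, b j, b k]) = ∑ q, g w (b q) * psiC q i j k := by
    intro w i j k
    conv_lhs => rw [← hb.expand w]
    rw [← psiMulti_apply]
    have h2 : ∀ v, psiMulti φ (Fin.cons v ![b i, b j, b k])
        = (psiMulti φ).curryLeft v ![b i, b j, b k] := fun v => rfl
    rw [h2, map_sum, _root_.sum_apply]
    refine Finset.sum_congr rfl fun q _ => ?_
    rw [map_smul, smul_apply, ← h2, psiMulti_apply, smul_eq_mul]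
    congr 1
    exact hφ.psi_frame hb q i j k
  refine hb.ext fun p => ?_
  obtain ⟨i, j, k, h0, h1⟩ := psiC_nondegenerate p
  have h2 := h ![b i, b j, b k]
  rw [e, e] at h2
  have h3 : ∀ w, ∑ q, g w (b q) * psiC q i j k = g w (b p) * psiC p i j k := fun w =>
    Finset.sum_eq_single p (fun q _ hq => by rw [h1 q hq, Int.cast_zero, mul_zero]) (by simp)
  rw [h3, h3] at h2
  exact mul_right_cancel₀ (Int.cast_ne_zero.mpr h0) h2

namespace LocalCCY

variable {U : Set E7} (L : LocalCCY U) (f h : ℝ)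

/-- The torsion tensor. -/
noncomputable def T (y : E7) : E7 →L[ℝ] E7 →L[ℝ] ℝ :=
  (f / h ^ 2 / 2) • (L.gT f h y - (4 * f ^ 2) • (L.η y).smulRight (L.η y))

@[simp]
theorem T_apply (y X Y : E7) : L.T f h y X Y
    = f / h ^ 2 / 2 * (L.gT f h y X Y - 4 * f ^ 2 * (L.η y X * L.η y Y)) := by
  simp [T]

/-- The torsion tensor as an endomorphism. -/
noncomputable def S (y : E7) : E7 →L[ℝ] E7 :=
  (f / h ^ 2 / 2) • (ContinuousLinearMap.id ℝ E7 - (4 : ℝ) • (L.η y).smulRight (L.ξ y))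

theorem S_apply (y X : E7) : L.S f h y X = (f / h ^ 2 / 2) • (X - (4 * L.η y X) • L.ξ y) := by
  simp [S, mul_smul]

theorem gT_S {y : E7} (hy : y ∈ U) (X Y : E7) : L.gT f h y (L.S f h y X) Y = L.T f h y X Y := by
  have hc := L.contact y hy
  rw [S_apply, map_smul, map_sub, map_smul, smul_apply, sub_apply, smul_apply,
    gT_apply (X := L.ξ y), hc.g_ξ, hc.η_ξ, T_apply]
  simp only [smul_eq_mul]
  ring

theorem T_frameT {f h : ℝ} (hf : f ≠ 0) (hh : h ≠ 0) {y : E7} (hy : y ∈ U) {u : Fin 3 → E7}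
    (hu : IsUnitary (L.g y) (L.η y) (L.Φ y) u) (i j : Fin 7) :
    L.T f h y (L.frameT f h y u i) (L.frameT f h y u j)
      = if i = j then f / h ^ 2 / 2 * torC i else 0 := by
  have h3 : L.gT f h y (L.frameT f h y u i) (L.frameT f h y u j) = if i = j then 1 else 0 :=
    L.isOrthoFrame hf hh hy hu i j
  rw [T_apply, h3, L.η_frameT hy hu, L.η_frameT hy hu, torC]
  by_cases hij : i = j
  · subst hij
    by_cases hi : i = 0
    · simp [hi, etaC]
      field_simp
      ring
    · simp [hi, etaC]
  · by_cases hi : i = 0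
    · have : j ≠ 0 := fun h0 => hij (hi.trans h0.symm)
      simp [hij, etaC, this]
    · simp [hij, etaC, hi]

section Parallel

variable {f h} (hf : f ≠ 0) (hh : h ≠ 0) {φ : E7 → Alt 3}
variable (hφ : ∀ y ∈ U, ∀ X Y Z, φ y ![X, Y, Z] = L.phiT f h y X Y Z) {y : E7} (hy : y ∈ U)

include hf hh hφ hy

theorem metric_eq (X Y : E7) : metric (φ y) X Y = L.gT f h y X Y := by
  obtain ⟨u, hu, h1⟩ := L.exists_normalized hy
  exact (L.isG2Frame hf hh hy hu h1 (hφ y hy)).metric_eq (L.isOrthoFrame hf hh hy hu) X Y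

theorem isG2Structure : IsG2Structure (φ y) := by
  obtain ⟨u, hu, h1⟩ := L.exists_normalized hy
  obtain ⟨vol, hv, -⟩ := (L.isG2Frame hf hh hy hu h1 (hφ y hy)).isMetricOf
    (L.isOrthoFrame hf hh hy hu)
  exact ⟨_, vol, hv⟩

theorem christoffel_metricField (X Y : E7) :
    christoffel (metricField φ) y X Y = L.G y X Y + L.C f h y X Y :=
  L.christoffel_eq hf hh hy (fun _ hz => L.metric_eq hf hh hφ hz) X Y

/-- The 3-form is parallel for the connection with torsion, so only the difference tensor acts. -/
theorem nabla_phi (X : E7) (v : Fin 3 → E7) :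
    nabla (metricField φ) (fun z w => φ z w) y X v
      = -(L.phiT f h y (L.C f h y X (v 0)) (v 1) (v 2)
        + L.phiT f h y (v 0) (L.C f h y X (v 1)) (v 2)
        + L.phiT f h y (v 0) (v 1) (L.C f h y X (v 2))) := by
  rw [nabla]
  have h1 : fderiv ℝ (fun z => φ z v) y X = L.phiT f h y (L.G y X (v 0)) (v 1) (v 2)
      + L.phiT f h y (v 0) (L.G y X (v 1)) (v 2) + L.phiT f h y (v 0) (v 1) (L.G y X (v 2)) := by
    rw [← L.fderiv_phiT_apply hy, fderiv_congr_of_isOpen L.isOpen (f' := fun z =>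
      L.phiT f h z (v 0) (v 1) (v 2)) (fun z hz => by rw [← hφ z hz, ← eq_vec3]) hy]
  rw [h1, sum_update_vec3, L.christoffel_metricField hf hh hφ hy,
    L.christoffel_metricField hf hh hφ hy, L.christoffel_metricField hf hh hφ hy, hφ y hy, hφ y hy, hφ y hy]
  simp only [map_add, add_apply]
  ring

theorem sharp_T (X : E7) : sharp (metric (φ y)) (fun P => L.T f h y X P) = L.S f h y X := by
  obtain ⟨u, hu, h1⟩ := L.exists_normalized hy
  exact (L.isOrthoFrame hf hh hy hu).sharp_eq_of_inner (L.metric_eq hf hh hφ hy) fun Y =>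
    (L.gT_S f h hy X Y).symm

/-- Both sides are multilinear in four vectors, so comparison on the frame suffices, where it is
`torsion_components` times k / 2. -/
theorem isTorsionAt : IsTorsionAt φ y (toBilin (L.T f h y)) := by
  obtain ⟨u, hu, h1⟩ := L.exists_normalized hy
  have hc := L.contact y hy
  have hb := L.isOrthoFrame hf hh hy hu
  have hφb := L.isG2Frame hf hh hy hu h1 (hφ y hy)
  set b := L.frameT f h y u with hbdef
  let act : E7 →L[ℝ] E7 →L[ℝ] E7 →L[ℝ] E7 →L[ℝ] ℝ :=
    ((covAct (covAct (covAct (0 : (E7 →L[ℝ] E7) →L[ℝ] ℝ →L[ℝ] ℝ)))).flip (L.phiT f h y)).comp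
      (L.C f h y)
  have hact : ∀ X A B D, act X A B D = L.phiT f h y (L.C f h y X A) B D
      + L.phiT f h y A (L.C f h y X B) D + L.phiT f h y A B (L.C f h y X D) := by
    intro X A B D
    simp only [act, ContinuousLinearMap.comp_apply, ContinuousLinearMap.flip_apply, covAct_apply,
      add_apply, zero_apply, add_zero, add_assoc]
  have hSb : ∀ m, L.S f h y (b m) = (f / h ^ 2 / 2 * torC m) • b m := by
    intro m
    refine hb.ext fun j => ?_
    have h3 : L.gT f h y (b m) (b j) = if m = j then 1 else 0 := hb m j
    rw [toBilin_apply, L.gT_S f h hy, L.T_frameT hf hh hy hu, toBilin_apply, map_smul, smul_apply, h3]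
    simp
  have key : -uncurry4 act = (psiMulti (φ y)).compLinearMap
      (Matrix.vecCons (L.S f h y).toLinearMap fun _ => LinearMap.id) := by
    refine Module.Basis.ext_multilinear (fun _ => hb.basis) fun i => ?_
    have e1 : ∀ i j k, L.phiT f h y (b i) (b j) (b k) = phiC i j k := fun i j k => by
      rw [← hφ y hy, hφb]
    have e2 : (fun a => (Matrix.vecCons (L.S f h y).toLinearMap (fun _ => LinearMap.id) :
        Fin 4 → E7 →ₗ[ℝ] E7) a (hb.basis (i a))) = Fin.cons ((f / h ^ 2 / 2 * torC (i 0)) • b (i 0))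
          ![b (i 1), b (i 2), b (i 3)] := by
      funext a
      fin_cases a
      · simp [hSb]
      · simp
      · simp
      · simp
    rw [MultilinearMap.compLinearMap_apply, e2]
    have e3 : ∀ v w, psiMulti (φ y) (Fin.cons v w) = (psiMulti (φ y)).curryLeft v w :=
      fun v w => rfl
    rw [e3, map_smul, smul_apply, ← e3, psiMulti_apply]
    change -(act (hb.basis (i 0)) (hb.basis (i 1)) (hb.basis (i 2)) (hb.basis (i 3))) = _
    simp only [IsOrthoFrame.basis_apply]
    have e4 : psi (φ y) (Fin.cons (b (i 0)) ![b (i 1), b (i 2), b (i 3)])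
      = psiC (i 0) (i 1) (i 2) (i 3) := hφb.psi_frame hb _ _ _ _
    rw [hact, e4, L.C_frameT hf hh hy hu, L.C_frameT hf hh hy hu, L.C_frameT hf hh hy hu]
    simp only [map_sum, map_smul, _root_.sum_apply, smul_apply, ← hbdef, e1, smul_eq_mul]
    have e5 := congrArg (Int.cast (R := ℝ)) (torsion_components (i 0) (i 1) (i 2) (i 3))
    push_cast at e5
    rw [mul_assoc, ← e5, ← Finset.sum_add_distrib, ← Finset.sum_add_distrib, mul_neg,
      Finset.mul_sum]
    congr 1
    exact Finset.sum_congr rfl fun p _ => by ring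
  intro X v
  rw [L.nabla_phi hf hh hφ hy]
  have := congrArg (fun F => F (Fin.cons X v)) key
  have e6 : (-uncurry4 act) (Fin.cons X v) = -(act X (v 0) (v 1) (v 2)) := rfl
  rw [← hact, ← e6, key, MultilinearMap.compLinearMap_apply, psiMulti_apply]
  congr 1
  funext a
  have e7 : sharp (metric (φ y)) (fun P => toBilin (L.T f h y) X P) = L.S f h y X :=
    L.sharp_T hf hh hφ hy X
  rw [e7]
  fin_cases a <;> rfl

/-- The chosen torsion tensor satisfies the same equation, and ψ is nondegenerate in its first
argument. -/
theorem torsion_eq (X Y : E7) : torsion φ y X Y = L.T f h y X Y := by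
  obtain ⟨u, hu, h1⟩ := L.exists_normalized hy
  have hb := L.isOrthoFrame hf hh hy hu
  have hφb := L.isG2Frame hf hh hy hu h1 (hφ y hy)
  have h2 := L.isTorsionAt hf hh hφ hy
  have h3 : IsTorsionAt φ y (Classical.epsilon fun T : LinearMap.BilinForm ℝ E7 =>
    IsTorsionAt φ y T) := Classical.epsilon_spec ⟨_, h2⟩
  rw [torsion]
  set T' := Classical.epsilon fun T : LinearMap.BilinForm ℝ E7 => IsTorsionAt φ y T
  have h4 := hφb.psi_nondegenerate hb fun v => (h3 X v).symm.trans (h2 X v)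
  have h5 := hb.inner_sharp (L.metric_eq hf hh hφ hy) (T' X) (fun _ => rfl) Y
  rw [h4, hb.inner_sharp (L.metric_eq hf hh hφ hy) (toBilin (L.T f h y) X) (fun _ => rfl)] at h5
  exact h5.symm

end Parallel

end LocalCCY

end G2Flow

/-! ### Riemann and Ricci curvature of the rescaled metric. -/

namespace G2Flow

/-- The trace of an endomorphism in an orthonormal frame. -/
theorem IsOrthoFrame.sum_apply_e {g : LinearMap.BilinForm ℝ E7} {b : Fin 7 → E7}
    (hb : IsOrthoFrame g b) (A : E7 →ₗ[ℝ] E7) : ∑ i, A (e i) i = ∑ a, g (A (b a)) (b a) := by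
  have h1 := LinearMap.trace_eq_matrix_trace ℝ hb.basis A
  have h2 := LinearMap.trace_eq_matrix_trace ℝ (EuclideanSpace.basisFun (Fin 7) ℝ).toBasis A
  rw [h2] at h1
  simpa [Matrix.trace, LinearMap.toMatrix_apply, hb.basis_repr] using h1

theorem trace_zero (g : Tensor2) : trace g (fun _ _ => 0) = 0 := by simp [trace]

theorem sharp_zero (g : Tensor2) : sharp g (fun _ => 0) = 0 := by simp [sharp]

namespace LocalCCY

variable {U : Set E7} (L : LocalCCY U) {f h : ℝ}

/-- The algebraic part of the curvature of `gT`. -/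
theorem curv_frameT (hf : f ≠ 0) (hh : h ≠ 0) {y : E7} (hy : y ∈ U) {u : Fin 3 → E7}
    (hu : IsUnitary (L.g y) (L.η y) (L.Φ y) u) (i j k l : Fin 7) :
    L.gT f h y (L.C f h y (L.frameT f h y u i) (L.C f h y (L.frameT f h y u j) (L.frameT f h y u k))
      - L.C f h y (L.frameT f h y u j) (L.C f h y (L.frameT f h y u i) (L.frameT f h y u k))
      + L.om y (L.frameT f h y u i) (L.frameT f h y u j) • L.C f h y (L.ξ y) (L.frameT f h y u k))
      (L.frameT f h y u l) = (f / h ^ 2) ^ 2 / 4 * rmC i j k l := by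
  have hb := L.isOrthoFrame hf hh hy hu
  have hξ : L.ξ y = f • L.frameT f h y u 0 := by
    rw [frameT_zero, smul_smul, mul_inv_cancel₀ hf, one_smul]
  have e3 : ∀ a p, L.gT f h y (L.frameT f h y u a) (L.frameT f h y u p) = if a = p then 1 else 0 :=
    hb
  rw [L.om_frameT hy hu, hξ, map_smul, smul_apply]
  set b := L.frameT f h y u with hbdef
  simp only [hbdef, L.C_frameT hf hh hy hu, map_sum, map_smul]
  simp only [← hbdef, map_add, map_sub, map_sum, map_smul, add_apply, sub_apply, _root_.sum_apply,
    smul_apply, e3, smul_eq_mul, mul_ite, mul_one, mul_zero, Finset.sum_ite_eq', Finset.mem_univ,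
    if_true, rmC]
  push_cast
  rw [mul_add, Finset.mul_sum, ← Finset.sum_sub_distrib]
  congr 1
  · exact Finset.sum_congr rfl fun p _ => by ring
  · field_simp
    ring

/-- The curvature of `gT` as a trilinear map. -/
noncomputable def curv (L : LocalCCY U) (f h : ℝ) (y : E7) : E7 →L[ℝ] E7 →L[ℝ] E7 →L[ℝ] E7 :=
  fderiv ℝ L.G y - (fderiv ℝ L.G y).flip
    + (ContinuousLinearMap.compL ℝ E7 E7 E7).bilinearComp (L.G y) (L.G y)
    - ((ContinuousLinearMap.compL ℝ E7 E7 E7).bilinearComp (L.G y) (L.G y)).flip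
    + ((ContinuousLinearMap.compL ℝ E7 E7 E7).bilinearComp (L.C f h y) (L.C f h y)
    - ((ContinuousLinearMap.compL ℝ E7 E7 E7).bilinearComp (L.C f h y) (L.C f h y)).flip
    + ((ContinuousLinearMap.smulRightL ℝ E7 (E7 →L[ℝ] E7)).flip (L.C f h y (L.ξ y))).comp (L.om y))

theorem curv_apply (y X Y Z : E7) : L.curv f h y X Y Z = L.R y X Y Z
      + (L.C f h y X (L.C f h y Y Z) - L.C f h y Y (L.C f h y X Z)
        + L.om y X Y • L.C f h y (L.ξ y) Z) := rfl

/-- The Riemann curvature tensor of `gT`. -/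
noncomputable def riem (L : LocalCCY U) (f h : ℝ) (y : E7) :
    MultilinearMap ℝ (fun _ : Fin 4 => E7) ℝ :=
  uncurry4 ((ContinuousLinearMap.compL ℝ E7 (E7 →L[ℝ] E7) (E7 →L[ℝ] E7 →L[ℝ] ℝ)
    (ContinuousLinearMap.compL ℝ E7 E7 (E7 →L[ℝ] ℝ) (L.gT f h y))).comp (L.curv f h y))

theorem riem_apply (y : E7) (v : Fin 4 → E7) :
    L.riem f h y v = L.gT f h y (L.curv f h y (v 0) (v 1) (v 2)) (v 3) := rfl

section Parallel

variable (hf : f ≠ 0) (hh : h ≠ 0) {φ : E7 → Alt 3}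
variable (hφ : ∀ y ∈ U, ∀ X Y Z, φ y ![X, Y, Z] = L.phiT f h y X Y Z) {y : E7} (hy : y ∈ U)

include hf hh hφ hy

theorem curvature_metricField (X Y Z : E7) :
    curvature (leviCivita (metricField φ)) y X Y Z = L.R y X Y Z
      + (L.C f h y X (L.C f h y Y Z) - L.C f h y Y (L.C f h y X Z)
        + L.om y X Y • L.C f h y (L.ξ y) Z) :=
  L.curvature_eq hf hh hy (fun _ hz => L.metric_eq hf hh hφ hz) X Y Z

theorem riemann_eq (v : Fin 4 → E7) : riemann (metricField φ) y v = L.riem f h y v := by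
  rw [riemann, L.curvature_metricField hf hh hφ hy, riem_apply, curv_apply]
  exact L.metric_eq hf hh hφ hy _ _

/-- The part R contributes nothing by transverse Ricci-flatness and `R_ξ_left`; the algebraic part
is evaluated by `sum_rmC`. -/
theorem ricci_eq (Y Z : E7) : ricci (metricField φ) y Y Z
    = - (f / h ^ 2) * L.T f h y Y Z := by
  obtain ⟨u, hu, h1⟩ := L.exists_normalized hy
  have hc := L.contact y hy
  have hb := L.isOrthoFrame hf hh hy hu
  have e3 : ∀ a p, L.gT f h y (L.frameT f h y u a) (L.frameT f h y u p) = if a = p then 1 else 0 :=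
    hb
  let A : E7 → E7 → E7 →ₗ[ℝ] E7 := fun Y Z =>
    (((L.curv f h y).flip Y).flip Z).toLinearMap
  have hA : ∀ Y Z, ricci (metricField φ) y Y Z = ∑ a, L.gT f h y (A Y Z (L.frameT f h y u a))
      (L.frameT f h y u a) := by
    intro Y Z
    rw [ricci]
    simp only [L.curvature_metricField hf hh hφ hy]
    exact hb.sum_apply_e (A Y Z)
  let B : LinearMap.BilinForm ℝ E7 := LinearMap.mk₂ ℝ (fun Y Z => ∑ a,
      L.gT f h y (A Y Z (L.frameT f h y u a)) (L.frameT f h y u a))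
    (by intros; simp only [A, ContinuousLinearMap.coe_coe, ContinuousLinearMap.flip_apply, map_add,
          add_apply, Finset.sum_add_distrib])
    (by intros; simp only [A, ContinuousLinearMap.coe_coe, ContinuousLinearMap.flip_apply, map_smul,
          smul_apply, Finset.smul_sum])
    (by intros; simp only [A, ContinuousLinearMap.coe_coe, ContinuousLinearMap.flip_apply, map_add,
          add_apply, Finset.sum_add_distrib])
    (by intros; simp only [A, ContinuousLinearMap.coe_coe, ContinuousLinearMap.flip_apply, map_smul,
          smul_apply, Finset.smul_sum])
  have key : B = -(f / h ^ 2) • toBilin (L.T f h y) := by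
    refine hb.basis.ext fun j => hb.basis.ext fun k => ?_
    rw [hb.basis_apply, hb.basis_apply]
    have e1 : ∀ i, L.gT f h y (A (L.frameT f h y u j) (L.frameT f h y u k) (L.frameT f h y u i))
        (L.frameT f h y u i) = L.gT f h y (L.R y (L.frameT f h y u i) (L.frameT f h y u j)
          (L.frameT f h y u k)) (L.frameT f h y u i) + (f / h ^ 2) ^ 2 / 4 * rmC i j k i := by
      intro i
      rw [← L.curv_frameT hf hh hy hu, ← add_apply, ← map_add]
      rfl
    have e2 : ∑ i, L.gT f h y (L.R y (L.frameT f h y u i) (L.frameT f h y u j)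
          (L.frameT f h y u k)) (L.frameT f h y u i) = 0 := by
      have h2 := L.ricci_R hy hu (L.frameT f h y u j) (L.frameT f h y u k)
      simp only [gT_apply, L.η_R hy, zero_mul, mul_zero, add_zero]
      rw [← Finset.mul_sum]
      have : ∑ i, L.g y (L.R y (L.frameT f h y u i) (L.frameT f h y u j)
          (L.frameT f h y u k)) (L.frameT f h y u i) = (h ^ 2)⁻¹ * ∑ a, (L.g y (L.R y (u a)
          (L.frameT f h y u j) (L.frameT f h y u k)) (u a) + L.g y (L.R y (L.Φ y (u a))
          (L.frameT f h y u j) (L.frameT f h y u k)) (L.Φ y (u a))) := by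
        generalize L.frameT f h y u j = Y
        generalize L.frameT f h y u k = Z
        have hR : ∀ (c : ℝ) X, L.R y (c • X) Y Z = c • L.R y X Y Z := by
          intro c X
          simp [R_apply, smul_sub]
        simp only [Fin.sum_univ_succ, Fin.sum_univ_zero, frameT, unitaryFrame, hR, map_smul,
          smul_apply, smul_eq_mul]
        simp [L.R_ξ_left hy]
        ring
      rw [this, h2, mul_zero, mul_zero]
    change ∑ i, L.gT f h y (A (L.frameT f h y u j) (L.frameT f h y u k) (L.frameT f h y u i))
        (L.frameT f h y u i) = -(f / h ^ 2) * L.T f h y _ _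
    simp only [e1]
    have e5 := congrArg (Int.cast (R := ℝ)) (sum_rmC j k)
    push_cast at e5
    rw [Finset.sum_add_distrib, e2, ← Finset.mul_sum, e5, T_apply, e3, L.η_frameT hy hu,
      L.η_frameT hy hu]
    by_cases hjk : j = k
    · subst hjk
      by_cases hj : j = 0
      · simp [hj, etaC]
        field_simp
        ring
      · simp [hj, etaC]
        field_simp
        ring
    · by_cases hj : j = 0
      · have : k ≠ 0 := fun h0 => hjk (hj.trans h0.symm)
        simp [hjk, etaC, this]
      · simp [hjk, etaC, hj]
  rw [hA]
  exact congrArg (fun F => F Y Z) key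

end Parallel

end LocalCCY

end G2Flow

/-! ### Derivative of the torsion and velocity of the flow. -/

namespace G2Flow

theorem sum_torC : ∑ i, torC i = 3 := by decide +kernel

namespace LocalCCY

variable {U : Set E7} (L : LocalCCY U) {f h : ℝ}

/-- The covariant derivative of the torsion. -/
noncomputable def nablaT (f h : ℝ) (y : E7) : E7 →L[ℝ] E7 →L[ℝ] E7 →L[ℝ] ℝ :=
  -(((covAct (covAct (0 : (E7 →L[ℝ] E7) →L[ℝ] ℝ →L[ℝ] ℝ))).flip (L.T f h y)).comp (L.C f h y))

theorem nablaT_apply (y X A B : E7) : L.nablaT f h y X A B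
    = -(L.T f h y (L.C f h y X A) B + L.T f h y A (L.C f h y X B)) := by
  simp only [nablaT, neg_apply, ContinuousLinearMap.comp_apply, ContinuousLinearMap.flip_apply,
    covAct_apply, add_apply, zero_apply, add_zero]

theorem nablaT_frameT (hf : f ≠ 0) (hh : h ≠ 0) {y : E7} (hy : y ∈ U) {u : Fin 3 → E7}
    (hu : IsUnitary (L.g y) (L.η y) (L.Φ y) u) (i j k : Fin 7) :
    L.nablaT f h y (L.frameT f h y u i) (L.frameT f h y u j) (L.frameT f h y u k)
      = -((f / h ^ 2) ^ 2 / 4 * (gammaC i j k * torC k + gammaC i k j * torC j)) := by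
  rw [nablaT_apply, L.C_frameT hf hh hy hu, L.C_frameT hf hh hy hu]
  simp only [map_sum, map_smul, _root_.sum_apply, smul_apply, L.T_frameT hf hh hy hu, smul_eq_mul,
    mul_ite, mul_zero, Finset.sum_ite_eq, Finset.sum_ite_eq', Finset.mem_univ, if_true]
  ring

theorem fderiv_T_apply {y : E7} (hy : y ∈ U) (X A B : E7) : fderiv ℝ (fun z => L.T f h z A B) y X
    = L.T f h y (L.G y X A) B + L.T f h y A (L.G y X B) := by
  simp only [T_apply]
  have hg : DifferentiableAt ℝ (fun z => L.gT f h z A B) y := by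
    simp only [gT_apply]
    exact ((L.diff_g hy A B).const_mul _).fun_add
      (((L.diff_η hy A).fun_mul (L.diff_η hy B)).const_mul _)
  have hη := fun A => (L.diff_η hy A).hasFDerivAt
  rw [((hg.hasFDerivAt.fun_sub (((hη A).fun_mul (hη B)).const_mul (4 * f ^ 2))).const_mul
    (f / h ^ 2 / 2)).fderiv]
  simp only [sub_apply, add_apply, smul_apply, smul_eq_mul, L.fderiv_gT_apply hy,
    L.fderiv_η_apply hy]
  ring

theorem phi_self {φ : E7 → Alt 3}
    (hφ : ∀ y ∈ U, ∀ X Y Z, φ y ![X, Y, Z] = L.phiT f h y X Y Z) {y : E7} (hy : y ∈ U) (X Z : E7) : L.phiT f h y X X Z = 0 := by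
  rw [← hφ y hy]
  exact (φ y).map_eq_zero_of_eq ![X, X, Z] (i := 0) (j := 1) rfl (by decide)

theorem T_symm {y : E7} (hy : y ∈ U) (X Y : E7) : L.T f h y X Y = L.T f h y Y X := by
  rw [T_apply, T_apply, gT_apply, gT_apply, (L.contact y hy).symm X Y]
  ring

section Parallel

variable (hf : f ≠ 0) (hh : h ≠ 0) {φ : E7 → Alt 3}
variable (hφ : ∀ y ∈ U, ∀ X Y Z, φ y ![X, Y, Z] = L.phiT f h y X Y Z) {y : E7} (hy : y ∈ U)

include hf hh hφ hy

/-- The torsion tensor is parallel for the connection with torsion, so its covariant derivative is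
algebraic. -/
theorem nablaTorsion_eq (v : Fin 3 → E7) :
    nablaTorsion φ y v = L.nablaT f h y (v 0) (v 1) (v 2) := by
  rw [nablaTorsion, nabla, nablaT_apply]
  have h1 : fderiv ℝ (fun z => torsion φ z (![v 1, v 2] 0) (![v 1, v 2] 1)) y (v 0)
      = L.T f h y (L.G y (v 0) (v 1)) (v 2) + L.T f h y (v 1) (L.G y (v 0) (v 2)) := by
    rw [← L.fderiv_T_apply hy]
    exact congrArg (fun F => F (v 0)) (fderiv_congr_of_isOpen L.isOpen
      (fun z hz => L.torsion_eq hf hh hφ hz (v 1) (v 2)) hy)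
  rw [h1, Fin.sum_univ_two]
  simp only [Function.update_self, Matrix.cons_val_zero, Matrix.cons_val_one,
    Function.update_of_ne (one_ne_zero : (1 : Fin 2) ≠ 0),
    Function.update_of_ne (zero_ne_one : (0 : Fin 2) ≠ 1),
    L.torsion_eq hf hh hφ hy, L.christoffel_metricField hf hh hφ hy]
  simp only [map_add, add_apply]
  ring

theorem divTorsion_eq (Z : E7) : divTorsion φ y Z = 0 := by
  obtain ⟨u, hu, h1⟩ := L.exists_normalized hy
  have hb := L.isOrthoFrame hf hh hy hu
  have e : ∀ Z, divTorsion φ y Z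
      = ∑ a, L.nablaT f h y (L.frameT f h y u a) (L.frameT f h y u a) Z := by
    intro Z
    exact hb.trace_eq (L.metric_eq hf hh hφ hy) (LinearMap.mk₂ ℝ (fun P Q => L.nablaT f h y P Q Z)
      (by simp) (by simp) (by simp) (by simp))
      (fun P Q => L.nablaTorsion_eq hf hh hφ hy ![P, Q, Z])
  let D : E7 →ₗ[ℝ] ℝ :=
    ∑ a, (L.nablaT f h y (L.frameT f h y u a) (L.frameT f h y u a)).toLinearMap
  have hD : D = 0 := by
    refine hb.basis.ext fun z => ?_
    rw [hb.basis_apply]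
    simp only [D, LinearMap.sum_apply, ContinuousLinearMap.coe_coe, L.nablaT_frameT hf hh hy hu]
    have e5 := congrArg (Int.cast (R := ℝ)) (div_torsion_components z)
    push_cast at e5
    rw [Finset.sum_neg_distrib, ← Finset.mul_sum, e5]
    simp
  rw [e]
  have := congrArg (fun F => F Z) hD
  simp only [D, LinearMap.sum_apply] at this
  exact this

/-- The torsion is diagonal in the frame, and φ is skew. -/
theorem vecTorsion_eq (Z : E7) : vecTorsion φ y Z = 0 := by
  obtain ⟨u, hu, h1⟩ := L.exists_normalized hy
  have hb := L.isOrthoFrame hf hh hy hu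
  have e1 : ∀ P P', trace (metric (φ y)) (fun Q Q' => torsion φ y P Q * φ y ![P', Q', Z])
      = ∑ q, L.T f h y P (L.frameT f h y u q) * L.phiT f h y P' (L.frameT f h y u q) Z := by
    intro P P'
    exact hb.trace_eq (L.metric_eq hf hh hφ hy) (LinearMap.mk₂ ℝ
      (fun Q Q' => L.T f h y P Q * L.phiT f h y P' Q' Z)
      (by intros; rw [map_add, add_mul]) (by intros; rw [map_smul, smul_mul_assoc])
      (by intros; rw [map_add, add_apply, mul_add])
      (by intros; rw [map_smul, smul_apply, mul_smul_comm]))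
      (fun Q Q' => by rw [L.torsion_eq hf hh hφ hy, hφ y hy]; rfl)
  have e2 := hb.trace_eq (L.metric_eq hf hh hφ hy) (LinearMap.mk₂ ℝ
      (fun P P' => ∑ q, L.T f h y P (L.frameT f h y u q) * L.phiT f h y P' (L.frameT f h y u q) Z)
      (by intros; simp only [map_add, add_apply, add_mul, Finset.sum_add_distrib])
      (by intros; simp only [map_smul, smul_apply, smul_mul_assoc, Finset.smul_sum])
      (by intros; simp only [map_add, add_apply, mul_add, Finset.sum_add_distrib])
      (by intros; simp only [map_smul, smul_apply, mul_smul_comm, Finset.smul_sum])) (e1)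
  rw [vecTorsion, e2]
  refine Finset.sum_eq_zero fun p _ => ?_
  rw [LinearMap.mk₂_apply]
  refine Finset.sum_eq_zero fun q _ => ?_
  rw [L.T_frameT hf hh hy hu]
  split_ifs with hpq
  · rw [hpq, L.phi_self hφ hy, mul_zero]
  · rw [zero_mul]

theorem trace_torsion : trace (metric (φ y)) (torsion φ y) = 3 / 2 * (f / h ^ 2) := by
  obtain ⟨u, hu, h1⟩ := L.exists_normalized hy
  have hb := L.isOrthoFrame hf hh hy hu
  rw [hb.trace_eq (L.metric_eq hf hh hφ hy) (toBilin (L.T f h y)) (L.torsion_eq hf hh hφ hy)]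
  simp only [toBilin_apply, L.T_frameT hf hh hy hu, if_true]
  have e5 := congrArg (Int.cast (R := ℝ)) sum_torC
  push_cast at e5
  rw [← Finset.mul_sum, e5]
  ring

theorem vecTorsionSharp_eq : vecTorsionSharp φ y = 0 := by
  rw [vecTorsionSharp, show vecTorsion φ y = fun _ => 0 from
    funext (L.vecTorsion_eq hf hh hφ hy), sharp_zero]

/-- With k = f / h², -Ric contributes kT and (tr T) T contributes (3/2) kT; the quadratic middle
term vanishes with VT. -/
theorem flowSym_eq (X Y : E7) : flowSym φ y X Y = 5 / 2 * (f / h ^ 2) * L.T f h y X Y := by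
  rw [flowSym, L.ricci_eq hf hh hφ hy, L.trace_torsion hf hh hφ hy]
  have e : symPart (comp2 (metric (φ y)) (torsion φ y)
        fun P Q => φ y ![vecTorsionSharp φ y, P, Q]) X Y = 0 := by
    have h0 : ∀ P Q, φ y ![vecTorsionSharp φ y, P, Q] = 0 := fun P Q => by
      rw [L.vecTorsionSharp_eq hf hh hφ hy, hφ y hy]
      simp only [map_zero, zero_apply]
    simp only [symPart, comp2, h0, mul_zero, trace_zero]
    norm_num
  rw [e, symPart, L.torsion_eq hf hh hφ hy, L.torsion_eq hf hh hφ hy,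
    L.T_symm hy Y X]
  ring

theorem flowVec_eq (Z : E7) : flowVec φ y Z = 0 := by
  rw [flowVec, L.divTorsion_eq hf hh hφ hy, L.vecTorsion_eq hf hh hφ hy,
    L.vecTorsionSharp_eq hf hh hφ hy, L.torsion_eq hf hh hφ hy]
  simp only [map_zero, zero_apply]
  ring

theorem sharp_flowSym (X : E7) : sharp (metric (φ y)) (flowSym φ y X)
    = (5 / 2 * (f / h ^ 2)) • L.S f h y X := by
  obtain ⟨u, hu, h1⟩ := L.exists_normalized hy
  refine (L.isOrthoFrame hf hh hy hu).sharp_eq_of_inner (L.metric_eq hf hh hφ hy) fun Y => ?_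
  rw [L.flowSym_eq hf hh hφ hy, toBilin_apply, map_smul, smul_apply, L.gT_S f h hy, smul_eq_mul]

/-- The velocity of the flow. -/
theorem flowVelocity_eq (v : Fin 3 → E7) : flowVelocity φ y v = 5 / 4 * (f / h ^ 2) ^ 2 *
    (3 * (h ^ 3 * (L.Υ y (v 0) (v 1) (v 2)).re) - f * h ^ 2 * (L.η y (v 0) * L.om y (v 1) (v 2)
      - L.η y (v 1) * L.om y (v 0) (v 2) + L.om y (v 0) (v 1) * L.η y (v 2))) := by
  have hP := L.typeThreeZero y hy
  have h0 : psi (φ y) (Fin.cons (sharp (metric (φ y)) (flowVec φ y)) v) = 0 := by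
    rw [show flowVec φ y = fun _ => 0 from funext (L.flowVec_eq hf hh hφ hy), sharp_zero,
      ← psiMulti_apply]
    exact (psiMulti (φ y)).map_coord_zero 0 rfl
  have Υ2 : ∀ A B, L.Υ y A (L.ξ y) B = 0 := fun A B => by
    rw [hP.swap₁, L.Υ_ξ hy, neg_zero]
  have Υ3 : ∀ A B, L.Υ y A B (L.ξ y) = 0 := fun A B => by rw [hP.swap₂, Υ2, neg_zero]
  rw [flowVelocity, h0, diamond]
  simp only [L.sharp_flowSym hf hh hφ hy]
  rw [sum_update_vec3 (φ y) (fun X => (5 / 2 * (f / h ^ 2)) • L.S f h y X), hφ y hy, hφ y hy,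
    hφ y hy]
  -- The endomorphism acts slot by slot with relative weights -3 on ξ and 1 on 𝒟: in total -3 + 1 +
  -- 1 = -1 on η ∧ ω and 3 on Re Υ.
  simp only [S_apply, map_smul, map_sub, smul_apply, sub_apply, phiT_apply (X := L.ξ y),
    phiT_apply (Y := L.ξ y), phiT_apply (Z := L.ξ y), L.om_ξ hy, L.om_ξ' hy, L.Υ_ξ hy, Υ2, Υ3,
    (L.contact y hy).η_ξ, smul_eq_mul, Complex.zero_re]
  simp only [phiT_apply]
  ring

end Parallel

end LocalCCY

end G2Flow

/-! ### Evaluation of Λ and bounds for it. -/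

namespace G2Flow

/-- The value of `Λ` for the model with flat transverse metric and `f / h² = 1`. -/
noncomputable def lambdaC : ℝ := Real.sqrt
  (∑ i : Fin 4 → Fin 7, (1 / 4 * rmC (i 0) (i 1) (i 2) (i 3) : ℝ) ^ 2
    + ∑ i : Fin 3 → Fin 7, (-(1 / 4 * (gammaC (i 0) (i 1) (i 2) * torC (i 2)
      + gammaC (i 0) (i 2) (i 1) * torC (i 1))) : ℝ) ^ 2
    + (∑ i : Fin 2 → Fin 7, (if i 0 = i 1 then (1 / 2 * torC (i 0) : ℝ) else 0) ^ 2) ^ 2)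

namespace LocalCCY

variable {U : Set E7} (L : LocalCCY U) {f h : ℝ}

variable (hf : f ≠ 0) (hh : h ≠ 0) {φ : E7 → Alt 3}
variable (hφ : ∀ y ∈ U, ∀ X Y Z, φ y ![X, Y, Z] = L.phiT f h y X Y Z) {y : E7} (hy : y ∈ U)

include hf hh hy

/-- R vanishes when ξ is inserted in any slot, so each unit vector contributes h⁻¹ while the metric
on 𝒟 contributes h²: in total h⁻². The algebraic part scales as (f / h²)², and this difference in
scaling separates the two singularity types. -/
theorem riem_frameT {u : Fin 3 → E7} (hu : IsUnitary (L.g y) (L.η y) (L.Φ y) u)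
    (i j k l : Fin 7) : L.riem f h y ![L.frameT f h y u i, L.frameT f h y u j,
      L.frameT f h y u k, L.frameT f h y u l]
      = (h ^ 2)⁻¹ * L.g y (L.R y (unitaryFrame (L.ξ y) (L.Φ y) u i)
          (unitaryFrame (L.ξ y) (L.Φ y) u j) (unitaryFrame (L.ξ y) (L.Φ y) u k))
          (unitaryFrame (L.ξ y) (L.Φ y) u l)
        + (f / h ^ 2) ^ 2 / 4 * rmC i j k l := by
  have hc := L.contact y hy
  have e1 : ∀ i Y Z, L.R y (L.frameT f h y u i) Y Z
      = h⁻¹ • L.R y (unitaryFrame (L.ξ y) (L.Φ y) u i) Y Z := by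
    intro i Y Z
    have hR : ∀ (c : ℝ) X, L.R y (c • X) Y Z = c • L.R y X Y Z := by
      intro c X
      simp [R_apply, smul_sub]
    rw [frameT, hR]
    split_ifs with hi
    · subst hi
      simp [unitaryFrame, L.R_ξ_left hy]
    · rfl
  have e2 : ∀ X i Z, L.R y X (L.frameT f h y u i) Z
      = h⁻¹ • L.R y X (unitaryFrame (L.ξ y) (L.Φ y) u i) Z := by
    intro X i Z
    rw [R_swap, e1, L.R_swap y X, smul_neg]
  have e3 : ∀ X Y i, L.R y X Y (L.frameT f h y u i)
      = h⁻¹ • L.R y X Y (unitaryFrame (L.ξ y) (L.Φ y) u i) := by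
    intro X Y i
    rw [frameT, map_smul]
    split_ifs with hi
    · subst hi
      simp [unitaryFrame, L.R_ξ hy]
    · rfl
  have e4 : ∀ X Y Z i, L.g y (L.R y X Y Z) (L.frameT f h y u i)
      = h⁻¹ * L.g y (L.R y X Y Z) (unitaryFrame (L.ξ y) (L.Φ y) u i) := by
    intro X Y Z i
    rw [frameT, map_smul, smul_eq_mul]
    split_ifs with hi
    · subst hi
      simp [unitaryFrame, hc.g_ξ', L.η_R hy]
    · rfl
  rw [riem_apply, ← L.curv_frameT hf hh hy hu]
  simp only [Matrix.cons_val]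
  rw [curv_apply, map_add, add_apply]
  congr 1
  rw [gT_apply, L.η_R hy, e4, e1, e2, e3]
  simp only [map_smul, smul_apply, smul_eq_mul]
  field_simp
  ring

include hφ

theorem lambdaAt_eq {u : Fin 3 → E7} (hu : IsUnitary (L.g y) (L.η y) (L.Φ y) u) :
    lambdaAt φ y = Real.sqrt
      (∑ i : Fin 4 → Fin 7, ((h ^ 2)⁻¹ * L.g y (L.R y (unitaryFrame (L.ξ y) (L.Φ y) u (i 0))
          (unitaryFrame (L.ξ y) (L.Φ y) u (i 1)) (unitaryFrame (L.ξ y) (L.Φ y) u (i 2)))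
          (unitaryFrame (L.ξ y) (L.Φ y) u (i 3))
          + (f / h ^ 2) ^ 2 / 4 * rmC (i 0) (i 1) (i 2) (i 3)) ^ 2
        + ∑ i : Fin 3 → Fin 7, (-((f / h ^ 2) ^ 2 / 4 * (gammaC (i 0) (i 1) (i 2) * torC (i 2)
          + gammaC (i 0) (i 2) (i 1) * torC (i 1)))) ^ 2
        + (∑ i : Fin 2 → Fin 7, (if i 0 = i 1 then f / h ^ 2 / 2 * torC (i 0) else 0) ^ 2) ^ 2) := by
  have hb := L.isOrthoFrame hf hh hy hu
  have hm := L.metric_eq hf hh hφ hy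
  rw [lambdaAt, hb.normSq_eq hm (L.riem f h y) (L.riemann_eq hf hh hφ hy),
    hb.normSq_eq hm (uncurry3 (L.nablaT f h y)) (L.nablaTorsion_eq hf hh hφ hy),
    hb.normSq_eq hm (uncurry2 (L.T f h y)) (fun v => L.torsion_eq hf hh hφ hy (v 0) (v 1))]
  congr 2
  · congr 1
    · refine Finset.sum_congr rfl fun i _ => ?_
      rw [← L.riem_frameT hf hh hy hu]
      rfl
    · refine Finset.sum_congr rfl fun i _ => ?_
      rw [← L.nablaT_frameT hf hh hy hu]
      rfl
  · congr 1
    refine Finset.sum_congr rfl fun i _ => ?_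
    rw [← L.T_frameT hf hh hy hu]
    rfl

/-- Without R, both Rm and ∇T are homogeneous of degree two in f / h², and T is of degree one. -/
theorem lambdaAt_of_flat (hR : ∀ X Y Z, L.R y X Y Z = 0) :
    lambdaAt φ y = (f / h ^ 2) ^ 2 * lambdaC := by
  obtain ⟨u, hu⟩ := (L.contact y hy).exists_unitary
  rw [L.lambdaAt_eq hf hh hφ hy hu, lambdaC]
  generalize f / h ^ 2 = k
  conv_rhs => rw [← Real.sqrt_sq (sq_nonneg k), ← Real.sqrt_mul (sq_nonneg _)]
  congr 1
  simp only [hR, map_zero, zero_apply, mul_zero, zero_add]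
  rw [mul_add, mul_add, Finset.mul_sum, Finset.mul_sum]
  congr 1
  · congr 1 <;> exact Finset.sum_congr rfl fun i _ => by ring
  · rw [← mul_pow, Finset.mul_sum]
    congr 1
    refine Finset.sum_congr rfl fun i _ => ?_
    split_ifs
    · ring
    · ring

/-- One component of Rm is dominated by Λ, and the reverse triangle inequality separates its two
parts. -/
theorem le_lambdaAt {u : Fin 3 → E7} (hu : IsUnitary (L.g y) (L.η y) (L.Φ y) u)
    (i j k l : Fin 7) : |L.g y (L.R y (unitaryFrame (L.ξ y) (L.Φ y) u i)
          (unitaryFrame (L.ξ y) (L.Φ y) u j) (unitaryFrame (L.ξ y) (L.Φ y) u k))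
          (unitaryFrame (L.ξ y) (L.Φ y) u l)| / h ^ 2 - (f / h ^ 2) ^ 2 * (|(rmC i j k l : ℝ)| / 4)
      ≤ lambdaAt φ y := by
  rw [L.lambdaAt_eq hf hh hφ hy hu]
  refine le_trans ?_ (Real.abs_le_sqrt (x := (h ^ 2)⁻¹ * L.g y (L.R y
    (unitaryFrame (L.ξ y) (L.Φ y) u i) (unitaryFrame (L.ξ y) (L.Φ y) u j)
    (unitaryFrame (L.ξ y) (L.Φ y) u k)) (unitaryFrame (L.ξ y) (L.Φ y) u l)
    + (f / h ^ 2) ^ 2 / 4 * rmC i j k l) ?_)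
  · generalize L.g y (L.R y _ _ _) _ = A
    have h1 := abs_sub_abs_le_abs_sub ((h ^ 2)⁻¹ * A) (-((f / h ^ 2) ^ 2 / 4 * rmC i j k l))
    rw [sub_neg_eq_add, abs_neg, abs_mul, abs_mul, abs_of_nonneg (by positivity : 0 ≤ (h ^ 2)⁻¹),
      abs_of_nonneg (by positivity : 0 ≤ (f / h ^ 2) ^ 2 / 4)] at h1
    refine le_trans (le_of_eq ?_) h1
    ring
  · have h1 := Finset.single_le_sum (f := fun i : Fin 4 → Fin 7 => ((h ^ 2)⁻¹ * L.g y (L.R y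
          (unitaryFrame (L.ξ y) (L.Φ y) u (i 0))
          (unitaryFrame (L.ξ y) (L.Φ y) u (i 1)) (unitaryFrame (L.ξ y) (L.Φ y) u (i 2)))
          (unitaryFrame (L.ξ y) (L.Φ y) u (i 3))
          + (f / h ^ 2) ^ 2 / 4 * rmC (i 0) (i 1) (i 2) (i 3)) ^ 2)
      (fun i _ => sq_nonneg _) (Finset.mem_univ ![i, j, k, l])
    refine le_trans h1 ?_
    rw [add_assoc]
    exact le_add_of_nonneg_right (add_nonneg (Finset.sum_nonneg fun i _ => sq_nonneg _)
      (sq_nonneg _))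

end LocalCCY

end G2Flow

/-! ### The transverse Levi-Civita connection and its curvature. -/

namespace G2Flow

namespace LocalCCY

variable {U : Set E7} (L : LocalCCY U)

/-- The projection onto the contact distribution. -/
noncomputable def proj (y Z : E7) : E7 := Z - L.η y Z • L.ξ y

/-- The transverse Levi-Civita connection. -/
noncomputable def transverse (X Z : E7 → E7) (y : E7) : E7 :=
  L.proj y (leviCivita (fun z A B => L.g z A B) (fun z => L.proj z (X z))
    (fun z => L.proj z (Z z)) y
    + L.η y (X y) • VectorField.lieBracket ℝ L.ξ (fun z => L.proj z (Z z)) y)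

variable {y : E7} (hy : y ∈ U)

include hy

theorem η_proj (Z : E7) : L.η y (L.proj y Z) = 0 := by
  simp [proj, (L.contact y hy).η_ξ]

theorem proj_ξ : L.proj y (L.ξ y) = 0 := by
  simp [proj, (L.contact y hy).η_ξ]

theorem diff_proj {Z : E7 → E7} (hZ : DifferentiableAt ℝ Z y) :
    DifferentiableAt ℝ (fun z => L.proj z (Z z)) y := by
  simp only [proj]
  exact hZ.fun_sub (((L.diff L.smooth_η hy).clm_apply hZ).fun_smul (L.diff L.smooth_ξ hy))

/-- The projection is parallel. -/
theorem fderiv_proj {Z : E7 → E7} (hZ : DifferentiableAt ℝ Z y) (X : E7) :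
    fderiv ℝ (fun z => L.proj z (Z z)) y X + L.G y X (L.proj y (Z y))
      = L.proj y (fderiv ℝ Z y X + L.G y X (Z y)) := by
  have hη := (L.diff L.smooth_η hy).clm_apply hZ
  have hξ := L.diff L.smooth_ξ hy
  have h1 : fderiv ℝ (fun z => L.proj z (Z z)) y X = fderiv ℝ Z y X
      - (L.η y (Z y) • fderiv ℝ L.ξ y X
        + (fderiv ℝ L.η y X (Z y) + L.η y (fderiv ℝ Z y X)) • L.ξ y) := by
    simp only [proj]
    rw [fderiv_fun_sub hZ (hη.fun_smul hξ), fderiv_fun_smul hη hξ]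
    simp only [sub_apply, add_apply, smul_apply, ContinuousLinearMap.smulRight_apply]
    rw [fderiv_clm_apply_apply (L.diff L.smooth_η hy) hZ]
  rw [h1, L.fderiv_η hy, L.fderiv_ξ hy]
  simp only [proj, map_sub, map_smul, map_add]
  module

/-- For horizontal directions the Levi-Civita connection differs from ∇ by a multiple of ξ, which
the projection removes. Along ξ, the parallelism of ξ and ξ ⌟ ω = 0 give ∇_ξ Z = [ξ, Z]. -/
theorem transverse_eq {X Z : E7 → E7} (hZ : DifferentiableAt ℝ Z y) :
    L.transverse X Z y = L.proj y (fderiv ℝ Z y (X y) + L.G y (X y) (Z y)) := by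
  have hg : ∀ z ∈ U, ∀ X Y, (fun z A B => L.g z A B : E7 → Tensor2) z X Y = L.gT 1 1 z X Y := by
    intro z _ X Y
    simp
  have hp : ∀ V, L.proj y (fderiv ℝ (fun z => L.proj z (Z z)) y V + L.G y V (L.proj y (Z y)))
      = fderiv ℝ (fun z => L.proj z (Z z)) y V + L.G y V (L.proj y (Z y)) := by
    intro V
    rw [L.fderiv_proj hy hZ]
    conv_lhs => rw [proj, L.η_proj hy, zero_smul, sub_zero]
  have hadd : ∀ V W, L.proj y (V + W) = L.proj y V + L.proj y W := by
    intro V W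
    simp only [proj, map_add]
    module
  have hsmul : ∀ (c : ℝ) W, L.proj y (c • W) = c • L.proj y W := by
    intro c W
    simp only [proj, map_smul, smul_eq_mul]
    module
  have h1 : leviCivita (fun z A B => L.g z A B) (fun z => L.proj z (X z))
      (fun z => L.proj z (Z z)) y = (fderiv ℝ (fun z => L.proj z (Z z)) y (L.proj y (X y))
        + L.G y (L.proj y (X y)) (L.proj y (Z y)))
        + (-(1 / 2) * L.om y (L.proj y (X y)) (L.proj y (Z y))) • L.ξ y := by
    rw [leviCivita, L.christoffel_eq one_ne_zero one_ne_zero hy hg, C_apply, L.η_proj hy,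
      L.η_proj hy]
    module
  have h2 : VectorField.lieBracket ℝ L.ξ (fun z => L.proj z (Z z)) y
      = fderiv ℝ (fun z => L.proj z (Z z)) y (L.ξ y) + L.G y (L.ξ y) (L.proj y (Z y)) := by
    rw [VectorField.lieBracket, L.fderiv_ξ hy, L.G_ξ hy]
    module
  rw [transverse, h1, h2, hadd, hadd, hsmul, hsmul, L.proj_ξ hy, smul_zero, add_zero, hp, hp,
    ← L.fderiv_proj hy hZ]
  have h3 : X y = L.proj y (X y) + L.η y (X y) • L.ξ y := by
    rw [proj]
    module
  conv_rhs => rw [h3]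
  simp only [map_add, map_smul, add_apply, smul_apply]
  module

/-- The projection is parallel, so it can be moved outside both derivatives, and R already takes
values in ker η. -/
theorem curvature_transverse (X Y Z : E7) :
    curvature L.transverse y X Y Z = L.R y X Y Z := by
  have hG := L.diff L.smooth_G hy
  have h1 : ∀ Y, ∀ z ∈ U, L.transverse (fun _ => Y) (fun _ => Z) z = L.proj z (L.G z Y Z) := by
    intro Y z hz
    rw [L.transverse_eq hz (differentiableAt_const Z)]
    simp
  have h2 : ∀ X Y, L.transverse (fun _ => X) (L.transverse (fun _ => Y) fun _ => Z) y
      = L.proj y (fderiv ℝ L.G y X Y Z + L.G y X (L.G y Y Z)) := by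
    intro X Y
    have hGYZ := (hG.clm_apply (differentiableAt_const Y)).clm_apply (differentiableAt_const Z)
    have hev : L.transverse (fun _ => Y) (fun _ => Z) =ᶠ[nhds y] fun z => L.proj z (L.G z Y Z) :=
      Filter.eventually_of_mem (L.isOpen.mem_nhds hy) (h1 Y)
    rw [L.transverse_eq hy ((L.diff_proj hy hGYZ).congr_of_eventuallyEq hev), hev.fderiv_eq,
      h1 Y y hy, L.fderiv_proj hy hGYZ]
    conv_lhs => rw [proj, L.η_proj hy, zero_smul, sub_zero]
    rw [fderiv_clm_apply_const (hG.clm_apply (differentiableAt_const Y)),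
      fderiv_clm_apply_const hG]
  rw [curvature, h2, h2]
  have h3 : L.proj y (L.R y X Y Z) = L.R y X Y Z := by
    rw [proj, L.η_R hy, zero_smul, sub_zero]
  rw [← h3]
  simp only [proj, R_apply, map_add, map_sub]
  module

end LocalCCY

end G2Flow

/-! ### Transition maps and coordinate expressions in different charts. -/

namespace G2Flow

section Charts

variable {M : Type*} [TopologicalSpace M] [ChartedSpace E7 M]

/-- The transition map between the preferred charts at two points. -/
noncomputable def tau (x p : M) : E7 → E7 := extChartAt (𝓡 7) p ∘ (extChartAt (𝓡 7) x).symm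

/-- The domain of a transition map. -/
noncomputable def tauDom (x p : M) : Set E7 :=
  (extChartAt (𝓡 7) x).target ∩ (extChartAt (𝓡 7) x).symm ⁻¹' (extChartAt (𝓡 7) p).source

theorem isOpen_tauDom (x p : M) : IsOpen (tauDom x p) :=
  (continuousOn_extChartAt_symm x).isOpen_inter_preimage (isOpen_extChartAt_target x)
    (isOpen_extChartAt_source p)

theorem mem_tauDom_self {x : M} {y : E7} (hy : y ∈ (extChartAt (𝓡 7) x).target) :
    y ∈ tauDom x (pt x y) := ⟨hy, mem_extChartAt_source (pt x y)⟩

theorem base_mem (x : M) : base x ∈ (extChartAt (𝓡 7) x).target := mem_extChartAt_target x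

theorem tau_mem {x p : M} {z : E7} (hz : z ∈ tauDom x p) :
    tau x p z ∈ (extChartAt (𝓡 7) p).target := (extChartAt (𝓡 7) p).map_source hz.2

theorem pt_tau {x p : M} {z : E7} (hz : z ∈ tauDom x p) : pt p (tau x p z) = pt x z :=
  (extChartAt (𝓡 7) p).left_inv hz.2

theorem tau_mem_dom {x p q : M} {z : E7} (hz : z ∈ tauDom x p) (hq : z ∈ tauDom x q) :
    tau x p z ∈ tauDom p q := by
  refine ⟨tau_mem hz, ?_⟩
  have := pt_tau hz
  rw [pt] at this
  rw [Set.mem_preimage, this]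
  exact hq.2

theorem tau_self {x : M} {z : E7} (hz : z ∈ (extChartAt (𝓡 7) x).target) : tau x x z = z :=
  (extChartAt (𝓡 7) x).right_inv hz

theorem tau_tau {x p q : M} {z : E7} (hz : z ∈ tauDom x p) :
    tau p q (tau x p z) = tau x q z := by
  have := pt_tau hz
  rw [pt] at this
  rw [tau, Function.comp_apply, this]
  rfl

theorem mem_tauDom_same {x : M} {y : E7} (hy : y ∈ (extChartAt (𝓡 7) x).target) :
    y ∈ tauDom x x := ⟨hy, (extChartAt (𝓡 7) x).map_target hy⟩

/-- The derivative of the inverse of a chart as an endomorphism of `ℝ⁷`. -/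
noncomputable def frameE (x : M) (y : E7) : E7 →L[ℝ] E7 := frame x y

theorem fderiv_tau_self {x : M} {z : E7} (hz : z ∈ (extChartAt (𝓡 7) x).target) :
    fderiv ℝ (tau x x) z = ContinuousLinearMap.id ℝ E7 := by
  have : tau x x =ᶠ[nhds z] id := Filter.eventually_of_mem
    ((isOpen_extChartAt_target x).mem_nhds hz) fun w hw => tau_self hw
  rw [this.fderiv_eq, fderiv_id]

section Form

variable {k : ℕ} {K : Type*} [NormedAddCommGroup K] [NormedSpace ℝ K]

theorem Form.apply_congr (A : Form M k K) {p q : M} (h : p = q) (v : Fin k → E7) :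
    A p v = A q v := by
  subst h
  rfl

theorem Form.inChart_apply (A : Form M k K) (x : M) (y : E7) (v : Fin k → E7) :
    A.inChart x y v = A (pt x y) (fun i => frame x y (v i)) := rfl

theorem Form.IsSmooth.differentiableAt {A : Form M k K} (hA : A.IsSmooth) {x : M} {y : E7}
    (hy : y ∈ (extChartAt (𝓡 7) x).target) : DifferentiableAt ℝ (A.inChart x) y :=
  ((hA x).contDiffAt ((isOpen_extChartAt_target x).mem_nhds hy)).differentiableAt (by simp)

end Form

variable [IsManifold (𝓡 7) ∞ M]

theorem contDiffOn_tau (x p : M) : ContDiffOn ℝ ∞ (tau x p) (tauDom x p) := by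
  have := contDiffOn_ext_coord_change (I := 𝓡 7) (n := ∞) p x
  refine this.mono fun z hz => ?_
  rw [PartialEquiv.trans_source]
  exact hz

theorem contDiffAt_tau {x p : M} {z : E7} (hz : z ∈ tauDom x p) : ContDiffAt ℝ ∞ (tau x p) z :=
  (contDiffOn_tau x p).contDiffAt ((isOpen_tauDom x p).mem_nhds hz)

theorem differentiableAt_tau {x p : M} {z : E7} (hz : z ∈ tauDom x p) :
    DifferentiableAt ℝ (tau x p) z := (contDiffAt_tau hz).differentiableAt (by simp)

theorem fderiv_tau_comp {x p q : M} {z : E7} (hz : z ∈ tauDom x p) (hq : z ∈ tauDom x q) :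
    (fderiv ℝ (tau p q) (tau x p z)).comp (fderiv ℝ (tau x p) z) = fderiv ℝ (tau x q) z := by
  rw [← fderiv_comp z (differentiableAt_tau (tau_mem_dom hz hq)) (differentiableAt_tau hz)]
  refine Filter.EventuallyEq.fderiv_eq (Filter.eventually_of_mem
    ((isOpen_tauDom x p).mem_nhds hz) fun w hw => tau_tau hw)

/-- A tangent space is identified with ℝ⁷ through the preferred chart at its own point, so the
derivative of an inverse chart is that of a transition map. -/
theorem frameE_eq {x : M} {y : E7} (hy : y ∈ (extChartAt (𝓡 7) x).target) :
    frameE x y = fderiv ℝ (tau x (pt x y)) y := by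
  have h : MDifferentiableAt (𝓡 7) (𝓡 7) (extChartAt (𝓡 7) x).symm y :=
    ((contMDiffOn_extChartAt_symm (n := ∞) x).contMDiffAt
      ((isOpen_extChartAt_target x).mem_nhds hy)).mdifferentiableAt (by simp)
  have h1 : frameE x y = fderivWithin ℝ (writtenInExtChartAt (𝓡 7) (𝓡 7) y
      (extChartAt (𝓡 7) x).symm) (Set.range (𝓡 7)) (extChartAt (𝓡 7) y y) := if_pos h
  have h2 : (Set.range (𝓡 7)) = Set.univ := ModelWithCorners.Boundaryless.range_eq_univ
  rw [h1, h2, fderivWithin_univ]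
  rfl

theorem frameE_eq_of_pt {x q : M} {y : E7} (hy : y ∈ (extChartAt (𝓡 7) x).target)
    (hq : pt x y = q) : frameE x y = fderiv ℝ (tau x q) y := by
  subst hq
  exact frameE_eq hy

/-- The frame as a linear equivalence. -/
theorem exists_frame_equiv {x : M} {y : E7} (hy : y ∈ (extChartAt (𝓡 7) x).target) :
    ∃ F : E7 ≃L[ℝ] E7, (F : E7 →L[ℝ] E7) = frameE x y := by
  have h1 := mem_tauDom_self hy
  have h2 := mem_tauDom_same hy
  have e1 := fderiv_tau_comp h1 h2
  have e2 := fderiv_tau_comp (tau_mem_dom h1 h2) (tau_mem_dom h1 h1)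
  rw [fderiv_tau_self hy] at e1
  rw [tau_tau h1, tau_self hy, fderiv_tau_self (tau_mem h1)] at e2
  refine ⟨ContinuousLinearEquiv.equivOfInverse (fderiv ℝ (tau x (pt x y)) y)
    (fderiv ℝ (tau (pt x y) x) (tau x (pt x y) y)) (fun v => ?_) (fun v => ?_), ?_⟩
  · exact congrArg (fun F => F v) e1
  · exact congrArg (fun F => F v) e2
  · exact (frameE_eq hy).symm

theorem frame_coframe {x : M} {y : E7} (hy : y ∈ (extChartAt (𝓡 7) x).target)
    (v : TangentSpace (𝓡 7) (pt x y)) : frame x y (coframe x y v) = v := by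
  obtain ⟨F, hF⟩ := exists_frame_equiv hy
  have h1 : frameE x y (ContinuousLinearMap.inverse (frameE x y) v) = (v : E7) := by
    rw [← hF, ContinuousLinearMap.inverse_equiv]
    exact F.apply_symm_apply v
  exact h1

theorem frame_injective {x : M} {y : E7} (hy : y ∈ (extChartAt (𝓡 7) x).target) :
    Function.Injective (frameE x y) := by
  obtain ⟨F, hF⟩ := exists_frame_equiv hy
  rw [← hF]
  exact F.injective

theorem frameE_tau {x p : M} {z : E7} (hz : z ∈ tauDom x p) :
    (frameE p (tau x p z)).comp (fderiv ℝ (tau x p) z) = frameE x z := by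
  rw [frameE_eq_of_pt (tau_mem hz) (pt_tau hz), frameE_eq hz.1,
    fderiv_tau_comp hz (mem_tauDom_self hz.1)]

section Form

variable {k : ℕ} {K : Type*} [NormedAddCommGroup K] [NormedSpace ℝ K]

theorem Form.inChart_tau (A : Form M k K) {x p : M} {z : E7} (hz : z ∈ tauDom x p) :
    A.inChart x z = (A.inChart p (tau x p z)).compContinuousLinearMap (fderiv ℝ (tau x p) z) := by
  ext v
  rw [ContinuousAlternatingMap.compContinuousLinearMap_apply, Form.inChart_apply,
    Form.inChart_apply]
  refine Eq.trans ?_ (Form.apply_congr A (pt_tau hz).symm _)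
  congr 1
  funext i
  exact congrArg (fun F : E7 →L[ℝ] E7 => F (v i)) (frameE_tau hz).symm

/-- The exterior derivative commutes with taking coordinate expressions. -/
theorem Form.IsSmooth.inChart_d {A : Form M k K} (hA : A.IsSmooth) {x : M} {y : E7}
    (hy : y ∈ (extChartAt (𝓡 7) x).target) : (Form.d A).inChart x y = extDeriv (A.inChart x) y := by
  have hz := mem_tauDom_self hy
  have hb : tau x (pt x y) y = base (pt x y) := rfl
  have h1 : A.inChart x =ᶠ[nhds y] fun z => (A.inChart (pt x y) (tau x (pt x y) z)).compContinuousLinearMap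
      (fderiv ℝ (tau x (pt x y)) z) :=
    Filter.eventually_of_mem ((isOpen_tauDom x _).mem_nhds hz) fun z hz => Form.inChart_tau A hz
  -- The exterior derivative at a point is taken in the chart at that point; naturality under
  -- pullback by the transition map brings it to the chart at x.
  rw [h1.extDeriv_eq, extDeriv_pullback (hA.differentiableAt (tau_mem hz)) (contDiffAt_tau hz)
    (by simp; exact ENat.LEInfty.out), hb, ← frameE_eq hy]
  rfl

end Form

section Fields

theorem frame_fieldInChart (ξ : ∀ x : M, TangentSpace (𝓡 7) x) {x : M} {y : E7}
    (hy : y ∈ (extChartAt (𝓡 7) x).target) : frame x y (fieldInChart ξ x y) = ξ (pt x y) :=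
  frame_coframe hy _

theorem frame_endoInChart (Φ : ∀ x : M, TangentSpace (𝓡 7) x →L[ℝ] TangentSpace (𝓡 7) x)
    {x : M} {y : E7} (hy : y ∈ (extChartAt (𝓡 7) x).target) (X : E7) :
    frame x y (endoInChart Φ x y X) = Φ (pt x y) (frame x y X) :=
  frame_coframe hy _

theorem fderiv_tau_endoInChart (Φ : ∀ x : M, TangentSpace (𝓡 7) x →L[ℝ] TangentSpace (𝓡 7) x)
    {x p : M} {z : E7} (hz : z ∈ tauDom x p) (X : E7) :
    fderiv ℝ (tau x p) z (endoInChart Φ x z X)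
      = endoInChart Φ p (tau x p z) (fderiv ℝ (tau x p) z X) := by
  refine frame_injective (tau_mem hz) ?_
  have e : ∀ v : E7, frameE p (tau x p z) (fderiv ℝ (tau x p) z v) = frameE x z v := fun v =>
    congrArg (fun F : E7 →L[ℝ] E7 => F v) (frameE_tau hz)
  have c : ∀ {p q : M} (_ : p = q) (v : E7), (Φ p v : E7) = Φ q v := by
    rintro p _ rfl v
    rfl
  refine (e _).trans ((frame_endoInChart Φ hz.1 X).trans
    (Eq.trans ?_ (frame_endoInChart Φ (tau_mem hz) _).symm))
  exact (c (pt_tau hz).symm _).trans (congrArg (Φ (pt p (tau x p z))) (e X).symm)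

theorem fderiv_tau_fieldInChart (ξ : ∀ x : M, TangentSpace (𝓡 7) x) {x p : M} {z : E7}
    (hz : z ∈ tauDom x p) :
    fderiv ℝ (tau x p) z (fieldInChart ξ x z) = fieldInChart ξ p (tau x p z) := by
  refine frame_injective (tau_mem hz) ?_
  have c : ∀ {p q : M} (_ : p = q), (ξ p : E7) = ξ q := by
    rintro p _ rfl
    rfl
  refine (congrArg (fun F : E7 →L[ℝ] E7 => F (fieldInChart ξ x z)) (frameE_tau hz)).trans ?_
  exact (frame_fieldInChart ξ hz.1).trans ((c (pt_tau hz).symm).trans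
    (frame_fieldInChart ξ (tau_mem hz)).symm)

end Fields

end Charts

/-- The Nijenhuis tensor is natural. -/
theorem nijenhuis_map {Φ Φ' : E7 → E7 →L[ℝ] E7} {τ : E7 → E7} {y : E7} (hτ : ContDiffAt ℝ ∞ τ y)
    (hΦ : DifferentiableAt ℝ Φ y) (hΦ' : DifferentiableAt ℝ Φ' (τ y))
    (h : ∀ᶠ z in nhds y, ∀ X, fderiv ℝ τ z (Φ z X) = Φ' (τ z) (fderiv ℝ τ z X)) (X Y : E7) :
    fderiv ℝ τ y (fderiv ℝ Φ y (Φ y X) Y - fderiv ℝ Φ y (Φ y Y) X - Φ y (fderiv ℝ Φ y X Y)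
      + Φ y (fderiv ℝ Φ y Y X))
    = fderiv ℝ Φ' (τ y) (Φ' (τ y) (fderiv ℝ τ y X)) (fderiv ℝ τ y Y)
      - fderiv ℝ Φ' (τ y) (Φ' (τ y) (fderiv ℝ τ y Y)) (fderiv ℝ τ y X)
      - Φ' (τ y) (fderiv ℝ Φ' (τ y) (fderiv ℝ τ y X) (fderiv ℝ τ y Y))
      + Φ' (τ y) (fderiv ℝ Φ' (τ y) (fderiv ℝ τ y Y) (fderiv ℝ τ y X)) := by
  have hs : IsSymmSndFDerivAt ℝ τ y := hτ.isSymmSndFDerivAt (by simp; exact ENat.LEInfty.out)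
  have hd : DifferentiableAt ℝ (fderiv ℝ τ) y :=
    (hτ.fderiv_right (m := ∞) (by simp)).differentiableAt (by simp)
  have hτd : DifferentiableAt ℝ τ y := hτ.differentiableAt (by simp)
  have h0 := h.self_of_nhds
  have h1 : ∀ V X, fderiv ℝ τ y (fderiv ℝ Φ y V X) = fderiv ℝ Φ' (τ y) (fderiv ℝ τ y V)
      (fderiv ℝ τ y X) + Φ' (τ y) (fderiv ℝ (fderiv ℝ τ) y V X)
      - fderiv ℝ (fderiv ℝ τ) y V (Φ y X) := by
    intro V X
    have e : (fun z => fderiv ℝ τ z (Φ z X)) =ᶠ[nhds y] fun z => Φ' (τ z) (fderiv ℝ τ z X) :=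
      h.mono fun z hz => hz X
    have e2 := congrArg (fun F => F V) (e.fderiv_eq (𝕜 := ℝ))
    rw [fderiv_clm_apply_apply hd (hΦ.clm_apply (differentiableAt_const X)),
      fderiv_clm_apply_const hΦ,
      fderiv_clm_apply_apply (c := fun z => Φ' (τ z)) (hΦ'.comp y hτd)
        (hd.clm_apply (differentiableAt_const X)),
      fderiv_clm_apply_const hd] at e2
    have e3 : fderiv ℝ (fun z => Φ' (τ z)) y V = fderiv ℝ Φ' (τ y) (fderiv ℝ τ y V) := by
      rw [show (fun z => Φ' (τ z)) = Φ' ∘ τ from rfl, fderiv_comp y hΦ' hτd]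
      rfl
    rw [e3] at e2
    rw [eq_sub_iff_add_eq, ← e2]
    abel
  simp only [map_add, map_sub, h0, h1]
  -- The second derivatives of the coordinate change cancel in pairs by symmetry.
  rw [hs (Φ y X) Y, hs (Φ y Y) X, hs Y X, hs Y (Φ y X), hs X (Φ y Y)]
  have h3 := hs (Φ y X) (Φ y Y)
  rw [h3]
  abel

theorem nijenhuis_eq {Φ : E7 → E7 →L[ℝ] E7} {y : E7} (hΦ : DifferentiableAt ℝ Φ y) (X Y : E7) :
    nijenhuis Φ y X Y = fderiv ℝ Φ y (Φ y X) Y - fderiv ℝ Φ y (Φ y Y) X - Φ y (fderiv ℝ Φ y X Y)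
      + Φ y (fderiv ℝ Φ y Y X) := by
  simp only [nijenhuis, VectorField.lieBracket, fderiv_clm_apply_const hΦ, fderiv_fun_const,
    Pi.zero_apply, zero_apply, map_sub, map_zero]
  abel

end G2Flow

/-! ### From a contact Calabi-Yau manifold to its coordinate structures. -/

namespace G2Flow

section Curry

variable (K : Type*) [NormedAddCommGroup K] [NormedSpace ℝ K]

/-- Currying of 1-forms. -/
noncomputable def curry1 : (E7 [⋀^Fin 1]→L[ℝ] K) →L[ℝ] (E7 →L[ℝ] K) :=
  (ContinuousLinearMap.compL ℝ E7 (E7 [⋀^Fin 0]→L[ℝ] K) K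
    (ContinuousAlternatingMap.apply ℝ E7 K ![])).comp
    (ContinuousAlternatingMap.curryLeftLI (𝕜 := ℝ) (E := E7) (F := K)
      (n := 0)).toContinuousLinearMap

/-- Currying of 2-forms. -/
noncomputable def curry2 : (E7 [⋀^Fin 2]→L[ℝ] K) →L[ℝ] (E7 →L[ℝ] E7 →L[ℝ] K) :=
  (ContinuousLinearMap.compL ℝ E7 (E7 [⋀^Fin 1]→L[ℝ] K) (E7 →L[ℝ] K) (curry1 K)).comp
    (ContinuousAlternatingMap.curryLeftLI (𝕜 := ℝ) (E := E7) (F := K)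
      (n := 1)).toContinuousLinearMap

/-- Currying of 3-forms. -/
noncomputable def curry3 : (E7 [⋀^Fin 3]→L[ℝ] K) →L[ℝ] (E7 →L[ℝ] E7 →L[ℝ] E7 →L[ℝ] K) :=
  (ContinuousLinearMap.compL ℝ E7 (E7 [⋀^Fin 2]→L[ℝ] K) (E7 →L[ℝ] E7 →L[ℝ] K) (curry2 K)).comp
    (ContinuousAlternatingMap.curryLeftLI (𝕜 := ℝ) (E := E7) (F := K)
      (n := 2)).toContinuousLinearMap

variable {K}

theorem curry1_apply (A : E7 [⋀^Fin 1]→L[ℝ] K) (X : E7) : curry1 K A X = A ![X] := rfl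

theorem curry3_apply (A : E7 [⋀^Fin 3]→L[ℝ] K) (X Y Z : E7) :
    curry3 K A X Y Z = A ![X, Y, Z] := rfl

theorem curry3_swap₁ (A : E7 [⋀^Fin 3]→L[ℝ] K) (X Y Z : E7) :
    curry3 K A X Y Z = - curry3 K A Y X Z := by
  have h := A.toAlternatingMap.map_swap ![X, Y, Z] (i := 0) (j := 1) (by decide)
  have e : (![X, Y, Z] : Fin 3 → E7) ∘ Equiv.swap 0 1 = ![Y, X, Z] := by
    funext i
    fin_cases i <;> rfl
  rw [e] at h
  exact neg_eq_iff_eq_neg.mp h.symm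

theorem curry3_swap₂ (A : E7 [⋀^Fin 3]→L[ℝ] K) (X Y Z : E7) :
    curry3 K A X Y Z = - curry3 K A X Z Y := by
  have h := A.toAlternatingMap.map_swap ![X, Y, Z] (i := 1) (j := 2) (by decide)
  have e : (![X, Y, Z] : Fin 3 → E7) ∘ Equiv.swap 1 2 = ![X, Z, Y] := by
    funext i
    fin_cases i <;> rfl
  rw [e] at h
  exact neg_eq_iff_eq_neg.mp h.symm

theorem fderiv_curry1 {A : E7 → E7 [⋀^Fin 1]→L[ℝ] K} {y : E7} (hA : DifferentiableAt ℝ A y)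
    (X Y : E7) : fderiv ℝ (fun z => curry1 K (A z)) y X Y = fderiv ℝ (fun z => A z ![Y]) y X := by
  have h1 : DifferentiableAt ℝ (fun z => curry1 K (A z)) y :=
    (curry1 K).differentiableAt.comp y hA
  rw [← fderiv_clm_apply_const h1]
  rfl

theorem fderiv_curry3 {A : E7 → E7 [⋀^Fin 3]→L[ℝ] K} {y : E7} (hA : DifferentiableAt ℝ A y)
    (X Y Z W : E7) : fderiv ℝ (fun z => curry3 K (A z)) y X Y Z W
      = fderiv ℝ (fun z => A z ![Y, Z, W]) y X := by
  have h1 : DifferentiableAt ℝ (fun z => curry3 K (A z)) y :=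
    (curry3 K).differentiableAt.comp y hA
  have h2 := h1.clm_apply (differentiableAt_const Y)
  rw [← fderiv_clm_apply_const h1, ← fderiv_clm_apply_const h2,
    ← fderiv_clm_apply_const (h2.clm_apply (differentiableAt_const Z))]
  rfl

theorem extDeriv_one {A : E7 → E7 [⋀^Fin 1]→L[ℝ] K} {y : E7} (hA : DifferentiableAt ℝ A y)
    (X Y : E7) : extDeriv A y ![X, Y] = fderiv ℝ (fun z => curry1 K (A z)) y X Y
      - fderiv ℝ (fun z => curry1 K (A z)) y Y X := by
  rw [extDeriv_apply hA, Fin.sum_univ_two, fderiv_curry1 hA, fderiv_curry1 hA]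
  have e0 : (0 : Fin 2).removeNth ![X, Y] = ![Y] := by
    funext i
    fin_cases i
    rfl
  have e1 : (1 : Fin 2).removeNth ![X, Y] = ![X] := by
    funext i
    fin_cases i
    rfl
  rw [e0, e1]
  simp [sub_eq_add_neg]

theorem extDeriv_three {A : E7 → E7 [⋀^Fin 3]→L[ℝ] K} {y : E7} (hA : DifferentiableAt ℝ A y)
    (X Y Z W : E7) : extDeriv A y ![X, Y, Z, W] = fderiv ℝ (fun z => curry3 K (A z)) y X Y Z W
      - fderiv ℝ (fun z => curry3 K (A z)) y Y X Z W
      + fderiv ℝ (fun z => curry3 K (A z)) y Z X Y W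
      - fderiv ℝ (fun z => curry3 K (A z)) y W X Y Z := by
  rw [extDeriv_apply hA, Fin.sum_univ_four]
  simp only [fderiv_curry3 hA]
  have e0 : (0 : Fin 4).removeNth ![X, Y, Z, W] = ![Y, Z, W] := by
    funext i
    fin_cases i <;> rfl
  have e1 : (1 : Fin 4).removeNth ![X, Y, Z, W] = ![X, Z, W] := by
    funext i
    fin_cases i <;> rfl
  have e2 : (2 : Fin 4).removeNth ![X, Y, Z, W] = ![X, Y, W] := by
    funext i
    fin_cases i <;> rfl
  have e3 : (3 : Fin 4).removeNth ![X, Y, Z, W] = ![X, Y, Z] := by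
    funext i
    fin_cases i <;> rfl
  rw [e0, e1, e2, e3]
  simp [pow_succ]
  abel

theorem wedge_one_two (α : E7 [⋀^Fin 1]→L[ℝ] ℝ) (β : E7 [⋀^Fin 2]→L[ℝ] ℝ) (v : Fin 3 → E7) :
    (wedge α β : Alt 3) v = α ![v 0] * β ![v 1, v 2] - α ![v 1] * β ![v 0, v 2]
        + α ![v 2] * β ![v 0, v 1] := by
  have h := factorial_smul_wedge α β v
  rw [sum_perm_eq_sum_eps (n := 3) (fun i => α (fun a => v (i (Fin.castAdd 2 a)))
    * β (fun a => v (i (Fin.natAdd 1 a))))] at h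
  simp only [sum_fin_succ_fun, sum_fin_zero_fun, Fin.sum_univ_three] at h
  have hα : ∀ a b c : Fin 3, (fun x => v ((![a, b, c] : Fin 3 → Fin 3) (Fin.castAdd 2 x)))
      = ![v a] := by
    intro a b c
    funext i
    fin_cases i
    rfl
  have hβ : ∀ a b c : Fin 3, (fun x => v ((![a, b, c] : Fin 3 → Fin 3) (Fin.natAdd 1 x)))
      = ![v b, v c] := by
    intro a b c
    funext i
    fin_cases i <;> rfl
  have hs : ∀ X Y, β ![X, Y] = - β ![Y, X] := by
    intro X Y
    have h := β.toAlternatingMap.map_swap ![X, Y] (i := 0) (j := 1) (by decide)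
    have e : (![X, Y] : Fin 2 → E7) ∘ Equiv.swap 0 1 = ![Y, X] := by
      funext i
      fin_cases i <;> rfl
    rw [e] at h
    exact neg_eq_iff_eq_neg.mp h.symm
  simp only [hα, hβ] at h
  have e1 : eps (![0, 1, 2] : Fin 3 → Fin 3) = 1 := by decide
  have e2 : eps (![0, 2, 1] : Fin 3 → Fin 3) = -1 := by decide
  have e3 : eps (![1, 0, 2] : Fin 3 → Fin 3) = -1 := by decide
  have e4 : eps (![1, 2, 0] : Fin 3 → Fin 3) = 1 := by decide
  have e5 : eps (![2, 0, 1] : Fin 3 → Fin 3) = 1 := by decide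
  have e6 : eps (![2, 1, 0] : Fin 3 → Fin 3) = -1 := by decide
  have e0 : ∀ a b c : Fin 3, a = b ∨ b = c ∨ a = c → eps ![a, b, c] = 0 := by decide
  simp only [e1, e2, e3, e4, e5, e6, e0 _ _ _ (Or.inl rfl), e0 _ _ _ (Or.inr (Or.inl rfl)),
    e0 _ _ _ (Or.inr (Or.inr rfl)), hs (v 1) (v 0), hs (v 2) (v 0), hs (v 2) (v 1)] at h
  norm_num [Nat.factorial] at h
  linarith

end Curry

namespace ContactCalabiYau

variable {M : Type*} [TopologicalSpace M] [ChartedSpace E7 M] [IsManifold (𝓡 7) ∞ M]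
variable (S : ContactCalabiYau M)

/-- The metric at a point. -/
noncomputable def gAt (p : M) : E7 →L[ℝ] E7 →L[ℝ] ℝ := S.g.inner p

/-- The contact form at a point. -/
noncomputable def ηAt (p : M) : E7 →L[ℝ] ℝ := curry1 ℝ (S.η p)

/-- The Reeb field at a point. -/
def ξAt (p : M) : E7 := S.ξ p

/-- The endomorphism `Φ` at a point. -/
def ΦAt (p : M) : E7 →L[ℝ] E7 := S.Φ p

/-- The transverse holomorphic volume form at a point. -/
noncomputable def ΥAt (p : M) : E7 →L[ℝ] E7 →L[ℝ] E7 →L[ℝ] ℂ := curry3 ℂ (S.Υ p)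

theorem contactAt (p : M) : IsAlmostContact (S.gAt p) (S.ηAt p) (S.ξAt p) (S.ΦAt p) where
  symm := S.g.symm p
  pos := S.g.pos p
  η_ξ := S.η_ξ p
  Φ_sq := S.Φ_sq p
  g_Φ := S.g_Φ p

theorem typeThreeZeroAt (p : M) : IsTypeThreeZero (S.ΦAt p) (S.ΥAt p) where
  swap₁ := curry3_swap₁ (S.Υ p)
  swap₂ := curry3_swap₂ (S.Υ p)
  type := S.Υ_type p

/-- The transverse holomorphic volume form at a point as an alternating form on `ℝ⁷`. -/
def ΥForm (p : M) : E7 [⋀^Fin 3]→L[ℝ] ℂ := S.Υ p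

/-- The transverse Kähler form at a point as an alternating form on `ℝ⁷`. -/
noncomputable def omForm (p : M) : E7 [⋀^Fin 2]→L[ℝ] ℝ := Form.d S.η p

/-- The contact form at a point as an alternating form on `ℝ⁷`. -/
def ηForm (p : M) : E7 [⋀^Fin 1]→L[ℝ] ℝ := S.η p

set_option maxRecDepth 20000 in
theorem ansatz_apply (A B : ℝ) (p : M) (v : Fin 3 → E7) : S.ansatz A B p v
    = A * (wedge (S.ηForm p) (S.omForm p) : Alt 3) v + B * (S.ΥForm p v).re := rfl

set_option maxRecDepth 20000 in
theorem wedge_ΥForm (p : M) (v : Fin 6 → E7) :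
    wedge (S.ΥForm p) ((Complex.conjCLE : ℂ →L[ℝ] ℂ).compContinuousAlternatingMap (S.ΥForm p)) v
      = -(4 * Complex.I / 3) * (wedge (wedge (S.omForm p) (S.omForm p)) (S.omForm p) v : ℝ) :=
  S.Υ_wedge p v

theorem norm_ΥAt (p : M) (u : Fin 3 → E7) (hu : IsUnitary (S.gAt p) (S.ηAt p) (S.ΦAt p) u) :
    ‖S.ΥAt p (u 0) (u 1) (u 2)‖ = 1 :=
  hu.norm_eq_one (S.contactAt p) (S.typeThreeZeroAt p) (Υ := S.ΥForm p) (om := S.omForm p)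
    (fun _ _ _ => rfl) (S.dη_eq p) (S.wedge_ΥForm p)

end ContactCalabiYau

section Pullback

variable {g : E7 →L[ℝ] E7 →L[ℝ] ℝ} {η η' : E7 →L[ℝ] ℝ} {ξ ξ' : E7} {Φ Φ' : E7 →L[ℝ] E7}
variable {F : E7 →L[ℝ] E7}

theorem IsAlmostContact.pullback (h : IsAlmostContact g η ξ Φ) (hF : Function.Injective F)
    (hη : ∀ X, η' X = η (F X)) (hξ : F ξ' = ξ) (hΦ : ∀ X, F (Φ' X) = Φ (F X)) :
    IsAlmostContact (g.bilinearComp F F) η' ξ' Φ' where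
  symm X Y := h.symm _ _
  pos X hX := h.pos _ fun h0 => hX (hF (h0.trans (map_zero F).symm))
  η_ξ := by rw [hη, hξ, h.η_ξ]
  Φ_sq X := hF (by rw [hΦ, hΦ, h.Φ_sq, map_add, map_neg, map_smul, hξ, hη])
  g_Φ X Y := by
    rw [ContinuousLinearMap.bilinearComp_apply, hΦ, hΦ, h.g_Φ, hη, hη,
      ContinuousLinearMap.bilinearComp_apply]

theorem IsUnitary.map {u : Fin 3 → E7} (hu : IsUnitary (g.bilinearComp F F) η' Φ' u)
    (hη : ∀ X, η' X = η (F X)) (hΦ : ∀ X, F (Φ' X) = Φ (F X)) :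
    IsUnitary g η Φ (fun a => F (u a)) where
  η_u a := by rw [← hη, hu.η_u]
  g_u a b := hu.g_u a b
  g_Φu a b := by
    rw [← hΦ]
    exact hu.g_Φu a b

end Pullback

namespace ContactCalabiYau

variable {M : Type*} [TopologicalSpace M] [ChartedSpace E7 M] [IsManifold (𝓡 7) ∞ M]
variable (S : ContactCalabiYau M) (x : M)

/-- The coordinate expression of the metric. -/
noncomputable def gChart (y : E7) : E7 →L[ℝ] E7 →L[ℝ] ℝ :=
  (S.gAt (pt x y)).bilinearComp (frameE x y) (frameE x y)

/-- The coordinate expression of the contact form. -/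
noncomputable def ηChart (y : E7) : E7 →L[ℝ] ℝ := curry1 ℝ (S.η.inChart x y)

/-- The coordinate expression of the transverse holomorphic volume form. -/
noncomputable def ΥChart (y : E7) : E7 →L[ℝ] E7 →L[ℝ] E7 →L[ℝ] ℂ := curry3 ℂ (S.Υ.inChart x y)

theorem ηChart_apply (y X : E7) : S.ηChart x y X = S.ηAt (pt x y) (frameE x y X) := by
  rw [ηChart, curry1_apply, Form.inChart_apply]
  change _ = S.η (pt x y) _
  congr 1
  funext i
  fin_cases i
  rfl

theorem ΥChart_apply (y X Y Z : E7) : S.ΥChart x y X Y Z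
    = S.ΥAt (pt x y) (frameE x y X) (frameE x y Y) (frameE x y Z) := by
  rw [ΥChart, curry3_apply, Form.inChart_apply]
  change _ = S.Υ (pt x y) _
  congr 1
  funext i
  fin_cases i <;> rfl

section Target

variable {x} {y : E7} (hy : y ∈ (extChartAt (𝓡 7) x).target)

include hy

theorem contactChart : IsAlmostContact (S.gChart x y) (S.ηChart x y) (fieldInChart S.ξ x y)
    (endoInChart S.Φ x y) :=
  (S.contactAt (pt x y)).pullback (frame_injective hy) (S.ηChart_apply x y)
    (frame_fieldInChart S.ξ hy) (frame_endoInChart S.Φ hy)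

theorem typeThreeZeroChart : IsTypeThreeZero (endoInChart S.Φ x y) (S.ΥChart x y) where
  swap₁ X Y Z := by
    rw [ΥChart_apply, ΥChart_apply, (S.typeThreeZeroAt _).swap₁]
  swap₂ X Y Z := by
    rw [ΥChart_apply, ΥChart_apply, (S.typeThreeZeroAt _).swap₂]
  type X Y Z := by
    rw [ΥChart_apply, ΥChart_apply, ← (S.typeThreeZeroAt _).type]
    exact congrArg (fun v => S.ΥAt (pt x y) v (frameE x y Y) (frameE x y Z))
      (frame_endoInChart S.Φ hy X)

theorem dη_inChart (X Y : E7) : (Form.d S.η).inChart x y ![X, Y]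
    = S.gChart x y (endoInChart S.Φ x y X) Y := by
  rw [Form.inChart_apply]
  have h1 := S.dη_eq (pt x y) (frame x y X) (frame x y Y)
  have e : (fun i => frame x y (![X, Y] i)) = ![frame x y X, frame x y Y] := by
    funext i
    fin_cases i <;> rfl
  refine (congrArg (Form.d S.η (pt x y)) e).trans (h1.trans ?_)
  exact congrArg (fun v => S.gAt (pt x y) v (frameE x y Y)) (frame_endoInChart S.Φ hy X).symm

theorem dηChart (X Y : E7) : fderiv ℝ (S.ηChart x) y X Y - fderiv ℝ (S.ηChart x) y Y X
    = S.gChart x y (endoInChart S.Φ x y X) Y := by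
  rw [← S.dη_inChart hy, S.smooth_η.inChart_d hy, extDeriv_one (S.smooth_η.differentiableAt hy)]
  rfl

theorem dΥChart (A B C D : E7) : fderiv ℝ (S.ΥChart x) y A B C D - fderiv ℝ (S.ΥChart x) y B A C D
    + fderiv ℝ (S.ΥChart x) y C A B D - fderiv ℝ (S.ΥChart x) y D A B C = 0 := by
  have h1 := extDeriv_three (S.smooth_Υ.differentiableAt hy) A B C D
  refine h1.symm.trans ?_
  rw [← S.smooth_Υ.inChart_d hy, Form.inChart_apply, S.Υ_closed]
  rfl

theorem differentiableAt_ΦChart : DifferentiableAt ℝ (endoInChart S.Φ x) y :=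
  ((S.smooth_Φ x).contDiffAt ((isOpen_extChartAt_target x).mem_nhds hy)).differentiableAt (by simp)

/-- Normality is imposed at each point in that point's preferred chart; naturality of the Nijenhuis
tensor carries it to all points of a fixed chart. -/
theorem normalChart (X Y : E7) :
    fderiv ℝ (endoInChart S.Φ x) y (endoInChart S.Φ x y X) Y
      - fderiv ℝ (endoInChart S.Φ x) y (endoInChart S.Φ x y Y) X
      - endoInChart S.Φ x y (fderiv ℝ (endoInChart S.Φ x) y X Y)
      + endoInChart S.Φ x y (fderiv ℝ (endoInChart S.Φ x) y Y X)
      + S.gChart x y (endoInChart S.Φ x y X) Y • fieldInChart S.ξ x y = 0 := by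
  have hz := mem_tauDom_self hy
  have hb : tau x (pt x y) y = base (pt x y) := rfl
  have h1 := nijenhuis_map (contDiffAt_tau hz) (S.differentiableAt_ΦChart hy)
    (S.differentiableAt_ΦChart (tau_mem hz))
    (Filter.eventually_of_mem ((isOpen_tauDom x _).mem_nhds hz)
      fun z hz => fderiv_tau_endoInChart S.Φ hz) X Y
  have h2 := S.normal (pt x y) (fderiv ℝ (tau x (pt x y)) y X) (fderiv ℝ (tau x (pt x y)) y Y)
  rw [hb] at h1
  rw [nijenhuis_eq (S.differentiableAt_ΦChart (base_mem _)), ← h1] at h2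
  refine frame_injective hy ?_
  rw [map_add, map_zero, map_smul, frameE_eq hy, ← S.dη_inChart hy]
  rw [← h2, fderiv_tau_fieldInChart S.ξ hz, hb, Form.inChart_tau _ hz, hb]
  have e : (fun i => fderiv ℝ (tau x (pt x y)) y (![X, Y] i))
      = ![fderiv ℝ (tau x (pt x y)) y X, fderiv ℝ (tau x (pt x y)) y Y] := by
    funext i
    fin_cases i <;> rfl
  rw [← e]
  rfl

/-- The metric is η ⊗ η + dη(·, Φ·), so its smoothness in coordinates follows from that of η and Φ.
-/
theorem gChart_eq (X Y : E7) : S.gChart x y X Y = S.ηChart x y X * S.ηChart x y Y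
    + (fderiv ℝ (S.ηChart x) y X (endoInChart S.Φ x y Y)
      - fderiv ℝ (S.ηChart x) y (endoInChart S.Φ x y Y) X) := by
  rw [S.dηChart hy, (S.contactChart hy).g_Φ]
  ring

end Target

theorem smooth_ηChart : ContDiffOn ℝ ∞ (S.ηChart x) (extChartAt (𝓡 7) x).target :=
  (curry1 ℝ).contDiff.comp_contDiffOn (S.smooth_η x)

theorem smooth_ΥChart : ContDiffOn ℝ ∞ (S.ΥChart x) (extChartAt (𝓡 7) x).target :=
  (curry3 ℂ).contDiff.comp_contDiffOn (S.smooth_Υ x)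

theorem smooth_gChart : ContDiffOn ℝ ∞ (S.gChart x) (extChartAt (𝓡 7) x).target := by
  have hη := S.smooth_ηChart x
  have hd := hη.fderiv_of_isOpen (m := ∞) (isOpen_extChartAt_target x) (by simp)
  have hΦ := S.smooth_Φ x
  refine contDiffOn_clm_apply.mpr fun X => contDiffOn_clm_apply.mpr fun Y => ?_
  have h1 := fun X : E7 => hη.clm_apply (contDiffOn_const (c := X))
  have h2 := hΦ.clm_apply (contDiffOn_const (c := Y))
  refine ContDiffOn.congr ?_ fun y hy => S.gChart_eq hy X Y
  exact ((h1 X).mul (h1 Y)).add (((hd.clm_apply contDiffOn_const).clm_apply h2).sub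
    ((hd.clm_apply h2).clm_apply contDiffOn_const))

/-- The contact Calabi-Yau structure in the preferred chart at a point. -/
noncomputable def localCCY : LocalCCY (extChartAt (𝓡 7) x).target where
  g := S.gChart x
  η := S.ηChart x
  ξ := fieldInChart S.ξ x
  Φ := endoInChart S.Φ x
  Υ := S.ΥChart x
  isOpen := isOpen_extChartAt_target x
  smooth_g := S.smooth_gChart x
  smooth_η := S.smooth_ηChart x
  smooth_ξ := S.smooth_ξ x
  smooth_Φ := S.smooth_Φ x
  smooth_Υ := S.smooth_ΥChart x
  contact _ hy := S.contactChart hy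
  dη_eq _ hy := S.dηChart hy
  normal _ hy := S.normalChart hy
  typeThreeZero _ hy := S.typeThreeZeroChart hy
  dΥ_eq _ hy := S.dΥChart hy
  norm_Υ y hy u hu := by
    rw [ΥChart_apply]
    exact S.norm_ΥAt (pt x y) (fun a => frameE x y (u a))
      (hu.map (S.ηChart_apply x y) (frame_endoInChart S.Φ hy))

theorem transverseConnection_eq : S.transverseConnection x = (S.localCCY x).transverse := rfl

/-- The 3-form of the ansatz in coordinates. -/
theorem ansatz_inChart (f h : ℝ) {y : E7} (hy : y ∈ (extChartAt (𝓡 7) x).target) (X Y Z : E7) :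
    (S.ansatz (f * h ^ 2) (h ^ 3)).inChart x y ![X, Y, Z]
      = (S.localCCY x).phiT f h y X Y Z := by
  have e : (fun i => frame x y (![X, Y, Z] i)) = ![frameE x y X, frameE x y Y, frameE x y Z] := by
    funext i
    fin_cases i <;> rfl
  have hom : ∀ V W : E7, S.omForm (pt x y) ![frameE x y V, frameE x y W]
      = (S.localCCY x).om y V W := fun V W => by
    refine (S.dη_eq (pt x y) (frameE x y V) (frameE x y W)).trans ?_
    exact congrArg (fun v => S.gAt (pt x y) v (frameE x y W)) (frame_endoInChart S.Φ hy V).symm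
  have hη : ∀ V : E7, S.ηForm (pt x y) ![frameE x y V] = (S.localCCY x).η y V :=
    fun V => (S.ηChart_apply x y V).symm
  have hΥ : S.ΥForm (pt x y) ![frameE x y X, frameE x y Y, frameE x y Z]
      = (S.localCCY x).Υ y X Y Z := (S.ΥChart_apply x y X Y Z).symm
  rw [LocalCCY.phiT_apply, Form.inChart_apply]
  refine (congrArg (S.ansatz (f * h ^ 2) (h ^ 3) (pt x y)) e).trans ?_
  rw [ansatz_apply, wedge_one_two, hΥ]
  simp only [Matrix.cons_val_zero, Matrix.cons_val_one, Matrix.cons_val, hη, hom]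
  ring

end ContactCalabiYau

end G2Flow

/-! ### Smoothness of the family, and nonzero components of the curvature. -/

namespace G2Flow

theorem curry3_injective : Function.Injective (curry3 ℝ) := by
  intro A B h
  ext v
  have e : v = ![v 0, v 1, v 2] := by
    funext i
    fin_cases i <;> rfl
  rw [e, ← curry3_apply, ← curry3_apply, h]

/-- A field of 3-forms is smooth if its components are. -/
theorem contDiffOn_of_curry3 {F : Type*} [NormedAddCommGroup F] [NormedSpace ℝ F] {s : Set F}
    {A : F → Alt 3} (hA : ContDiffOn ℝ ∞ (fun p => curry3 ℝ (A p)) s) : ContDiffOn ℝ ∞ A s := by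
  have hfin : FiniteDimensional ℝ (Alt 3) :=
    FiniteDimensional.of_injective (curry3 ℝ).toLinearMap curry3_injective
  -- Trilinear forms on ℝ⁷ make up a finite-dimensional space, so a linear left inverse of currying
  -- is automatically continuous.
  obtain ⟨P, hP⟩ := (curry3 ℝ).toLinearMap.exists_leftInverse_of_injective
    (LinearMap.ker_eq_bot.mpr curry3_injective)
  have h1 := (LinearMap.toContinuousLinearMap P).contDiff.comp_contDiffOn hA
  refine h1.congr fun p _ => ?_
  exact (LinearMap.congr_fun hP (A p)).symm

namespace LocalCCY

variable {U : Set E7} (L : LocalCCY U)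

theorem contDiffOn_phiT {I : Set ℝ} {f h : ℝ → ℝ} (hf : ContDiffOn ℝ ∞ f I)
    (hh : ContDiffOn ℝ ∞ h I) :
    ContDiffOn ℝ ∞ (fun p : ℝ × E7 => L.phiT (f p.1) (h p.1) p.2) (I ×ˢ U) := by
  have h1 : Set.MapsTo (Prod.fst : ℝ × E7 → ℝ) (I ×ˢ U) I := fun p hp => hp.1
  have h2 : Set.MapsTo (Prod.snd : ℝ × E7 → E7) (I ×ˢ U) U := fun p hp => hp.2
  have hf' := hf.comp contDiffOn_fst h1
  have hh' := hh.comp contDiffOn_fst h1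
  have hη := L.smooth_η.comp contDiffOn_snd h2
  have hom := L.smooth_om.comp contDiffOn_snd h2
  have hΥ := L.smooth_Υ.comp contDiffOn_snd h2
  refine contDiffOn_clm_apply.mpr fun X => contDiffOn_clm_apply.mpr fun Y =>
    contDiffOn_clm_apply.mpr fun Z => ?_
  have hη' := fun X : E7 => hη.clm_apply (contDiffOn_const (c := X))
  have hom' := fun X Y : E7 => (hom.clm_apply (contDiffOn_const (c := X))).clm_apply
    (contDiffOn_const (c := Y))
  have hΥ' := Complex.reCLM.contDiff.comp_contDiffOn
    (((hΥ.clm_apply (contDiffOn_const (c := X))).clm_apply (contDiffOn_const (c := Y))).clm_apply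
      (contDiffOn_const (c := Z)))
  refine ContDiffOn.congr ?_ fun p _ => L.phiT_apply _ _ p.2 X Y Z
  exact ((hf'.mul (hh'.pow 2)).mul ((((hη' X).mul (hom' Y Z)).sub ((hη' Y).mul (hom' X Z))).add
    ((hom' X Y).mul (hη' Z)))).add ((hh'.pow 3).mul hΥ')

theorem exists_frame_R_ne {y : E7} (hy : y ∈ U) {u : Fin 3 → E7}
    (hu : IsUnitary (L.g y) (L.η y) (L.Φ y) u) {X Y Z : E7} (hR : L.R y X Y Z ≠ 0) :
    ∃ i j k l, L.g y (L.R y (unitaryFrame (L.ξ y) (L.Φ y) u i)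
      (unitaryFrame (L.ξ y) (L.Φ y) u j) (unitaryFrame (L.ξ y) (L.Φ y) u k))
      (unitaryFrame (L.ξ y) (L.Φ y) u l) ≠ 0 := by
  by_contra! h0
  have hb := hu.isOrthoFrame (L.contact y hy)
  refine hR ?_
  have h1 : ∀ i j k, L.R y (unitaryFrame (L.ξ y) (L.Φ y) u i)
      (unitaryFrame (L.ξ y) (L.Φ y) u j) (unitaryFrame (L.ξ y) (L.Φ y) u k) = 0 :=
    fun i j k => hb.ext fun l => (h0 i j k l).trans (by simp)
  have h2 : ∀ i j Z, L.R y (unitaryFrame (L.ξ y) (L.Φ y) u i)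
      (unitaryFrame (L.ξ y) (L.Φ y) u j) Z = 0 := fun i j Z => by
    have h := hb.basis.ext (f₁ := (L.R y (unitaryFrame (L.ξ y) (L.Φ y) u i)
      (unitaryFrame (L.ξ y) (L.Φ y) u j)).toLinearMap) (f₂ := 0) fun k => by simpa using h1 i j k
    exact LinearMap.congr_fun h Z
  have hlin : ∀ W Z, (∀ i, L.R y (unitaryFrame (L.ξ y) (L.Φ y) u i) W Z = 0) →
      ∀ X, L.R y X W Z = 0 := fun W Z hi X => by
    have h := hb.basis.ext (f₁ := ({
      toFun := fun X => L.R y X W Z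
      map_add' := fun A B => by
        simp only [R_apply, map_add, add_apply]
        abel
      map_smul' := fun c A => by
        simp only [R_apply, map_smul, smul_apply, RingHom.id_apply, smul_add, smul_sub] } :
        E7 →ₗ[ℝ] E7)) (f₂ := 0) fun i => by simpa using hi i
    exact LinearMap.congr_fun h X
  refine hlin Y Z (fun i => ?_) X
  rw [L.R_swap, hlin _ _ (fun j => h2 j i Z), neg_zero]

end LocalCCY

theorem IsRicciLikeFlow.mono {M : Type*} [TopologicalSpace M] [ChartedSpace E7 M]
    {φ : ℝ → Form M 3 ℝ} {I J : Set ℝ} (h : IsRicciLikeFlow φ I) (hJ : J ⊆ I) :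
    IsRicciLikeFlow φ J where
  smooth x := (h.smooth x).mono (Set.prod_mono_left hJ)
  isG2Structure t ht := h.isG2Structure t (hJ ht)
  equation t ht x v := (h.equation t (hJ ht) x v).mono hJ

/-! ### The equations for f and h, and the long-time behaviour. -/

namespace ContactCalabiYau

variable {a t : ℝ}

/-- The scale `1 + (25a²/2) t`. -/
theorem scale_pos (ha : 0 < a) (ht : t ∈ Set.Ioi (-(2 / (25 * a ^ 2)))) :
    0 < 1 + 25 * a ^ 2 / 2 * t := by
  have h1 : -(2 / (25 * a ^ 2)) < t := ht
  have h2 : 0 < 25 * a ^ 2 / 2 := by positivity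
  have h3 := mul_lt_mul_of_pos_left h1 h2
  have h4 : 25 * a ^ 2 / 2 * -(2 / (25 * a ^ 2)) = -1 := by
    field_simp
  linarith

theorem Ici_subset (ha : 0 < a) : Set.Ici (0 : ℝ) ⊆ Set.Ioi (-(2 / (25 * a ^ 2))) := by
  intro t ht
  have h1 : 0 < 2 / (25 * a ^ 2) := by positivity
  exact lt_of_lt_of_le (neg_lt_zero.mpr h1) ht

theorem fFun_ne (ha : 0 < a) (ht : t ∈ Set.Ioi (-(2 / (25 * a ^ 2)))) : fFun a t ≠ 0 :=
  (mul_pos ha (Real.rpow_pos_of_pos (scale_pos ha ht) _)).ne'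

theorem hFun_ne (ha : 0 < a) (ht : t ∈ Set.Ioi (-(2 / (25 * a ^ 2)))) : hFun a t ≠ 0 :=
  (Real.rpow_pos_of_pos (scale_pos ha ht) _).ne'

theorem contDiffOn_scale_rpow (ha : 0 < a) (p : ℝ) :
    ContDiffOn ℝ ∞ (fun t : ℝ => (1 + 25 * a ^ 2 / 2 * t) ^ p) (Set.Ioi (-(2 / (25 * a ^ 2)))) :=
  ContDiffOn.rpow_const_of_ne (by fun_prop) fun _ ht => (scale_pos ha ht).ne'

theorem hasDerivAt_scale_rpow (ha : 0 < a) (ht : t ∈ Set.Ioi (-(2 / (25 * a ^ 2)))) (p : ℝ) :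
    HasDerivAt (fun t : ℝ => (1 + 25 * a ^ 2 / 2 * t) ^ p)
      (25 * a ^ 2 / 2 * p * (1 + 25 * a ^ 2 / 2 * t) ^ (p - 1)) t := by
  have h1 : HasDerivAt (fun t : ℝ => 1 + 25 * a ^ 2 / 2 * t) (25 * a ^ 2 / 2) t := by
    simpa using ((hasDerivAt_id t).const_mul (25 * a ^ 2 / 2)).const_add 1
  exact h1.rpow_const (Or.inl (scale_pos ha ht).ne')

theorem fFun_mul_hFun_sq (ha : 0 < a) (ht : t ∈ Set.Ioi (-(2 / (25 * a ^ 2)))) :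
    fFun a t * hFun a t ^ 2 = a * (1 + 25 * a ^ 2 / 2 * t) ^ (-(1 / 10) : ℝ) := by
  have h0 := scale_pos ha ht
  rw [fFun, hFun, ← Real.rpow_mul_natCast h0.le, mul_assoc, ← Real.rpow_add h0]
  norm_num

theorem hFun_sq (ha : 0 < a) (ht : t ∈ Set.Ioi (-(2 / (25 * a ^ 2)))) :
    hFun a t ^ 2 = (1 + 25 * a ^ 2 / 2 * t) ^ (1 / 5 : ℝ) := by
  have h0 := scale_pos ha ht
  rw [hFun, ← Real.rpow_mul_natCast h0.le]
  norm_num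

theorem hFun_cube (ha : 0 < a) (ht : t ∈ Set.Ioi (-(2 / (25 * a ^ 2)))) :
    hFun a t ^ 3 = (1 + 25 * a ^ 2 / 2 * t) ^ (3 / 10 : ℝ) := by
  have h0 := scale_pos ha ht
  rw [hFun, ← Real.rpow_mul_natCast h0.le]
  norm_num

/-- The exponents add up to -3/10 - 1/5 = -1/2, and squaring gives -1. -/
theorem fFun_div_hFun_sq (ha : 0 < a) (ht : t ∈ Set.Ioi (-(2 / (25 * a ^ 2)))) :
    (fFun a t / hFun a t ^ 2) ^ 2 = a ^ 2 / (1 + 25 * a ^ 2 / 2 * t) := by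
  have h0 := scale_pos ha ht
  have h1 : ((-(3 / 10) - 1 / 5 : ℝ) * (2 : ℕ)) = -1 := by norm_num
  rw [hFun_sq ha ht, fFun, mul_div_assoc, ← Real.rpow_sub h0, mul_pow,
    ← Real.rpow_mul_natCast h0.le, h1, Real.rpow_neg_one]
  exact (div_eq_mul_inv _ _).symm

/-- The exponent of f h² is -1/10, and (1/10)(25a²/2) = (5/4)a². -/
theorem hasDerivAt_fFun_mul (ha : 0 < a) (ht : t ∈ Set.Ioi (-(2 / (25 * a ^ 2)))) :
    HasDerivAt (fun s => fFun a s * hFun a s ^ 2)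
      (-(5 / 4 * (fFun a t / hFun a t ^ 2) ^ 2 * (fFun a t * hFun a t ^ 2))) t := by
  have h0 := scale_pos ha ht
  have h1 := (hasDerivAt_scale_rpow ha ht (-(1 / 10))).const_mul a
  have h2 := h1.congr_of_eventuallyEq (f₁ := fun s => fFun a s * hFun a s ^ 2)
    (Filter.eventually_of_mem (isOpen_Ioi.mem_nhds ht) fun s hs => fFun_mul_hFun_sq ha hs)
  refine h2.congr_deriv ?_
  rw [fFun_mul_hFun_sq ha ht, fFun_div_hFun_sq ha ht, Real.rpow_sub_one h0.ne']
  ring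

/-- The exponent of h³ is 3/10, and (3/10)(25a²/2) = 3 · (5/4)a². -/
theorem hasDerivAt_hFun_cube (ha : 0 < a) (ht : t ∈ Set.Ioi (-(2 / (25 * a ^ 2)))) :
    HasDerivAt (fun s => hFun a s ^ 3)
      (5 / 4 * (fFun a t / hFun a t ^ 2) ^ 2 * (3 * hFun a t ^ 3)) t := by
  have h0 := scale_pos ha ht
  have h1 := hasDerivAt_scale_rpow ha ht (3 / 10)
  have h2 := h1.congr_of_eventuallyEq (f₁ := fun s => hFun a s ^ 3)
    (Filter.eventually_of_mem (isOpen_Ioi.mem_nhds ht) fun s hs => hFun_cube ha hs)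
  refine h2.congr_deriv ?_
  rw [hFun_cube ha ht, fFun_div_hFun_sq ha ht, Real.rpow_sub_one h0.ne']
  ring

theorem mul_scale_le (ha : 0 < a) (ht : 0 ≤ t) :
    t * (a ^ 2 / (1 + 25 * a ^ 2 / 2 * t)) ≤ 2 / 25 := by
  rw [← mul_div_assoc, div_le_iff₀ (by positivity)]
  linarith

theorem exists_le_div_hFun_sq (ha : 0 < a) {N : ℝ} (hN : 0 ≤ N) :
    ∃ t ∈ Set.Ici (0 : ℝ), N ≤ t / hFun a t ^ 2 := by
  obtain ⟨b, hb⟩ : ∃ b, b = 25 * a ^ 2 / 2 := ⟨_, rfl⟩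
  have hb0 : 0 < b := by rw [hb]; positivity
  -- The time is chosen so that 1 + bt = s⁵, hence h² = s. Then t / h² = (s⁵ - 1) / (bs) ≥ (s - 1) /
  -- b = N.
  obtain ⟨s, hs⟩ : ∃ s, s = 1 + b * N := ⟨_, rfl⟩
  have hs1 : 1 ≤ s := by rw [hs]; nlinarith
  have hs5 : 1 ≤ s ^ 5 := one_le_pow₀ hs1
  have ht : (s ^ 5 - 1) / b ∈ Set.Ici (0 : ℝ) := div_nonneg (sub_nonneg.mpr hs5) hb0.le
  refine ⟨(s ^ 5 - 1) / b, ht, ?_⟩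
  have hu : 1 + b * ((s ^ 5 - 1) / b) = s ^ 5 := by
    field_simp
    ring
  have hs4 : 1 ≤ s ^ 4 := one_le_pow₀ hs1
  rw [hFun_sq ha (Ici_subset ha ht), ← hb, hu, ← Real.rpow_natCast_mul (by linarith)]
  norm_num
  rw [le_div_iff₀ (by linarith), le_div_iff₀ hb0]
  have h1 : N * s * b = s * (s - 1) := by
    rw [hs]
    ring
  have h2 : s ^ 2 ≤ s ^ 5 := pow_le_pow_right₀ hs1 (by norm_num)
  rw [h1]
  linarith [sq s]

variable {M : Type*} [TopologicalSpace M] [ChartedSpace E7 M] [IsManifold (𝓡 7) ∞ M]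
variable (S : ContactCalabiYau M)

theorem flowSolution_inChart (x : M) {y : E7} (hy : y ∈ (extChartAt (𝓡 7) x).target)
    (X Y Z : E7) : (S.flowSolution a t).inChart x y ![X, Y, Z]
      = (S.localCCY x).phiT (fFun a t) (hFun a t) y X Y Z :=
  S.ansatz_inChart x (fFun a t) (hFun a t) hy X Y Z

theorem flowSolution_zero : S.flowSolution a 0 = S.initialForm a := by
  simp [flowSolution, initialForm, fFun, hFun]

/-- The velocity is again a combination of η ∧ ω and Re Υ, so the flow equation is the pair of
scalar equations for their coefficients. -/
theorem isRicciLikeFlow_flowSolution (ha : 0 < a) :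
    IsRicciLikeFlow (S.flowSolution a) (Set.Ioi (-(2 / (25 * a ^ 2)))) where
  smooth x := by
    have hf : ContDiffOn ℝ ∞ (fFun a) (Set.Ioi (-(2 / (25 * a ^ 2)))) :=
      contDiffOn_const.mul (contDiffOn_scale_rpow ha _)
    have hh : ContDiffOn ℝ ∞ (hFun a) (Set.Ioi (-(2 / (25 * a ^ 2)))) :=
      contDiffOn_scale_rpow ha _
    refine contDiffOn_of_curry3 (((S.localCCY x).contDiffOn_phiT hf hh).congr fun p hp => ?_)
    ext X Y Z
    exact S.flowSolution_inChart x hp.2 X Y Z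
  isG2Structure t ht x := (S.localCCY x).isG2Structure (fFun_ne ha ht) (hFun_ne ha ht)
    (fun y hy => S.flowSolution_inChart x hy) (base_mem x)
  equation t ht x v := by
    refine HasDerivAt.hasDerivWithinAt ?_
    rw [(S.localCCY x).flowVelocity_eq (fFun_ne ha ht) (hFun_ne ha ht)
      (fun y hy => S.flowSolution_inChart x hy) (base_mem x)]
    have e : v = ![v 0, v 1, v 2] := by
      funext i
      fin_cases i <;> rfl
    have h1 := fun s => (S.flowSolution_inChart (a := a) (t := s) x (base_mem x)
      (v 0) (v 1) (v 2)).trans (LocalCCY.phiT_apply ..)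
    rw [← e] at h1
    simp only [h1]
    refine (((hasDerivAt_fFun_mul ha ht).mul_const _).add
      ((hasDerivAt_hFun_cube ha ht).mul_const _)).congr_deriv ?_
    ring

theorem lambdaAt_flowSolution_of_flat (ha : 0 < a) (ht : t ∈ Set.Ioi (-(2 / (25 * a ^ 2))))
    (hS : S.IsTransverselyFlat) (x : M) :
    lambdaAt ((S.flowSolution a t).inChart x) (base x)
      = a ^ 2 / (1 + 25 * a ^ 2 / 2 * t) * lambdaC := by
  rw [(S.localCCY x).lambdaAt_of_flat (fFun_ne ha ht) (hFun_ne ha ht)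
    (fun y hy => S.flowSolution_inChart x hy) (base_mem x), fFun_div_hFun_sq ha ht]
  intro X Y Z
  rw [← (S.localCCY x).curvature_transverse (base_mem x), ← S.transverseConnection_eq]
  exact hS x X Y Z

/-- Λ equals a²/(1 + 25a²t/2) times a constant that does not depend on the point, so tΛ is bounded
by 2/25 times that constant. -/
theorem hasTypeIIISingularity_flowSolution (ha : 0 < a) (hS : S.IsTransverselyFlat) :
    HasTypeIIISingularity (S.flowSolution a) := by
  refine ⟨(S.isRicciLikeFlow_flowSolution ha).mono (Ici_subset ha), ?_⟩
  refine lt_of_le_of_lt (iSup₂_le fun t ht => ?_)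
    (ENNReal.ofReal_lt_top (r := 2 / 25 * lambdaC))
  rw [supLambda, ENNReal.mul_iSup]
  refine iSup_le fun x => ?_
  have ht0 : 0 ≤ t := ht
  rw [S.lambdaAt_flowSolution_of_flat ha (Ici_subset ha ht) hS, ← ENNReal.ofReal_mul ht0]
  refine ENNReal.ofReal_le_ofReal ?_
  rw [← mul_assoc]
  refine mul_le_mul_of_nonneg_right (mul_scale_le ha ht0) (Real.sqrt_nonneg _)

/-- A nonzero component r of the transverse curvature at a single point suffices: there tΛ is at
least t|r|/h² minus a bounded term. -/
theorem hasTypeIIbSingularity_flowSolution (ha : 0 < a) (hS : ¬ S.IsTransverselyFlat) :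
    HasTypeIIbSingularity (S.flowSolution a) := by
  refine ⟨(S.isRicciLikeFlow_flowSolution ha).mono (Ici_subset ha), ?_⟩
  unfold IsTransverselyFlat at hS
  push Not at hS
  obtain ⟨x, X, Y, Z, hR⟩ := hS
  rw [S.transverseConnection_eq, (S.localCCY x).curvature_transverse (base_mem x)] at hR
  obtain ⟨u, hu, -⟩ := (S.localCCY x).exists_normalized (base_mem x)
  obtain ⟨i, j, k, l, hr⟩ := (S.localCCY x).exists_frame_R_ne (base_mem x) hu hR
  have hL := fun t (ht : t ∈ Set.Ici (0 : ℝ)) => (S.localCCY x).le_lambdaAt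
    (fFun_ne ha (Ici_subset ha ht)) (hFun_ne ha (Ici_subset ha ht))
    (fun y hy => S.flowSolution_inChart x hy) (base_mem x) hu i j k l
  have hr := abs_pos.mpr hr
  obtain ⟨r, hr'⟩ : ∃ r, r = |(S.localCCY x).g (base x) ((S.localCCY x).R (base x)
      (unitaryFrame ((S.localCCY x).ξ (base x)) ((S.localCCY x).Φ (base x)) u i)
      (unitaryFrame ((S.localCCY x).ξ (base x)) ((S.localCCY x).Φ (base x)) u j)
      (unitaryFrame ((S.localCCY x).ξ (base x)) ((S.localCCY x).Φ (base x)) u k))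
      (unitaryFrame ((S.localCCY x).ξ (base x)) ((S.localCCY x).Φ (base x)) u l)| := ⟨_, rfl⟩
  rw [← hr'] at hr
  simp only [← hr'] at hL
  have hc : 0 ≤ |(rmC i j k l : ℝ)| / 4 := by positivity
  generalize |(rmC i j k l : ℝ)| / 4 = c at hL hc
  refine ENNReal.eq_top_of_forall_nnreal_le fun N => ?_
  -- The bound makes t r / h² at least N + 2c/25, and the term subtracted from it is at most 2c/25.
  obtain ⟨t, ht, h1⟩ := exists_le_div_hFun_sq ha (N := (N + 2 / 25 * c) / r) (by positivity)
  refine le_trans ?_ (le_iSup₂ (f := fun t (_ : t ∈ Set.Ici (0 : ℝ)) =>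
    ENNReal.ofReal t * supLambda (S.flowSolution a t)) t ht)
  refine le_trans ?_ (mul_le_mul_right (le_iSup (fun x : M =>
    ENNReal.ofReal (lambdaAt (Form.inChart (S.flowSolution a t) x) (base x))) x) _)
  rw [← ENNReal.ofReal_mul ht, ← ENNReal.ofReal_coe_nnreal]
  refine ENNReal.ofReal_le_ofReal ?_
  have h2 := mul_le_mul_of_nonneg_left (hL t ht) ht
  have h3 := mul_le_mul_of_nonneg_right (mul_scale_le ha ht) hc
  rw [fFun_div_hFun_sq ha (Ici_subset ha ht)] at h2
  rw [div_le_iff₀ hr] at h1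
  have h4 : t * (r / hFun a t ^ 2 - a ^ 2 / (1 + 25 * a ^ 2 / 2 * t) * c)
      = t / hFun a t ^ 2 * r - t * (a ^ 2 / (1 + 25 * a ^ 2 / 2 * t)) * c := by ring
  linarith

end ContactCalabiYau

end G2Flow

theorem mainTheorem6 {M : Type*} [TopologicalSpace M] [T2Space M] [CompactSpace M]
    [ChartedSpace G2Flow.E7 M] [IsManifold (𝓡 7) ∞ M]
    (S : G2Flow.ContactCalabiYau M) (a : ℝ) (ha : 0 < a) :
    G2Flow.IsRicciLikeFlow (S.flowSolution a) (Set.Ioi (-(2 / (25 * a ^ 2)))) ∧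
    S.flowSolution a 0 = S.initialForm a ∧
    (¬ S.IsTransverselyFlat → G2Flow.HasTypeIIbSingularity (S.flowSolution a)) ∧
    (S.IsTransverselyFlat → G2Flow.HasTypeIIISingularity (S.flowSolution a)) :=
  ⟨S.isRicciLikeFlow_flowSolution ha, S.flowSolution_zero,
    S.hasTypeIIbSingularity_flowSolution ha, S.hasTypeIIISingularity_flowSolution ha⟩
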